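/- For functions $f:\mathbb N\to\mathbb N$ and $g:\mathbb N\to\mathbb R$, let $NDTIME(f(n),g(n))$ be the class of languages $L\subseteq\{0,1\}^*$ solvable in $O(g(n))$ time by a multi-tape Turing machine using an $f(n)$-bit nondeterministic oracle; that is, there is a deterministic multi-tape Turing machine which on every input $x$ of length $n$ and every string $y\in\{0,1\}^{f(n)}$, given on a separate tape, halts within $O(g(n))$ steps, and $x\in L$ iff the machine accepts $(x,y)$ for at least one $y\in\{0,1\}^{f(n)}$. Let $DTIME(g(n))=NDTIME(0,g(n))$. Let $\omega$ be the exponent of matrix multiplication over a field $K$ (an arbitrary field, fixed throughout), i.e. the infimum of all real $\tau$ such that two $n\times n$ matrices over $K$ can be multiplied with $O(n^{\tau})$ arithmetic operations (additions, subtractions, multiplications) by straight-line programs. **Theorem.** Let $\ell\ge 3$ be an integer divisible by $3$. Suppose that for every $\epsilon>0$, the problem of detecting an $\ell$-clique in an undirected simple graph on $N$ vertices (given by $N$ and its adjacency matrix) does not admit an $O(N^{\omega\ell/3-\epsilon+o(1)})$-time algorithm on a random access machine with logarithmic cost. Then for every $\epsilon'>0$, $$NDTIME\bigl((\ell-2)\lceil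 \tfrac12\log_2 n\rceil,\ n\bigr)\not\subseteq DTIME\bigl(n^{\omega\ell/6-\epsilon'}\bigr).$$ -/

import Mathlib

open Filter Asymptotics
open scoped Topology

/-! ### Multi-tape Turing machines and time classes -/

/-- A deterministic multi-tape Turing machine over the input alphabet `{0,1}`, with `k + 2`
two-way infinite tapes: tape `0` holds the input, tape `1` holds the bits of the nondeterministic
oracle, and there are `k` further work tapes (all tapes may be read and written).
The tape alphabet is `Option (Bool ⊕ A)`, with `none` the blank symbol. A state `q` with
`verdict q = some b` is halting (accepting for `b = true`, rejecting for `b = false`). -/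
structure MultiTapeTM where
  k : ℕ
  A : Type
  Q : Type
  [finA : Finite A]
  [finQ : Finite Q]
  start : Q
  verdict : Q → Option Bool
  /-- new state, symbols to write, and head moves (`none` means that the head stays) -/
  δ : Q → (Fin (k + 2) → Option (Bool ⊕ A)) →
    Q × (Fin (k + 2) → Option (Bool ⊕ A)) × (Fin (k + 2) → Option Turing.Dir)

namespace MultiTapeTM

/-- The tape alphabet. -/
abbrev Sym (M : MultiTapeTM) : Type := Option (Bool ⊕ M.A)

/-- A configuration: the state and the tapes with their head positions. -/
structure Cfg (M : MultiTapeTM) where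
  state : M.Q
  tapes : Fin (M.k + 2) → Turing.Tape M.Sym

/-- Optional head move. -/
def moveHead {Γ : Type} [Inhabited Γ] : Option Turing.Dir → Turing.Tape Γ → Turing.Tape Γ
  | none, t => t
  | some d, t => t.move d

/-- One step of the machine; halting configurations do not change. -/
def step (M : MultiTapeTM) (c : M.Cfg) : M.Cfg :=
  match M.verdict c.state with
  | some _ => c
  | none =>
    let a := M.δ c.state (fun i => (c.tapes i).head)
    { state := a.1
      tapes := fun i => moveHead (a.2.2 i) ((c.tapes i).write (a.2.1 i)) }

/-- The tape that holds the bit string `w` with the head on its first bit. -/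
def bitTape (M : MultiTapeTM) (w : List Bool) : Turing.Tape M.Sym :=
  Turing.Tape.mk₁ (w.map fun b => some (Sum.inl b))

/-- Start configuration on input `x` with oracle bits `y`. -/
def init (M : MultiTapeTM) (x y : List Bool) : M.Cfg where
  state := M.start
  tapes := fun i =>
    if i.val = 0 then M.bitTape x else if i.val = 1 then M.bitTape y else M.bitTape []

/-- On input `x` with oracle bits `y` the machine halts with verdict `b` within `t` steps. -/
def HaltsWithin (M : MultiTapeTM) (x y : List Bool) (b : Bool) (t : ℕ) : Prop :=
  M.verdict (M.step^[t] (M.init x y)).state = some b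

end MultiTapeTM

/-- `NDTIME f g`: the languages `L` over `{0,1}` that some multi-tape Turing machine solves in
`O(g(n))` time with an `f(n)`-bit nondeterministic oracle. On inputs of length `n` the machine halts
within `T n = O(g(n))` steps for each of the `2 ^ f n` possible strings of oracle bits, and the
input belongs to `L` iff at least one of these strings makes the machine accept. -/
def NDTIME (f : ℕ → ℕ) (g : ℕ → ℝ) : Set (Language Bool) :=
  {L | ∃ (M : MultiTapeTM) (T : ℕ → ℕ),
    (fun n => (T n : ℝ)) =O[atTop] g ∧
    (∀ x y : List Bool, y.length = f x.length → ∃ b, M.HaltsWithin x y b (T x.length)) ∧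
    ∀ x : List Bool, x ∈ L ↔
      ∃ y : List Bool, y.length = f x.length ∧ M.HaltsWithin x y true (T x.length)}

/-- Deterministic time `O(g(n))` on multi-tape Turing machines. -/
def DTIME (g : ℕ → ℝ) : Set (Language Bool) := NDTIME (fun _ => 0) g

/-! ### Random access machines with logarithmic cost -/

namespace RAM

/-- Register addresses: direct `i`, and indirect `*i`. -/
inductive Addr where
  | dir (i : ℕ)
  | ind (i : ℕ)

/-- Operands: a literal `=z`, or the contents of a register. -/
inductive Operand where
  | lit (z : ℤ)
  | reg (a : Addr)

/-- The instructions; register `0` is the accumulator, jump targets are positions in the program. -/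
inductive Instr where
  | load (a : Operand)
  | store (a : Addr)
  | add (a : Operand)
  | sub (a : Operand)
  | mult (a : Operand)
  | div (a : Operand)
  | read (a : Addr)
  | write (a : Operand)
  | jump (l : ℕ)
  | jgtz (l : ℕ)
  | jzero (l : ℕ)
  | halt

/-- A program is a finite list of instructions. -/
abbrev Program : Type := List Instr

/-- A configuration: program counter, registers, unread input and output so far. -/
structure Cfg where
  pc : ℕ
  reg : ℕ → ℤ
  input : List ℤ
  output : List ℤ

/-- The logarithmic size of an integer: `⌊log₂ |z|⌋ + 1`, and `1` for `z = 0`. -/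
def size (z : ℤ) : ℕ := Nat.log 2 z.natAbs + 1

/-- The register an address denotes (none for an indirect address with negative contents). -/
def Addr.resolve (r : ℕ → ℤ) : Addr → Option ℕ
  | .dir i => some i
  | .ind i => if 0 ≤ r i then some (r i).toNat else none

/-- The logarithmic cost of accessing an address. -/
def Addr.cost (r : ℕ → ℤ) : Addr → ℕ
  | .dir i => size i
  | .ind i => size i + size (r i)

/-- The value of an operand together with its logarithmic cost. -/
def Operand.fetch (r : ℕ → ℤ) : Operand → Option (ℤ × ℕ)
  | .lit z => some (z, size z)
  | .reg a => (a.resolve r).map fun j => (r j, a.cost r + size (r j))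

/-- Advance to the next instruction with the value `z` stored in register `j`. -/
def Cfg.set (c : Cfg) (j : ℕ) (z : ℤ) : Cfg :=
  { c with pc := c.pc + 1, reg := Function.update c.reg j z }

/-- Execution of one instruction other than `halt`: the next configuration and the cost of the
instruction. It is undefined for `halt`, for an indirect access through a negative address, and for
a division by zero. Division rounds down; reading beyond the end of the input gives `0`. -/
def exec (c : Cfg) : Instr → Option (Cfg × ℕ)
  | .load a => (a.fetch c.reg).map fun v => (c.set 0 v.1, v.2)
  | .store a => (a.resolve c.reg).map fun j =>
      (c.set j (c.reg 0), size (c.reg 0) + a.cost c.reg)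
  | .add a => (a.fetch c.reg).map fun v => (c.set 0 (c.reg 0 + v.1), size (c.reg 0) + v.2)
  | .sub a => (a.fetch c.reg).map fun v => (c.set 0 (c.reg 0 - v.1), size (c.reg 0) + v.2)
  | .mult a => (a.fetch c.reg).map fun v => (c.set 0 (c.reg 0 * v.1), size (c.reg 0) + v.2)
  | .div a => (a.fetch c.reg).bind fun v =>
      if v.1 = 0 then none
      else some (c.set 0 (Int.fdiv (c.reg 0) v.1), size (c.reg 0) + v.2)
  | .read a => (a.resolve c.reg).map fun j =>
      let z := c.input.headD 0
      ({ c.set j z with input := c.input.tail }, size z + a.cost c.reg)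
  | .write a => (a.fetch c.reg).map fun v =>
      ({ c with pc := c.pc + 1, output := c.output ++ [v.1] }, v.2)
  | .jump l => some ({ c with pc := l }, 1)
  | .jgtz l => some ({ c with pc := if 0 < c.reg 0 then l else c.pc + 1 }, size (c.reg 0))
  | .jzero l => some ({ c with pc := if c.reg 0 = 0 then l else c.pc + 1 }, size (c.reg 0))
  | .halt => none

/-- `Computes P c out t`: started in `c`, the program `P` reaches a `halt` instruction, its
output is then `out`, and the total logarithmic cost of the executed instructions is `t`. -/
inductive Computes (P : Program) : Cfg → List ℤ → ℕ → Prop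
  | halt {c : Cfg} : P[c.pc]? = some .halt → Computes P c c.output 1
  | step {c c' : Cfg} {i : Instr} {s t : ℕ} {out : List ℤ} :
      P[c.pc]? = some i → exec c i = some (c', s) → Computes P c' out t →
      Computes P c out (s + t)

/-- The start configuration: all registers are `0`. -/
def init (input : List ℤ) : Cfg where
  pc := 0
  reg := fun _ => 0
  input := input
  output := []

end RAM

/-! ### The clique problem -/

open Classical in
/-- The input of the RAM for a graph on `N` vertices: `N`, then the adjacency matrix by rows. -/
noncomputable def encodeGraph {N : ℕ} (G : SimpleGraph (Fin N)) : List ℤ :=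
  (N : ℤ) :: (List.finRange N).flatMap fun i =>
    (List.finRange N).map fun j => if G.Adj i j then 1 else 0

open Classical in
/-- The program `P` decides whether a graph contains an `l`-clique (output `1` for yes, `0` for no)
and its logarithmic-cost running time on graphs with `N` vertices is at most `T N`. -/
def DetectsClique (l : ℕ) (P : RAM.Program) (T : ℕ → ℕ) : Prop :=
  ∀ (N : ℕ) (G : SimpleGraph (Fin N)), ∃ t ≤ T N,
    RAM.Computes P (RAM.init (encodeGraph G)) [if G.CliqueFree l then 0 else 1] t

/-- Detecting an `l`-clique in a graph on `N` vertices admits an `O(N ^ (d + o(1)))`-time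
algorithm. -/
def CliqueInTime (l : ℕ) (d : ℝ) : Prop :=
  ∃ (P : RAM.Program) (T : ℕ → ℕ) (η : ℕ → ℝ),
    DetectsClique l P T ∧ Tendsto η atTop (𝓝 0) ∧
    (fun N => (T N : ℝ)) =O[atTop] fun N => (N : ℝ) ^ (d + η N)

/-! ### The exponent of matrix multiplication -/

namespace StraightLine

/-- Arguments of a gate: an indeterminate, a scalar, or the result of an earlier gate. -/
inductive Arg (K σ : Type*) where
  | var (x : σ)
  | const (c : K)
  | gate (i : ℕ)

/-- An arithmetic operation on two arguments. -/
inductive Gate (K σ : Type*) where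
  | add (a b : Arg K σ)
  | sub (a b : Arg K σ)
  | mul (a b : Arg K σ)

variable {K σ : Type*} [Field K]

/-- The value of an argument, where `v` lists the results of the earlier gates. -/
noncomputable def Arg.val (v : List (MvPolynomial σ K)) : Arg K σ → MvPolynomial σ K
  | .var x => MvPolynomial.X x
  | .const c => MvPolynomial.C c
  | .gate i => v.getD i 0

/-- The result of a gate, where `v` lists the results of the earlier gates. -/
noncomputable def Gate.val (v : List (MvPolynomial σ K)) : Gate K σ → MvPolynomial σ K
  | .add a b => a.val v + b.val v
  | .sub a b => a.val v - b.val v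
  | .mul a b => a.val v * b.val v

/-- The results of all gates of a straight-line program, in order. -/
noncomputable def results (p : List (Gate K σ)) : List (MvPolynomial σ K) :=
  p.foldl (fun v g => v ++ [g.val v]) []

end StraightLine

/-- The straight-line program `p` computes all entries of the product of two generic
`n × n` matrices over `K`. -/
def ComputesMatMul (K : Type*) [Field K] (n : ℕ)
    (p : List (StraightLine.Gate K ((Fin n × Fin n) ⊕ (Fin n × Fin n)))) : Prop :=
  ∀ i j : Fin n,
    (∑ m : Fin n, MvPolynomial.X (Sum.inl (i, m)) * MvPolynomial.X (Sum.inr (m, j)))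
      ∈ StraightLine.results p

/-- The exponent `ω` of matrix multiplication over `K`: the infimum of the real numbers `τ` such
that two `n × n` matrices can be multiplied with `O(n ^ τ)` arithmetic operations. -/
noncomputable def matMulExponent (K : Type*) [Field K] : ℝ :=
  sInf {τ : ℝ |
    ∃ p : (n : ℕ) → List (StraightLine.Gate K ((Fin n × Fin n) ⊕ (Fin n × Fin n))),
      (∀ n, ComputesMatMul K n (p n)) ∧
      (fun n => ((p n).length : ℝ)) =O[atTop] fun n : ℕ => (n : ℝ) ^ τ}

/-! Write c for the exponent ωℓ/6 − ε', put m = ℓ − 2, and suppose the inclusion holds.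

If c < 1, it fails for an elementary reason: recognising the words that contain a bit 1 takes linear
time, and a machine that halts within n − 1 steps has never seen the last of n bits
(`not_NDTIME_subset_DTIME_of_lt_one`).

If c ≥ 1, the inclusion yields a clique algorithm. A nondeterministic machine guesses m vertices of
the clique. The remaining two need no guessing: they are the ends of an edge whose two ends are
adjacent to all guesses, and such an edge is found in one pass over the adjacency matrix. A word for
a graph on N vertices has length n with N² ≤ n = O(N²), so ½ log₂ n bits suffice for the label of a
vertex, and m such labels are the available oracle.

A Turing machine has no random access, so the heads must be steered to the right cells without loss
of time. This is left to the input: it is not the bare matrix but a list of operations (compare a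
label bit, move a head, process a matrix entry, evaluate a row), each coded in unary by boundedly
many bits. A machine that spends one step on each bit executes them, so its language lies in
NDTIME(·, n) by construction (`StreamMachine.language_mem_NDTIME`), whatever it does on other words.
Only on the words of graphs is its behaviour analysed (`CliqueOp.foldl_graphOps`,
`CliqueOp.graphWord_mem_language`).

By the inclusion some deterministic machine decides this language in time O(n^c). A random access
machine reads the graph, writes the word into its memory in O(N²) instructions
(`MultiTapeTM.graphFrag_does`) and simulates the deterministic machine with O(1) instructions per
step (`MultiTapeTM.simulate_does`). All numbers stay polynomial in N, so the logarithmic cost adds a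
factor O(log N), which is N^{o(1)}. The total is N^{2c + o(1)} (`cliqueInTime_of_mem_DTIME`), and 2c
= ωℓ/3 − 2ε' contradicts the assumed hardness. The number ω enters only through that assumption.

The random access programs are assembled from relocatable fragments. The judgement `RAM.Does`
records the effect of a fragment on an abstract state and counts instructions; the size of the
numbers is bounded once and for all by a parameter V. -/

namespace RAM

/-! ### Structured programs for the random access machine -/

/-- `Steps P C c c' n`: the program `P` leads from `c` to `c'` by `n` instructions, each of
cost at most `C`. -/
inductive Steps (P : Program) (C : ℕ) : Cfg → Cfg → ℕ → Prop
  | refl (c : Cfg) : Steps P C c c 0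
  | head {c c' c'' : Cfg} {i : Instr} {s n : ℕ} :
      P[c.pc]? = some i → exec c i = some (c', s) → s ≤ C → Steps P C c' c'' n →
      Steps P C c c'' (n + 1)

theorem Steps.trans {P : Program} {C : ℕ} {a b c : Cfg} {m n : ℕ} (h : Steps P C a b m)
    (h' : Steps P C b c n) : Steps P C a c (m + n) := by
  induction h with
  | refl => simpa using h'
  | head h1 h2 h3 _ ih =>
    have := Steps.head h1 h2 h3 (ih h')
    rwa [show ∀ k, k + 1 + n = k + n + 1 from fun k => by omega]

/-- This converts a count of instructions into logarithmic cost; the uniform bound C per instruction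
is the only place where sizes matter. -/
theorem Steps.computes {P : Program} {C : ℕ} {a b : Cfg} {n t : ℕ} {out : List ℤ}
    (h : Steps P C a b n) (h' : Computes P b out t) : ∃ t' ≤ C * n + t, Computes P a out t' := by
  induction h with
  | refl => exact ⟨t, by omega, h'⟩
  | head h1 h2 h3 _ ih =>
    obtain ⟨t', ht', hc⟩ := ih h'
    exact ⟨_, by rw [Nat.mul_succ]; omega, Computes.step h1 h2 hc⟩

/-- `At P o L`: the list `L` of instructions stands in `P` from position `o` on. -/
def At (P : Program) (o : ℕ) (L : List Instr) : Prop :=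
  ∀ i x, L[i]? = some x → P[o + i]? = some x

theorem At.left {P : Program} {o : ℕ} {L L' : List Instr} (h : At P o (L ++ L')) : At P o L := by
  intro i x hx
  apply h
  rw [List.getElem?_append_left]
  · exact hx
  · by_contra hi
    rw [List.getElem?_eq_none (by omega)] at hx
    simp at hx

theorem At.right {P : Program} {o : ℕ} {L L' : List Instr} (h : At P o (L ++ L')) :
    At P (o + L.length) L' := by
  intro i x hx
  rw [add_assoc]
  apply h
  rw [List.getElem?_append_right (by omega)]
  simpa using hx

theorem At.head {P : Program} {o : ℕ} {i : Instr} {L : List Instr} (h : At P o (i :: L)) :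
    P[o]? = some i := h 0 i rfl

theorem At.tail {P : Program} {o : ℕ} {i : Instr} {L : List Instr} (h : At P o (i :: L)) :
    At P (o + 1) L := At.right (L := [i]) h

/-- A relocatable piece of program: its length, and its instructions for a given position. -/
structure Frag where
  len : ℕ
  code : ℕ → List Instr
  length_code : ∀ o, (code o).length = len

/-- An abstract state: variables, memory, unread input, and output. The accumulator is hidden. -/
structure HS where
  var : ℕ → ℤ
  mem : ℤ → ℤ
  inp : List ℤ
  out : List ℤ

/-- Assignment to a variable. -/
def HS.setv (h : HS) (i : ℕ) (z : ℤ) : HS := { h with var := Function.update h.var i z }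

/-- Assignment to a memory cell. -/
def HS.setm (h : HS) (a z : ℤ) : HS := { h with mem := Function.update h.mem a z }

/-- The configuration `c` represents `h`: variable `i < b` lives in register `i + 1`, the memory
cell `a > b` in register `a`, and all numbers are bounded by `V`. -/
structure Rel (b V : ℕ) (h : HS) (c : Cfg) : Prop where
  var : ∀ i < b, c.reg (i + 1) = h.var i
  mem : ∀ a : ℤ, (b : ℤ) < a → c.reg a.toNat = h.mem a
  inp : c.input = h.inp
  out : c.output = h.out
  bdd : ∀ j, |c.reg j| ≤ V
  bddInp : ∀ z ∈ c.input, |z| ≤ V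

/-- `Does b V F h h' n`: the fragment `F` transforms `h` into `h'` by at most `n` instructions
whose costs are bounded by four times the size of `V`. -/
def Does (b V : ℕ) (F : Frag) (h h' : HS) (n : ℕ) : Prop :=
  ∀ (P : Program) (o : ℕ), At P o (F.code o) → ∀ c : Cfg, c.pc = o → Rel b V h c →
    ∃ c' : Cfg, c'.pc = o + F.len ∧ Rel b V h' c' ∧ ∃ n' ≤ n, Steps P (4 * size V) c c' n'

theorem Does.mono {b V : ℕ} {F : Frag} {h h' : HS} {n n' : ℕ} (H : Does b V F h h' n)
    (hn : n ≤ n') : Does b V F h h' n' := by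
  intro P o hP c hc hr
  obtain ⟨c', h1, h2, k, hk, h3⟩ := H P o hP c hc hr
  exact ⟨c', h1, h2, k, hk.trans hn, h3⟩

theorem size_le_of_abs_le {z : ℤ} {V : ℕ} (h : |z| ≤ V) : size z ≤ size (V : ℤ) := by
  unfold size
  have : z.natAbs ≤ V := by rw [Int.abs_eq_natAbs] at h; exact_mod_cast h
  simpa using Nat.log_mono_right (b := 2) this

theorem one_le_size (z : ℤ) : 1 ≤ size z := by unfold size; omega

namespace Frag

/-- The empty fragment. -/
def skip : Frag := ⟨0, fun _ => [], fun _ => rfl⟩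

/-- Sequential composition. -/
def seq (F G : Frag) : Frag where
  len := F.len + G.len
  code o := F.code o ++ G.code (o + F.len)
  length_code o := by simp [F.length_code, G.length_code]

/-- Sequential composition of a list of fragments. -/
def seqs : List Frag → Frag
  | [] => skip
  | F :: l => F.seq (seqs l)

/-- `if` variable `v` is zero `then F else G`. -/
def ifz (v : ℕ) (F G : Frag) : Frag where
  len := G.len + F.len + 3
  code o := .load (.reg (.dir (v + 1))) :: .jzero (o + 3 + G.len) :: (G.code (o + 2) ++
    (.jump (o + 3 + G.len + F.len) :: F.code (o + 3 + G.len)))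
  length_code o := by simp [F.length_code, G.length_code]; omega

/-- `while` variable `v` is positive `do F`. -/
def loop (v : ℕ) (F : Frag) : Frag where
  len := F.len + 4
  code o := .load (.reg (.dir (v + 1))) :: .jgtz (o + 3) :: .jump (o + 4 + F.len) ::
    (F.code (o + 3) ++ [.jump o])
  length_code o := by simp [F.length_code]

/-- A fixed list of instructions. -/
def block (L : List Instr) : Frag := ⟨L.length, fun _ => L, fun _ => rfl⟩

end Frag

/-- An argument of an assignment: a literal or a variable. -/
inductive Src where
  | lit (z : ℤ)
  | var (i : ℕ)

/-- The corresponding operand. -/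
def Src.op : Src → Operand
  | .lit z => .lit z
  | .var i => .reg (.dir (i + 1))

/-- The value of an argument. -/
def Src.val (h : HS) : Src → ℤ
  | .lit z => z
  | .var i => h.var i

/-- An argument is admissible if it is a small literal or an existing variable. -/
def Src.Ok (b V : ℕ) : Src → Prop
  | .lit z => |z| ≤ V
  | .var i => i < b

theorem Src.Ok.fetch {b V : ℕ} {h : HS} {c : Cfg} {x : Src} (hx : x.Ok b V) (hV : b ≤ V)
    (hr : Rel b V h c) :
    ∃ s ≤ 2 * size V, x.op.fetch c.reg = some (x.val h, s) ∧ |x.val h| ≤ V := by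
  cases x with
  | lit z =>
    have := size_le_of_abs_le (V := V) hx
    exact ⟨size z, by omega, rfl, hx⟩
  | var i =>
    have hi : i < b := hx
    have h1 := hr.var i hi
    have h2 := hr.bdd (i + 1)
    have h3 := size_le_of_abs_le h2
    have h4 : size ((i + 1 : ℕ) : ℤ) ≤ size (V : ℤ) :=
      size_le_of_abs_le (by rw [Nat.abs_cast]; exact_mod_cast (by omega : i + 1 ≤ V))
    refine ⟨size ((i + 1 : ℕ) : ℤ) + size (c.reg (i + 1)), by omega, ?_, ?_⟩
    · simp [Src.op, Operand.fetch, Addr.resolve, Addr.cost, Src.val, h1]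
    · simpa [Src.val, ← h1] using h2

theorem Rel.setAcc {b V : ℕ} {h : HS} {c : Cfg} (hr : Rel b V h c) {z : ℤ} (hz : |z| ≤ V) :
    Rel b V h (c.set 0 z) where
  var i hi := by simpa [Cfg.set] using hr.var i hi
  mem a ha := by
    have : a.toNat ≠ 0 := by omega
    simpa [Cfg.set, Function.update_of_ne this] using hr.mem a ha
  inp := hr.inp
  out := hr.out
  bdd j := by
    by_cases hj : j = 0
    · subst hj; simpa [Cfg.set] using hz
    · simpa [Cfg.set, Function.update_of_ne hj] using hr.bdd j
  bddInp := hr.bddInp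

theorem Rel.setVar {b V : ℕ} {h : HS} {c : Cfg} (hr : Rel b V h c) {z : ℤ} (hz : |z| ≤ V) {i : ℕ}
    (hi : i < b) : Rel b V (h.setv i z) (c.set (i + 1) z) where
  var j hj := by
    by_cases hij : j = i
    · subst hij; simp [Cfg.set, HS.setv]
    · simpa [Cfg.set, HS.setv, Function.update_of_ne hij,
        Function.update_of_ne (show j + 1 ≠ i + 1 by omega)] using hr.var j hj
  mem a ha := by
    have : a.toNat ≠ i + 1 := by omega
    simpa [Cfg.set, HS.setv, Function.update_of_ne this] using hr.mem a ha
  inp := hr.inp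
  out := hr.out
  bdd j := by
    by_cases hj : j = i + 1
    · subst hj; simpa [Cfg.set] using hz
    · simpa [Cfg.set, Function.update_of_ne hj] using hr.bdd j
  bddInp := hr.bddInp

theorem Rel.setMem {b V : ℕ} {h : HS} {c : Cfg} (hr : Rel b V h c) {z : ℤ} (hz : |z| ≤ V) {a : ℤ}
    (ha : (b : ℤ) < a) : Rel b V (h.setm a z) (c.set a.toNat z) where
  var j hj := by
    simpa [Cfg.set, HS.setm, Function.update_of_ne (show j + 1 ≠ a.toNat by omega)]
      using hr.var j hj
  mem a' ha' := by
    by_cases hij : a' = a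
    · subst hij; simp [Cfg.set, HS.setm]
    · have : a'.toNat ≠ a.toNat := by omega
      simpa [Cfg.set, HS.setm, Function.update_of_ne this, Function.update_of_ne hij]
        using hr.mem a' ha'
  inp := hr.inp
  out := hr.out
  bdd j := by
    by_cases hj : j = a.toNat
    · subst hj; simpa [Cfg.set] using hz
    · simpa [Cfg.set, Function.update_of_ne hj] using hr.bdd j
  bddInp := hr.bddInp

theorem Rel.setPc {b V : ℕ} {h : HS} {c : Cfg} (hr : Rel b V h c) (n : ℕ) :
    Rel b V h { c with pc := n } := ⟨hr.var, hr.mem, hr.inp, hr.out, hr.bdd, hr.bddInp⟩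

/-! ### Proof rules for the control structures -/

section Rules

variable {b V : ℕ} {h h' h'' : HS} {F G : Frag} {n n' : ℕ}

theorem Does.skip : Does b V Frag.skip h h 0 := by
  intro P o _ c hc hr
  exact ⟨c, by simp [hc, Frag.skip], hr, 0, le_rfl, .refl c⟩

theorem Does.seq (H : Does b V F h h' n) (H' : Does b V G h' h'' n') :
    Does b V (F.seq G) h h'' (n + n') := by
  intro P o hP c hc hr
  obtain ⟨c', h1, h2, k, hk, h3⟩ := H P o (At.left hP) c hc hr
  have hP' := At.right hP
  rw [F.length_code] at hP'
  obtain ⟨c'', h1', h2', k', hk', h3'⟩ := H' P _ hP' c' h1 h2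
  exact ⟨c'', by simp [h1', Frag.seq, add_assoc], h2', k + k', by omega, h3.trans h3'⟩

/-- Loading a variable into the accumulator. -/
theorem load_var (hV : b ≤ V) {v : ℕ} (hv : v < b) {P : Program} {c : Cfg} (hr : Rel b V h c)
    (hP : P[c.pc]? = some (.load (.reg (.dir (v + 1))))) :
    Steps P (4 * size V) c (c.set 0 (h.var v)) 1 ∧ Rel b V h (c.set 0 (h.var v)) := by
  obtain ⟨s, hs, hf, hb⟩ := Src.Ok.fetch (x := .var v) hv hV hr
  have e : exec c (.load (.reg (.dir (v + 1)))) = some (c.set 0 (h.var v), s) := by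
    have hf' : (Operand.reg (.dir (v + 1))).fetch c.reg = some (h.var v, s) := hf
    simp [exec, hf']
  exact ⟨.head hP e (by omega) (.refl _), hr.setAcc hb⟩

theorem Does.ifz_zero (hV : b ≤ V) {v : ℕ} (hv : v < b) (h0 : h.var v = 0)
    (H : Does b V F h h' n) : Does b V (Frag.ifz v F G) h h' (n + 2) := by
  intro P o hP c hc hr
  subst hc
  obtain ⟨h1, h2⟩ := load_var hV hv hr hP.head
  have hz := size_le_of_abs_le (h2.bdd 0)
  have e : exec (c.set 0 (h.var v)) (.jzero (c.pc + 3 + G.len)) =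
      some ({ c.set 0 (h.var v) with pc := c.pc + 3 + G.len },
        size ((c.set 0 (h.var v)).reg 0)) := by
    simp [exec, Cfg.set, h0]
  have hP' := hP.tail.tail.right.tail
  rw [G.length_code, show c.pc + 1 + 1 + G.len + 1 = c.pc + 3 + G.len by omega] at hP'
  obtain ⟨c', h3, h4, k, hk, h5⟩ := H P _ hP' { c.set 0 (h.var v) with pc := c.pc + 3 + G.len } rfl
    (h2.setPc _)
  refine ⟨c', by simp only [h3, Frag.ifz]; omega, h4, 1 + (k + 1), by omega, h1.trans ?_⟩
  exact .head hP.tail.head e (by omega) h5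

theorem Does.ifz_ne (hV : b ≤ V) {v : ℕ} (hv : v < b) (h0 : h.var v ≠ 0)
    (H : Does b V G h h' n) : Does b V (Frag.ifz v F G) h h' (n + 3) := by
  intro P o hP c hc hr
  subst hc
  obtain ⟨h1, h2⟩ := load_var hV hv hr hP.head
  have hz := size_le_of_abs_le (h2.bdd 0)
  have e : exec (c.set 0 (h.var v)) (.jzero (c.pc + 3 + G.len)) =
      some ({ c.set 0 (h.var v) with pc := c.pc + 1 + 1 },
        size ((c.set 0 (h.var v)).reg 0)) := by
    simp [exec, Cfg.set, h0]
  have hP' := hP.tail.tail.left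
  obtain ⟨c', h3, h4, k, hk, h5⟩ := H P _ hP' { c.set 0 (h.var v) with pc := c.pc + 1 + 1 } rfl
    (h2.setPc _)
  have hP'' := hP.tail.tail.right.head
  rw [G.length_code, ← h3] at hP''
  refine ⟨{ c' with pc := c.pc + 3 + G.len + F.len }, by simp only [Frag.ifz]; omega,
    h4.setPc _, 1 + (k + 1 + 1), by omega, h1.trans ?_⟩
  refine .head hP.tail.head e (by omega) (h5.trans (.head hP'' rfl ?_ (.refl _)))
  have := one_le_size V
  omega

theorem Does.loop_exit (hV : b ≤ V) {v : ℕ} (hv : v < b) (h0 : h.var v ≤ 0) :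
    Does b V (Frag.loop v F) h h 3 := by
  intro P o hP c hc hr
  subst hc
  obtain ⟨h1, h2⟩ := load_var hV hv hr hP.head
  have hz := size_le_of_abs_le (h2.bdd 0)
  have e : exec (c.set 0 (h.var v)) (.jgtz (c.pc + 3)) =
      some ({ c.set 0 (h.var v) with pc := c.pc + 1 + 1 },
        size ((c.set 0 (h.var v)).reg 0)) := by
    simp [exec, Cfg.set, h0.not_gt]
  refine ⟨{ c.set 0 (h.var v) with pc := c.pc + 4 + F.len }, by simp only [Frag.loop]; omega,
    h2.setPc _, 3, by omega, h1.trans (.head hP.tail.head e (by omega) (.head hP.tail.tail.head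
      rfl ?_ (.refl _)))⟩
  have := one_le_size V
  omega

/-- One round is peeled off: the closing jump returns to the first instruction of the same code, so
the rest of the run is again a run of the loop. The three extra instructions are the load, the test
and that jump. -/
theorem Does.loop_step (hV : b ≤ V) {v : ℕ} (hv : v < b) (h0 : 0 < h.var v)
    (H : Does b V F h h' n) (H' : Does b V (Frag.loop v F) h' h'' n') :
    Does b V (Frag.loop v F) h h'' (n + n' + 3) := by
  intro P o hP c hc hr
  subst hc
  obtain ⟨h1, h2⟩ := load_var hV hv hr hP.head
  have hz := size_le_of_abs_le (h2.bdd 0)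
  have e : exec (c.set 0 (h.var v)) (.jgtz (c.pc + 3)) =
      some ({ c.set 0 (h.var v) with pc := c.pc + 3 },
        size ((c.set 0 (h.var v)).reg 0)) := by
    simp [exec, Cfg.set, h0]
  have hP' := hP.tail.tail.tail
  obtain ⟨c', h3, h4, k, hk, h5⟩ := H P _ hP'.left { c.set 0 (h.var v) with pc := c.pc + 3 } rfl
    (h2.setPc _)
  have hP'' := hP'.right.head
  rw [F.length_code] at hP''
  obtain ⟨c'', h6, h7, k', hk', h8⟩ := H' P _ hP { c' with pc := c.pc } rfl (h4.setPc _)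
  refine ⟨c'', h6, h7, 1 + (k + (k' + 1) + 1), by omega, h1.trans ?_⟩
  refine .head hP.tail.head e (by omega) (h5.trans (.head (by rw [h3]; exact hP'') rfl ?_ h8))
  have := one_le_size V
  omega

end Rules

/-! ### Assignments, memory access, input and output -/

namespace Frag

/-- `v := x`. -/
def mov (v : ℕ) (x : Src) : Frag := block [.load x.op, .store (.dir (v + 1))]

/-- `v := x + y`. -/
def add (v : ℕ) (x y : Src) : Frag := block [.load x.op, .add y.op, .store (.dir (v + 1))]

/-- `v := x - y`. -/
def sub (v : ℕ) (x y : Src) : Frag := block [.load x.op, .sub y.op, .store (.dir (v + 1))]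

/-- `v := x * y`. -/
def mul (v : ℕ) (x y : Src) : Frag := block [.load x.op, .mult y.op, .store (.dir (v + 1))]

/-- `v := ⌊x / y⌋`. -/
def div (v : ℕ) (x y : Src) : Frag := block [.load x.op, .div y.op, .store (.dir (v + 1))]

/-- `v := mem[w]`. -/
def ldm (v w : ℕ) : Frag := block [.load (.reg (.ind (w + 1))), .store (.dir (v + 1))]

/-- `mem[w] := x`. -/
def stm (w : ℕ) (x : Src) : Frag := block [.load x.op, .store (.ind (w + 1))]

/-- `read v`. -/
def rd (v : ℕ) : Frag := block [.read (.dir (v + 1))]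

/-- `write x`. -/
def wr (x : Src) : Frag := block [.write x.op]

end Frag

section Assignments

variable {b V : ℕ} {h : HS} {v w : ℕ} {x y : Src}

theorem load_src (hV : b ≤ V) (hx : x.Ok b V) {P : Program} {c : Cfg} (hr : Rel b V h c)
    (hP : P[c.pc]? = some (.load x.op)) :
    Steps P (4 * size V) c (c.set 0 (x.val h)) 1 ∧ Rel b V h (c.set 0 (x.val h)) := by
  obtain ⟨s, hs, hf, hb⟩ := hx.fetch hV hr
  exact ⟨.head hP (by simp [exec, hf]; rfl) (by omega) (.refl _), hr.setAcc hb⟩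

theorem store_var (hV : b ≤ V) (hv : v < b) {P : Program} {c : Cfg} (hr : Rel b V h c)
    (hP : P[c.pc]? = some (.store (.dir (v + 1)))) :
    Steps P (4 * size V) c (c.set (v + 1) (c.reg 0)) 1 ∧
      Rel b V (h.setv v (c.reg 0)) (c.set (v + 1) (c.reg 0)) := by
  have h1 := size_le_of_abs_le (hr.bdd 0)
  have h4 : size ((v + 1 : ℕ) : ℤ) ≤ size (V : ℤ) :=
    size_le_of_abs_le (by rw [Nat.abs_cast]; exact_mod_cast (by omega : v + 1 ≤ V))
  refine ⟨.head hP rfl ?_ (.refl _), hr.setVar (hr.bdd 0) hv⟩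
  simp only [Addr.cost]
  omega

/-- The pattern of all arithmetic assignments. -/
theorem Does.arith (hV : b ≤ V) (hv : v < b) (hx : x.Ok b V) {i : Instr} {r : ℤ} (hr : |r| ≤ V)
    (hi : ∀ c, Rel b V h c → c.reg 0 = x.val h →
      ∃ s ≤ 4 * size V, exec c i = some (c.set 0 r, s)) :
    Does b V (Frag.block [.load x.op, i, .store (.dir (v + 1))]) h (h.setv v r) 3 := by
  intro P o hP c hc hR
  subst hc
  have hP1 : At P c.pc [.load x.op, i, .store (.dir (v + 1))] := hP
  obtain ⟨h1, h2⟩ := load_src hV hx hR hP1.head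
  obtain ⟨s, hs, he⟩ := hi _ h2 (by simp [Cfg.set])
  have h3 := h2.setAcc hr
  obtain ⟨h4, h5⟩ := store_var hV hv h3 hP1.tail.tail.head
  refine ⟨_, ?_, ?_, 1 + (1 + 1), le_rfl, h1.trans (.head hP1.tail.head he hs h4)⟩
  · simp [Cfg.set, Frag.block]
  · simpa [Cfg.set] using h5

theorem Does.mov (hV : b ≤ V) (hv : v < b) (hx : x.Ok b V) :
    Does b V (Frag.mov v x) h (h.setv v (x.val h)) 2 := by
  intro P o hP c hc hR
  subst hc
  have hP1 : At P c.pc [.load x.op, .store (.dir (v + 1))] := hP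
  obtain ⟨h1, h2⟩ := load_src hV hx hR hP1.head
  obtain ⟨h4, h5⟩ := store_var hV hv h2 hP1.tail.head
  refine ⟨_, ?_, ?_, 1 + 1, le_rfl, h1.trans h4⟩
  · simp [Cfg.set, Frag.mov, Frag.block]
  · simpa [Cfg.set] using h5

theorem Does.add (hV : b ≤ V) (hv : v < b) (hx : x.Ok b V) (hy : y.Ok b V)
    (hr : |x.val h + y.val h| ≤ V) :
    Does b V (Frag.add v x y) h (h.setv v (x.val h + y.val h)) 3 := by
  refine Does.arith hV hv hx hr fun c hc h0 => ?_
  obtain ⟨s, hs, hf, hb⟩ := hy.fetch hV hc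
  have := size_le_of_abs_le (hc.bdd 0)
  exact ⟨size (c.reg 0) + s, by omega, by simp [exec, hf, h0]⟩

theorem Does.sub (hV : b ≤ V) (hv : v < b) (hx : x.Ok b V) (hy : y.Ok b V)
    (hr : |x.val h - y.val h| ≤ V) :
    Does b V (Frag.sub v x y) h (h.setv v (x.val h - y.val h)) 3 := by
  refine Does.arith hV hv hx hr fun c hc h0 => ?_
  obtain ⟨s, hs, hf, hb⟩ := hy.fetch hV hc
  have := size_le_of_abs_le (hc.bdd 0)
  exact ⟨size (c.reg 0) + s, by omega, by simp [exec, hf, h0]⟩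

theorem Does.mul (hV : b ≤ V) (hv : v < b) (hx : x.Ok b V) (hy : y.Ok b V)
    (hr : |x.val h * y.val h| ≤ V) :
    Does b V (Frag.mul v x y) h (h.setv v (x.val h * y.val h)) 3 := by
  refine Does.arith hV hv hx hr fun c hc h0 => ?_
  obtain ⟨s, hs, hf, hb⟩ := hy.fetch hV hc
  have := size_le_of_abs_le (hc.bdd 0)
  exact ⟨size (c.reg 0) + s, by omega, by simp [exec, hf, h0]⟩

theorem Does.div (hV : b ≤ V) (hv : v < b) (hx : x.Ok b V) (hy : y.Ok b V)
    (h0 : y.val h ≠ 0) (hr : |(x.val h).fdiv (y.val h)| ≤ V) :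
    Does b V (Frag.div v x y) h (h.setv v ((x.val h).fdiv (y.val h))) 3 := by
  refine Does.arith hV hv hx hr fun c hc hc0 => ?_
  obtain ⟨s, hs, hf, hb⟩ := hy.fetch hV hc
  have := size_le_of_abs_le (hc.bdd 0)
  exact ⟨size (c.reg 0) + s, by omega, by simp [exec, hf, hc0, h0]⟩

/-- An address above b is nonnegative, so the indirect access is defined, and it lies beyond the
accumulator and the registers of the variables. The two sizes in the cost are those of the pointer
register and of its contents. -/
theorem ind_cost (hV : b ≤ V) (hw : w < b) {c : Cfg} (hr : Rel b V h c) (ha : (b : ℤ) < h.var w) :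
    (Addr.ind (w + 1)).resolve c.reg = some (h.var w).toNat ∧
      (Addr.ind (w + 1)).cost c.reg ≤ 2 * size V := by
  have h1 := hr.var w hw
  have h2 := size_le_of_abs_le (hr.bdd (w + 1))
  have h4 : size ((w + 1 : ℕ) : ℤ) ≤ size (V : ℤ) :=
    size_le_of_abs_le (by rw [Nat.abs_cast]; exact_mod_cast (by omega : w + 1 ≤ V))
  constructor
  · simp only [Addr.resolve, h1]
    rw [if_pos (by omega)]
  · simp only [Addr.cost]
    omega

theorem Does.ldm (hV : b ≤ V) (hv : v < b) (hw : w < b) (ha : (b : ℤ) < h.var w) :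
    Does b V (Frag.ldm v w) h (h.setv v (h.mem (h.var w))) 2 := by
  intro P o hP c hc hR
  subst hc
  have hP1 : At P c.pc [.load (.reg (.ind (w + 1))), .store (.dir (v + 1))] := hP
  obtain ⟨h1, h2⟩ := ind_cost hV hw hR ha
  have h3 := hR.mem _ ha
  have h4 := hR.bdd (h.var w).toNat
  have h5 := size_le_of_abs_le h4
  have h6 := hR.setAcc h4
  obtain ⟨h7, h8⟩ := store_var hV hv h6 hP1.tail.head
  refine ⟨_, ?_, ?_, 1 + 1, le_rfl, .head hP1.head (c' := c.set 0 (c.reg (h.var w).toNat)) (s :=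
    (Addr.ind (w + 1)).cost c.reg + size (c.reg (h.var w).toNat)) ?_ (by omega) h7⟩
  · simp [Cfg.set, Frag.ldm, Frag.block]
  · simpa [Cfg.set, h3] using h8
  · simp [exec, Operand.fetch, h1]

theorem Does.stm (hV : b ≤ V) (hx : x.Ok b V) (hw : w < b) (ha : (b : ℤ) < h.var w) :
    Does b V (Frag.stm w x) h (h.setm (h.var w) (x.val h)) 2 := by
  intro P o hP c hc hR
  subst hc
  have hP1 : At P c.pc [.load x.op, .store (.ind (w + 1))] := hP
  obtain ⟨h1, h2⟩ := load_src hV hx hR hP1.head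
  obtain ⟨h3, h4⟩ := ind_cost hV hw h2 ha
  have h5 := size_le_of_abs_le (h2.bdd 0)
  have h6 := h2.setMem (h2.bdd 0) ha
  refine ⟨_, ?_, ?_, 1 + 1, le_rfl, h1.trans (.head hP1.tail.head (c' := (c.set 0 (x.val h)).set
    (h.var w).toNat ((c.set 0 (x.val h)).reg 0)) ?_
    (by omega : size ((c.set 0 (x.val h)).reg 0) +
      (Addr.ind (w + 1)).cost (c.set 0 (x.val h)).reg ≤ _) (.refl _))⟩
  · simp [Cfg.set, Frag.stm, Frag.block]
  · simpa [Cfg.set] using h6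
  · simp [exec, h3]

theorem Does.rd (hV : b ≤ V) (hv : v < b) {z : ℤ} {l : List ℤ} (hi : h.inp = z :: l) :
    Does b V (Frag.rd v) h { h.setv v z with inp := l } 1 := by
  intro P o hP c hc hR
  subst hc
  have hP1 : At P c.pc [.read (.dir (v + 1))] := hP
  have hin : c.input = z :: l := by rw [hR.inp, hi]
  have hz : |z| ≤ V := hR.bddInp z (by simp [hin])
  have h1 := hR.setVar hz hv
  have h4 : size ((v + 1 : ℕ) : ℤ) ≤ size (V : ℤ) :=
    size_le_of_abs_le (by rw [Nat.abs_cast]; exact_mod_cast (by omega : v + 1 ≤ V))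
  have h5 := size_le_of_abs_le hz
  refine ⟨{ c.set (v + 1) z with input := l }, ?_, ?_, 1, le_rfl, .head hP1.head (s := size z +
    size ((v + 1 : ℕ) : ℤ)) ?_ (by omega) (.refl _)⟩
  · simp [Cfg.set, Frag.rd, Frag.block]
  · exact ⟨h1.var, h1.mem, rfl, h1.out, h1.bdd, fun z' hz' =>
      hR.bddInp z' (by rw [hin]; exact List.mem_cons_of_mem _ hz')⟩
  · simp [exec, Addr.resolve, Addr.cost, hin]

theorem Does.wr (hV : b ≤ V) (hx : x.Ok b V) :
    Does b V (Frag.wr x) h { h with out := h.out ++ [x.val h] } 1 := by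
  intro P o hP c hc hR
  subst hc
  have hP1 : At P c.pc [.write x.op] := hP
  obtain ⟨s, hs, hf, hb⟩ := hx.fetch hV hR
  refine ⟨{ c with pc := c.pc + 1, output := c.output ++ [x.val h] }, ?_, ?_, 1, le_rfl,
    .head hP1.head (s := s) ?_ (by omega) (.refl _)⟩
  · simp [Frag.wr, Frag.block]
  · exact ⟨hR.var, hR.mem, hR.inp, by simp [hR.out], hR.bdd, hR.bddInp⟩
  · simp [exec, hf]

end Assignments

/-- Case distinction on the value of the variable `v` among the numbers below `n`, with the
scratch variable `t`. -/
def Frag.switch (v t : ℕ) (body : ℕ → Frag) : ℕ → Frag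
  | 0 => Frag.skip
  | n + 1 => (Frag.sub t (.var v) (.lit n)).seq
      (Frag.ifz t (body n) (Frag.switch v t body n))

theorem HS.setv_setv (h : HS) (i : ℕ) (x y : ℤ) : (h.setv i x).setv i y = h.setv i y := by
  simp [HS.setv]

theorem HS.setv_var (h : HS) (i : ℕ) (x : ℤ) (j : ℕ) :
    (h.setv i x).var j = if j = i then x else h.var j := by
  simp [HS.setv, Function.update_apply]

/-- The candidates are tried from n − 1 downwards, each by a subtraction and a branch of three
instructions apiece. The scratch variable holds the difference, which is 0 when the right body is
entered; hence the state `h.setv t 0` in the premise. -/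
theorem Does.switch {b V : ℕ} (hV : b ≤ V) {v t : ℕ} (hv : v < b) (ht : t < b) (hvt : v ≠ t)
    {body : ℕ → Frag} {i n m : ℕ} (hin : i < n) (hnV : n ≤ V) {h h' : HS} (hi : h.var v = i)
    (H : Does b V (body i) (h.setv t 0) h' m) :
    Does b V (Frag.switch v t body n) h h' (m + 6 * n) := by
  induction n generalizing h with
  | zero => omega
  | succ n ih =>
    have h1 : Does b V (Frag.sub t (.var v) (.lit n)) h (h.setv t ((i : ℤ) - n)) 3 := by
      have := Does.sub (h := h) (x := .var v) (y := .lit n) hV ht hv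
        (by simp only [Src.Ok, Nat.abs_cast]; exact_mod_cast (by omega : n ≤ V))
        (by simp only [Src.val, hi]; rw [abs_le]; omega)
      simpa [Src.val, hi] using this
    by_cases hn : i = n
    · subst hn
      refine (h1.seq (Does.ifz_zero hV ht ?_ (by simpa using H))).mono (by omega)
      simp [HS.setv_var]
    · refine (h1.seq (Does.ifz_ne hV ht ?_ (ih (by omega) (by omega) ?_ ?_))).mono
        (by omega : 3 + (m + 6 * n + 3) ≤ _)
      · simp only [HS.setv_var, if_true]; omega
      · simp [HS.setv_var, hvt, hi]
      · simpa [HS.setv_setv] using H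

end RAM

/-! ### Simulation of a multi-tape Turing machine on the random access machine -/

namespace MultiTapeTM

open RAM Turing

/-- Codes of the tape symbols and of the states of `M` by natural numbers. -/
structure Coding (M : MultiTapeTM) where
  sym : M.Sym → ℕ
  symInv : ℕ → M.Sym
  numSym : ℕ
  symInv_sym : ∀ s, symInv (sym s) = s
  sym_none : sym none = 0
  sym_lt : ∀ s, sym s < numSym
  st : M.Q → ℕ
  stInv : ℕ → M.Q
  numSt : ℕ
  stInv_st : ∀ q, stInv (st q) = q
  st_lt : ∀ q, st q < numSt

/-- The blank gets code 0 and all other symbols are shifted by one, so that registers in their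
initial state already represent blank tape. -/
theorem nonempty_coding (M : MultiTapeTM) : Nonempty M.Coding := by
  classical
  have := M.finA
  have := M.finQ
  obtain ⟨n, ⟨e⟩⟩ := Finite.exists_equiv_fin (Bool ⊕ M.A)
  obtain ⟨n', ⟨e'⟩⟩ := Finite.exists_equiv_fin M.Q
  have : Nonempty M.Q := ⟨M.start⟩
  let f : M.Sym → ℕ := fun s => s.elim 0 fun a => (e a : ℕ) + 1
  have hf : Function.Injective f := by
    rintro (_ | a) (_ | a') h
    · rfl
    · simp [f] at h
    · simp [f] at h
    · have : (e a : ℕ) = e a' := by simpa [f] using h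
      rw [e.injective (Fin.ext this)]
  have hg : Function.Injective fun q => (e' q : ℕ) := fun q q' h => e'.injective (Fin.ext h)
  exact ⟨{
    sym := f
    symInv := Function.invFun f
    numSym := n + 1
    symInv_sym := Function.leftInverse_invFun hf
    sym_none := rfl
    sym_lt := by
      rintro (_ | a)
      · simp [f]
      · simp [f]
    st := fun q => e' q
    stInv := Function.invFun fun q => (e' q : ℕ)
    numSt := n'
    stInv_st := Function.leftInverse_invFun hg
    st_lt := fun q => (e' q).2 }⟩

variable {M : MultiTapeTM}

/-- The number of tapes. -/
abbrev numTapes (M : MultiTapeTM) : ℕ := M.k + 2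

/-- The number of variables of the simulating program. -/
abbrev numVars (M : MultiTapeTM) : ℕ := 10 + M.numTapes

/-- The number of tapes as an integer: the distance in memory of adjacent cells of a tape. -/
def stride (M : MultiTapeTM) : ℤ := M.numTapes

theorem stride_pos (M : MultiTapeTM) : 0 < M.stride := by
  unfold stride numTapes; positivity

/-- The first memory address that is used for tapes. -/
def lowest (M : MultiTapeTM) : ℤ := M.stride * (M.numVars + 1)

theorem numVars_lt_lowest (M : MultiTapeTM) : (M.numVars : ℤ) < M.lowest := by
  unfold lowest numVars stride numTapes
  push_cast
  nlinarith

/-- The memory of `hs` represents the tape `tp` as tape number `i` of `M`, with room for `R` moves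
of the head below the address `U`. -/
structure TapeRep (C : M.Coding) (U : ℤ) (hs : HS) (i : Fin M.numTapes) (tp : Tape M.Sym) (R : ℕ) :
    Prop where
  emod : hs.var (10 + i) % M.stride = (i : ℕ)
  lower : M.lowest + M.stride * R ≤ hs.var (10 + i)
  upper : hs.var (10 + i) + M.stride * R ≤ U
  mem : ∀ p : ℤ, M.lowest ≤ hs.var (10 + i) + M.stride * p →
    hs.mem (hs.var (10 + i) + M.stride * p) = C.sym (tp.nth p)

theorem TapeRep.congr {C : M.Coding} {U : ℤ} {hs hs' : HS} {i : Fin M.numTapes} {tp : Tape M.Sym}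
    {R : ℕ} (h : TapeRep C U hs i tp R) (hv : hs'.var (10 + i) = hs.var (10 + i))
    (hm : hs'.mem = hs.mem) : TapeRep C U hs' i tp R :=
  ⟨by rw [hv, h.emod], by rw [hv]; exact h.lower, by rw [hv]; exact h.upper,
    by rw [hv, hm]; exact h.mem⟩

theorem TapeRep.lowest_le {C : M.Coding} {U : ℤ} {hs : HS} {i : Fin M.numTapes} {tp : Tape M.Sym}
    {R : ℕ} (h : TapeRep C U hs i tp R) : M.lowest ≤ hs.var (10 + i) := by
  have := h.lower
  have := mul_nonneg M.stride_pos.le (Int.natCast_nonneg R)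
  omega

/-- Write the symbol `w` on tape `i` and move the head. -/
def writeMove (C : M.Coding) (i : Fin M.numTapes) (w : M.Sym) (d : Option Dir) : Frag :=
  (Frag.stm (10 + i) (.lit (C.sym w))).seq <| match d with
    | none => Frag.skip
    | some .left => Frag.sub (10 + i) (.var (10 + i)) (.lit M.stride)
    | some .right => Frag.add (10 + i) (.var (10 + i)) (.lit M.stride)

/-- The constants of the simulation do not exceed `V`. -/
structure Coding.Fits (C : M.Coding) (V : ℕ) : Prop where
  vars : M.numVars ≤ V
  syms : C.numSym ≤ V
  states : C.numSt ≤ V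

/-- The tapes are interleaved in memory: tape i owns the addresses congruent to i modulo the number
of tapes. A head move adds or subtracts this modulus, so residues are preserved and a write on one
tape never touches another. A move uses up at most one unit of the room R on either side. -/
theorem writeMove_does {C : M.Coding} {V : ℕ} {U : ℤ} (hV : C.Fits V) (hU : U ≤ V) {hs : HS}
    {i : Fin M.numTapes} {tp : Tape M.Sym} {R : ℕ} (h : TapeRep C U hs i tp (R + 1)) (w : M.Sym)
    (d : Option Dir) :
    ∃ hs', Does M.numVars V (writeMove C i w d) hs hs' 5 ∧
      TapeRep C U hs' i (moveHead d (tp.write w)) R ∧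
      (∀ j ≠ i, ∀ tp' R', TapeRep C U hs j tp' R' → TapeRep C U hs' j tp' R') ∧
      (∀ v, v ≠ 10 + i.val → hs'.var v = hs.var v) ∧ hs'.out = hs.out := by
  have hi : 10 + i.val < M.numVars := by have := i.2; unfold numVars; omega
  have hlo := h.lowest_le
  have hlow := M.numVars_lt_lowest
  have hsym : |((C.sym w : ℕ) : ℤ)| ≤ V := by
    rw [Nat.abs_cast]
    exact_mod_cast (C.sym_lt w).le.trans hV.syms
  have hK := M.stride_pos
  have hKV : |M.stride| ≤ V := by
    rw [abs_of_pos hK]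
    unfold stride
    have := hV.vars
    unfold numVars at this
    exact_mod_cast (by omega : M.numTapes ≤ V)
  obtain ⟨a, ha⟩ : ∃ a, hs.var (10 + i) = a := ⟨_, rfl⟩
  have h1 := Does.stm (h := hs) (x := .lit (C.sym w)) (w := 10 + i) hV.vars hsym hi
    (by rw [ha]; omega)
  rw [ha] at h1 hlo
  simp only [Src.val] at h1
  have hup := h.upper
  have hlw := h.lower
  have hem := h.emod
  rw [ha] at hup hlw hem
  push_cast at hup hlw
  rw [mul_add, mul_one] at hup hlw
  have hR : (0 : ℤ) ≤ M.stride * R := mul_nonneg hK.le (Int.natCast_nonneg R)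
  rw [abs_of_pos hK] at hKV
  have hmem : ∀ p : ℤ, M.lowest ≤ a + M.stride * p →
      (hs.setm a (C.sym w)).mem (a + M.stride * p) = C.sym ((tp.write w).nth p) := by
    intro p hp
    rw [Tape.write_nth]
    by_cases hp0 : p = 0
    · simp [hp0, HS.setm]
    · have hne : a + M.stride * p ≠ a := by
        intro he
        have : M.stride * p = 0 := by omega
        rcases mul_eq_zero.1 this with h0 | h0
        · omega
        · exact hp0 h0
      have := h.mem p (by rw [ha]; exact hp)
      rw [ha] at this
      simp [HS.setm, Function.update_of_ne hne, hp0, this]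
  have hother : ∀ j ≠ i, ∀ tp' R', TapeRep C U hs j tp' R' →
      TapeRep C U (hs.setm a (C.sym w)) j tp' R' := by
    intro j hj tp' R' hr
    refine ⟨hr.emod, hr.lower, hr.upper, fun p hp => ?_⟩
    -- Equal addresses would have equal residues modulo the stride, which are the numbers of the
    -- tapes.
    have hne : hs.var (10 + j) + M.stride * p ≠ a := by
      intro he
      have h2 : (hs.var (10 + j) + M.stride * p) % M.stride = (j : ℕ) := by
        rw [Int.add_mul_emod_self_left]; exact hr.emod
      rw [he, hem] at h2
      exact hj (Fin.ext (by exact_mod_cast h2.symm))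
    have hm : (hs.setm a (C.sym w)).mem (hs.var (10 + j) + M.stride * p) =
        hs.mem (hs.var (10 + j) + M.stride * p) := by
      simp [HS.setm, Function.update_of_ne hne]
    exact hm.trans (hr.mem p hp)
  have hvar : (hs.setm a (C.sym w)).var (10 + i) = a := ha
  have hkey : ∀ hs' : HS, hs'.mem = (hs.setm a (C.sym w)).mem →
      (∀ v, v ≠ 10 + i.val → hs'.var v = hs.var v) → ∀ j ≠ i, ∀ tp' R', TapeRep C U hs j tp' R' →
      TapeRep C U hs' j tp' R' := fun hs' hm hv j hj tp' R' hr =>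
    (hother j hj tp' R' hr).congr (hv _ fun he => hj (Fin.ext (by omega))) hm
  have hset : ∀ z : ℤ, ∀ v, v ≠ 10 + i.val →
      ((hs.setm a (C.sym w)).setv (10 + i) z).var v = hs.var v := by
    intro z v hv
    rw [HS.setv_var, if_neg hv]
    rfl
  match d with
  | none =>
    refine ⟨hs.setm a (C.sym w), (h1.seq Does.skip).mono (by omega), ⟨?_, ?_, ?_, ?_⟩, hother,
      fun v _ => rfl, rfl⟩
    · rw [hvar, hem]
    · rw [hvar]; omega
    · rw [hvar]; omega
    · rw [hvar]; exact hmem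
  | some .right =>
    have h2 := Does.add (h := hs.setm a (C.sym w)) (v := 10 + i) (x := .var (10 + i))
      (y := .lit M.stride) hV.vars hi hi (by rw [Src.Ok, abs_of_pos hK]; exact hKV)
      (by simp only [Src.val, hvar]; rw [abs_le]; omega)
    simp only [Src.val, hvar] at h2
    have hv' : ((hs.setm a (C.sym w)).setv (10 + i) (a + M.stride)).var (10 + i) =
      a + M.stride := by simp [HS.setv_var]
    refine ⟨_, h1.seq h2, ⟨?_, ?_, ?_, ?_⟩, hkey _ rfl (hset _), hset _, rfl⟩
    · rw [hv', Int.add_emod_right, hem]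
    · rw [hv']; omega
    · rw [hv']; omega
    · rw [hv']
      intro p hp
      simp only [moveHead]
      rw [Tape.move_right_nth, show a + M.stride + M.stride * p = a + M.stride * (p + 1) by
        ring]
      exact hmem (p + 1) (by linarith)
  | some .left =>
    have h2 := Does.sub (h := hs.setm a (C.sym w)) (v := 10 + i) (x := .var (10 + i))
      (y := .lit M.stride) hV.vars hi hi (by rw [Src.Ok, abs_of_pos hK]; exact hKV)
      (by simp only [Src.val, hvar]; rw [abs_le]; omega)
    simp only [Src.val, hvar] at h2
    have hv' : ((hs.setm a (C.sym w)).setv (10 + i) (a - M.stride)).var (10 + i) =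
      a - M.stride := by simp [HS.setv_var]
    refine ⟨_, h1.seq h2, ⟨?_, ?_, ?_, ?_⟩, hkey _ rfl (hset _), hset _, rfl⟩
    · rw [hv', Int.sub_emod_right, hem]
    · rw [hv']; omega
    · rw [hv']; omega
    · rw [hv']
      intro p hp
      simp only [moveHead]
      rw [Tape.move_left_nth, show a - M.stride + M.stride * p = a + M.stride * (p - 1) by
        ring]
      exact hmem (p - 1) (by linarith)

/-- Write and move on all tapes of a list. -/
def writeMoves (C : M.Coding) (w : Fin M.numTapes → M.Sym) (d : Fin M.numTapes → Option Dir)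
    (l : List (Fin M.numTapes)) : Frag := Frag.seqs (l.map fun i => writeMove C i (w i) (d i))

/-- For the induction the tapes are split into those still in the list, in their old form with room
R + 1, and the others, which are already updated and have room R. -/
theorem writeMoves_does {C : M.Coding} {V : ℕ} {U : ℤ} (hV : C.Fits V) (hU : U ≤ V) {R : ℕ}
    {tp : Fin M.numTapes → Tape M.Sym} (w : Fin M.numTapes → M.Sym)
    (d : Fin M.numTapes → Option Dir) (l : List (Fin M.numTapes)) (hl : l.Nodup) {hs : HS}
    (h : ∀ i ∈ l, TapeRep C U hs i (tp i) (R + 1))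
    (h' : ∀ i ∉ l, TapeRep C U hs i (moveHead (d i) ((tp i).write (w i))) R) :
    ∃ hs', Does M.numVars V (writeMoves C w d l) hs hs' (5 * l.length) ∧
      (∀ i, TapeRep C U hs' i (moveHead (d i) ((tp i).write (w i))) R) ∧ hs'.out = hs.out := by
  induction l generalizing hs with
  | nil => exact ⟨hs, Does.skip, fun i => h' i (by simp), rfl⟩
  | cons i l ih =>
    obtain ⟨hs1, h1, h2, h3, -, h5⟩ :=
      writeMove_does hV hU (h i (by simp)) (w i) (d i)
    rw [List.nodup_cons] at hl
    obtain ⟨hs2, h6, h7, h8⟩ := ih hl.2 (hs := hs1)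
      (fun j hj => h3 j (fun hji => hl.1 (hji ▸ hj)) _ _ (h j (by simp [hj])))
      (fun j hj => by
        by_cases hji : j = i
        · subst hji; exact h2
        · exact h3 j hji _ _ (h' j (by simp [hj, hji])))
    exact ⟨hs2, (h1.seq h6).mono (by simp; omega), h7, h8.trans h5⟩

/-- The code of a verdict: `1` if the machine has not halted, else `0` for acceptance and `-1` for
rejection. -/
def verdictCode : Option Bool → ℤ
  | none => 1
  | some true => 0
  | some false => -1

theorem abs_verdictCode_le (v : Option Bool) : |verdictCode v| ≤ 1 := by
  rcases v with _ | _ | _ <;> simp [verdictCode]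

/-- `hs` represents the configuration `c` of `M`, with room for `R` more steps. -/
structure SimRel (C : M.Coding) (U : ℤ) (hs : HS) (c : M.Cfg) (R : ℕ) : Prop where
  st : hs.var 8 = C.st c.state
  verdict : hs.var 9 = verdictCode (M.verdict c.state)
  tapes : ∀ i, TapeRep C U hs i (c.tapes i) R

/-- The effect of one step in state `q` with the symbols `g` under the heads. -/
def leaf (C : M.Coding) (q : M.Q) (g : Fin M.numTapes → M.Sym) : Frag :=
  (writeMoves C (M.δ q g).2.1 (M.δ q g).2.2 (List.finRange _)).seq
    ((Frag.mov 8 (.lit (C.st (M.δ q g).1))).seq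
      (Frag.mov 9 (.lit (verdictCode (M.verdict (M.δ q g).1)))))

theorem leaf_does {C : M.Coding} {V : ℕ} {U : ℤ} (hV : C.Fits V) (hU : U ≤ V) {R : ℕ} {c : M.Cfg}
    (hc : M.verdict c.state = none) {hs : HS} (h : ∀ i, TapeRep C U hs i (c.tapes i) (R + 1)) :
    ∃ hs', Does M.numVars V (leaf C c.state fun i => (c.tapes i).head) hs hs'
        (5 * M.numTapes + 4) ∧ SimRel C U hs' (M.step c) R ∧ hs'.out = hs.out := by
  obtain ⟨hs1, h1, h2, h3⟩ := writeMoves_does hV hU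
    (M.δ c.state fun i => (c.tapes i).head).2.1 (M.δ c.state fun i => (c.tapes i).head).2.2
    (List.finRange _) (List.nodup_finRange _) (fun i _ => h i) (fun i hi => by simp at hi)
  have hb := hV.vars
  have h4 := Does.mov (h := hs1) (v := 8)
    (x := .lit (C.st (M.δ c.state fun i => (c.tapes i).head).1)) hV.vars (by unfold numVars; omega)
    (by
      simp only [Src.Ok, Nat.abs_cast]
      exact_mod_cast (C.st_lt _).le.trans hV.states)
  have h5 := Does.mov (h := hs1.setv 8 (C.st (M.δ c.state fun i => (c.tapes i).head).1)) (v := 9)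
    (x := .lit (verdictCode (M.verdict (M.δ c.state fun i => (c.tapes i).head).1))) hV.vars
    (by unfold numVars; omega)
    ((abs_verdictCode_le _).trans (by unfold numVars at hb; exact_mod_cast (by omega : 1 ≤ V)))
  refine ⟨_, (h1.seq (h4.seq h5)).mono (by rw [List.length_finRange]), ⟨?_, ?_, fun i => ?_⟩, h3⟩
  · simp [HS.setv_var, Src.val, step, hc]
  · simp [HS.setv_var, Src.val, step, hc]
  · have := (h2 i).congr (hs' := (hs1.setv 8 (C.st (M.δ c.state fun i => (c.tapes i).head).1)).setv
      9 (verdictCode (M.verdict (M.δ c.state fun i => (c.tapes i).head).1)))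
      (by rw [HS.setv_var, if_neg (by omega), HS.setv_var, if_neg (by omega)]) rfl
    simpa [step, hc, Src.val] using this

/-- Read the symbols under the heads of the tapes in a list and continue as required by the
transition function. -/
def dispatch (C : M.Coding) (q : M.Q) : List (Fin M.numTapes) → (Fin M.numTapes → M.Sym) → Frag
  | [], g => leaf C q g
  | i :: l, g => (Frag.ldm 6 (10 + i)).seq
      (Frag.switch 6 7 (fun s => dispatch C q l (Function.update g i (C.symInv s))) C.numSym)

/-- The transition function is compiled into a decision tree. The argument g collects the symbols
read so far; on the branch that the run takes it agrees with the heads outside the remaining list,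
hence everywhere at the leaf. Reading changes only scratch variables, so the tapes stay represented.
-/
theorem dispatch_does {C : M.Coding} {V : ℕ} {U : ℤ} (hV : C.Fits V) (hU : U ≤ V) {R : ℕ}
    {c : M.Cfg} (hc : M.verdict c.state = none) (l : List (Fin M.numTapes))
    (g : Fin M.numTapes → M.Sym) (hg : ∀ i ∉ l, g i = (c.tapes i).head) {hs : HS}
    (h : ∀ i, TapeRep C U hs i (c.tapes i) (R + 1)) :
    ∃ hs', Does M.numVars V (dispatch C c.state l g) hs hs'
        (5 * M.numTapes + 4 + l.length * (2 + 6 * C.numSym)) ∧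
      SimRel C U hs' (M.step c) R ∧ hs'.out = hs.out := by
  induction l generalizing g hs with
  | nil =>
    obtain rfl : g = fun i => (c.tapes i).head := funext fun i => hg i (by simp)
    simpa [dispatch] using leaf_does hV hU hc h
  | cons i l ih =>
    have hi : 10 + i.val < M.numVars := by have := i.2; unfold numVars; omega
    have h6 : 6 < M.numVars := by unfold numVars; omega
    have h7 : 7 < M.numVars := by unfold numVars; omega
    have h1 := Does.ldm (h := hs) (v := 6) hV.vars h6 hi
      (M.numVars_lt_lowest.trans_le (h i).lowest_le)
    have hm := (h i).mem 0 (by simpa using (h i).lowest_le)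
    rw [mul_zero, add_zero, Tape.nth_zero] at hm
    rw [hm] at h1
    obtain ⟨hs', h2, h3, h4⟩ := ih (Function.update g i (c.tapes i).head)
      (fun j hj => by
        by_cases hji : j = i
        · subst hji; simp
        · rw [Function.update_of_ne hji]; exact hg j (by simp [hj, hji]))
      (hs := (hs.setv 6 (C.sym (c.tapes i).head)).setv 7 0)
      (fun j => (h j).congr (by rw [HS.setv_var, if_neg (by omega), HS.setv_var,
        if_neg (by omega)]) rfl)
    have h5 := Does.switch (h := hs.setv 6 (C.sym (c.tapes i).head)) (h' := hs') (v := 6) (t := 7)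
      (body := fun s => dispatch C c.state l (Function.update g i (C.symInv s)))
      hV.vars h6 h7 (by omega) (C.sym_lt (c.tapes i).head) hV.syms (by simp [HS.setv_var])
      (by simpa [C.symInv_sym] using h2)
    refine ⟨hs', (h1.seq h5).mono (le_of_eq ?_), h3, h4⟩
    rw [List.length_cons]
    ring

/-- Simulation of one step. -/
def stepFrag (C : M.Coding) : Frag :=
  Frag.switch 8 7 (fun s => dispatch C (C.stInv s) (List.finRange _) fun _ => none) C.numSt

/-- The number of instructions for the simulation of one step. -/
def stepCost (C : M.Coding) : ℕ :=
  5 * M.numTapes + 4 + M.numTapes * (2 + 6 * C.numSym) + 6 * C.numSt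

theorem stepFrag_does {C : M.Coding} {V : ℕ} {U : ℤ} (hV : C.Fits V) (hU : U ≤ V) {R : ℕ}
    {c : M.Cfg} (hc : M.verdict c.state = none) {hs : HS} (h : SimRel C U hs c (R + 1)) :
    ∃ hs', Does M.numVars V (stepFrag C) hs hs' (stepCost C) ∧
      SimRel C U hs' (M.step c) R ∧ hs'.out = hs.out := by
  have h8 : 8 < M.numVars := by unfold numVars; omega
  have h7 : 7 < M.numVars := by unfold numVars; omega
  obtain ⟨hs', h2, h3, h4⟩ := dispatch_does hV hU hc (List.finRange _) (fun _ => none)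
    (fun i hi => by simp at hi) (hs := hs.setv 7 0)
    (fun j => (h.tapes j).congr (by rw [HS.setv_var, if_neg (by omega)]) rfl)
  refine ⟨hs', ?_, h3, h4⟩
  rw [List.length_finRange] at h2
  exact Does.switch (h := hs) (h' := hs') (v := 8) (t := 7)
    (body := fun s => dispatch C (C.stInv s) (List.finRange _) fun _ => none)
    hV.vars h8 h7 (by omega) (C.st_lt c.state) hV.states h.st
    (by simpa only [C.stInv_st] using h2)

theorem step_of_verdict {c : M.Cfg} {b : Bool} (h : M.verdict c.state = some b) : M.step c = c := by
  simp [step, h]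

theorem iterate_step_of_verdict {c : M.Cfg} {b : Bool} (h : M.verdict c.state = some b) (n : ℕ) :
    M.step^[n] c = c :=
  Function.iterate_fixed (step_of_verdict h) n

theorem HaltsWithin.mono {x y : List Bool} {b : Bool} {t t' : ℕ} (h : M.HaltsWithin x y b t)
    (ht : t ≤ t') : M.HaltsWithin x y b t' := by
  obtain ⟨d, rfl⟩ := Nat.exists_eq_add_of_le ht
  unfold HaltsWithin at *
  rw [add_comm, Function.iterate_add_apply, iterate_step_of_verdict h]
  exact h

/-- The program does not know R: the loop runs while the verdict code is positive, that is, until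
the simulated machine halts. The number R serves only as the bound for the rounds and as the room
for the heads. -/
theorem simulate_does {C : M.Coding} {V : ℕ} {U : ℤ} (hV : C.Fits V) (hU : U ≤ V) {R : ℕ}
    {c : M.Cfg} {b : Bool} (hc : M.verdict (M.step^[R] c).state = some b) {hs : HS}
    (h : SimRel C U hs c R) :
    ∃ hs', Does M.numVars V (Frag.loop 9 (stepFrag C)) hs hs' (R * (stepCost C + 3) + 3) ∧
      hs'.var 9 = verdictCode (some b) ∧ hs'.out = hs.out := by
  have h9 : 9 < M.numVars := by unfold numVars; omega
  induction R generalizing c hs with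
  | zero =>
    have hc : M.verdict c.state = some b := hc
    have h1 := h.verdict
    rw [hc] at h1
    refine ⟨hs, (Does.loop_exit hV.vars h9 ?_).mono (by omega), h1, rfl⟩
    rw [h1]; cases b <;> simp [verdictCode]
  | succ R ih =>
    cases hv : M.verdict c.state with
    | some b' =>
      rw [iterate_step_of_verdict hv, hv, Option.some.injEq] at hc
      subst hc
      have h1 := h.verdict
      rw [hv] at h1
      refine ⟨hs, (Does.loop_exit hV.vars h9 ?_).mono (by omega), h1, rfl⟩
      rw [h1]; cases b' <;> simp [verdictCode]
    | none =>
      obtain ⟨hs1, h1, h2, h3⟩ := stepFrag_does hV hU hv h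
      rw [Function.iterate_succ_apply] at hc
      obtain ⟨hs2, h4, h5, h6⟩ := ih hc h2
      have h0 : 0 < hs.var 9 := by rw [h.verdict, hv]; simp [verdictCode]
      exact ⟨hs2, (Does.loop_step hV.vars h9 h0 h1 h4).mono (by rw [Nat.succ_mul]; omega), h5,
        h6.trans h3⟩

end MultiTapeTM

/-! ### Machines that make one step for each input bit -/

theorem MultiTapeTM.step_of_verdict_eq_none {M : MultiTapeTM} {c : M.Cfg}
    (h : M.verdict c.state = none) :
    M.step c =
      { state := (M.δ c.state fun i => (c.tapes i).head).1
        tapes := fun i => moveHead ((M.δ c.state fun i => (c.tapes i).head).2.2 i)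
          ((c.tapes i).write ((M.δ c.state fun i => (c.tapes i).head).2.1 i)) } := by
  unfold MultiTapeTM.step
  rw [h]

open Turing in
/-- A machine with an oracle tape and one work tape that reads its input once, from left to right,
and makes one step for each bit. In each step it may write on the work tape and move the heads of
the oracle tape and of the work tape. -/
structure StreamMachine where
  A : Type
  S : Type
  [finA : Finite A]
  [finS : Finite S]
  start : S
  /-- new state, symbol to write on the work tape, moves on the oracle tape and the work tape -/
  next : S → Bool → Option (Bool ⊕ A) → Option (Bool ⊕ A) →
    S × Option (Bool ⊕ A) × Option Dir × Option Dir
  accept : S → Bool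

namespace StreamMachine

open Turing MultiTapeTM

variable (D : StreamMachine)

/-- The state together with the oracle tape and the work tape. -/
abbrev Conf : Type := D.S × Tape (Option (Bool ⊕ D.A)) × Tape (Option (Bool ⊕ D.A))

/-- The step for an input bit. -/
def stepBit (c : D.Conf) (b : Bool) : D.Conf :=
  let a := D.next c.1 b c.2.1.head c.2.2.head
  (a.1, moveHead a.2.2.1 c.2.1, moveHead a.2.2.2 (c.2.2.write a.2.1))

/-- The start configuration with oracle bits `y`. -/
def initConf (y : List Bool) : D.Conf :=
  (D.start, Tape.mk₁ (y.map fun b => some (Sum.inl b)), Tape.mk₁ [])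

/-- The machine accepts the input `x` with oracle bits `y`. -/
def Accepts (x y : List Bool) : Prop := D.accept (x.foldl D.stepBit (D.initConf y)).1 = true

/-- The language solved with an `f`-bit oracle. -/
def language (f : ℕ → ℕ) : Language Bool :=
  {x | ∃ y : List Bool, y.length = f x.length ∧ D.Accepts x y}

/-- The transition function of the corresponding Turing machine with three tapes. -/
def delta (q : D.S ⊕ Bool) (a : Fin 3 → Option (Bool ⊕ D.A)) :
    (D.S ⊕ Bool) × (Fin 3 → Option (Bool ⊕ D.A)) × (Fin 3 → Option Dir) :=
  match q, a 0 with
  | .inl s, some (.inl b) =>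
    let r := D.next s b (a 1) (a 2)
    (.inl r.1, fun i => if i.val = 2 then r.2.1 else a i,
      fun i => if i.val = 0 then some .right else if i.val = 1 then r.2.2.1 else r.2.2.2)
  | .inl s, _ => (.inr (D.accept s), a, fun _ => none)
  | .inr b, _ => (.inr b, a, fun _ => none)

theorem delta_bit {s : D.S} {b : Bool} {a : Fin 3 → Option (Bool ⊕ D.A)}
    (h : a 0 = some (.inl b)) : D.delta (.inl s) a = (.inl (D.next s b (a 1) (a 2)).1,
      fun i => if i.val = 2 then (D.next s b (a 1) (a 2)).2.1 else a i,
      fun i => if i.val = 0 then some .right else if i.val = 1 then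
        (D.next s b (a 1) (a 2)).2.2.1 else (D.next s b (a 1) (a 2)).2.2.2) := by
  simp [delta, h]

theorem delta_blank {s : D.S} {a : Fin 3 → Option (Bool ⊕ D.A)} (h : a 0 = none) :
    D.delta (.inl s) a = (.inr (D.accept s), a, fun _ => none) := by
  simp [delta, h]

/-- The corresponding multi-tape Turing machine. -/
abbrev toTM : MultiTapeTM where
  k := 1
  A := D.A
  Q := D.S ⊕ Bool
  finA := D.finA
  finQ := by have := D.finS; infer_instance
  start := Sum.inl D.start
  verdict := Sum.elim (fun _ => none) some
  δ := D.delta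

/-- `c` has not halted and represents `r`, and `w` is the unread part of the input. -/
structure Represents (c : D.toTM.Cfg) (r : D.Conf) (w : List Bool) : Prop where
  state : c.state = .inl r.1
  input : ∃ L, c.tapes ⟨0, Nat.zero_lt_succ _⟩ =
    Tape.mk' L (ListBlank.mk (w.map fun b => some (Sum.inl b)))
  oracle : c.tapes ⟨1, Nat.succ_lt_succ (Nat.zero_lt_succ _)⟩ = r.2.1
  work : c.tapes ⟨2, Nat.lt_succ_self 2⟩ = r.2.2

variable {D}

theorem Represents.step {c : D.toTM.Cfg} {r : D.Conf} {b : Bool} {w : List Bool}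
    (h : D.Represents c r (b :: w)) : D.Represents (D.toTM.step c) (D.stepBit r b) w := by
  obtain ⟨hs, ⟨L, hi⟩, ho, hw⟩ := h
  have h0 : (c.tapes ⟨0, Nat.zero_lt_succ _⟩).head = some (Sum.inl b) := by
    rw [hi, Tape.mk'_head]; rfl
  have hv : D.toTM.verdict c.state = none := by rw [hs]; rfl
  have hd : D.toTM.δ c.state (fun i => (c.tapes i).head) =
      (.inl (D.next r.1 b r.2.1.head r.2.2.head).1,
        fun i => if i.val = 2 then (D.next r.1 b r.2.1.head r.2.2.head).2.1 else (c.tapes i).head,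
        fun i => if i.val = 0 then some .right else if i.val = 1 then
          (D.next r.1 b r.2.1.head r.2.2.head).2.2.1
          else (D.next r.1 b r.2.1.head r.2.2.head).2.2.2) := by
    rw [hs, ← ho, ← hw]
    exact D.delta_bit (a := fun i => (c.tapes i).head) h0
  rw [step_of_verdict_eq_none hv, hd]
  refine ⟨rfl, ⟨L.cons (some (Sum.inl b)), ?_⟩, ?_, ?_⟩
  · have h1 : ((c.tapes ⟨0, Nat.zero_lt_succ _⟩).write
        (c.tapes ⟨0, Nat.zero_lt_succ _⟩).head).move .right =
        Tape.mk' (L.cons (some (Sum.inl b))) (ListBlank.mk (w.map fun b => some (Sum.inl b))) := by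
      rw [Tape.write_self, hi, Tape.move_right_mk']
      rfl
    exact h1
  · have h1 : moveHead (D.next r.1 b r.2.1.head r.2.2.head).2.2.1
        ((c.tapes ⟨1, Nat.succ_lt_succ (Nat.zero_lt_succ _)⟩).write
          (c.tapes ⟨1, Nat.succ_lt_succ (Nat.zero_lt_succ _)⟩).head) = (D.stepBit r b).2.1 := by
      rw [Tape.write_self, ho]
      rfl
    exact h1
  · have h1 : moveHead (D.next r.1 b r.2.1.head r.2.2.head).2.2.2
        ((c.tapes ⟨2, Nat.lt_succ_self 2⟩).write (D.next r.1 b r.2.1.head r.2.2.head).2.1) =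
          (D.stepBit r b).2.2 := by
      rw [hw]
      rfl
    exact h1

theorem Represents.halt {c : D.toTM.Cfg} {r : D.Conf} (h : D.Represents c r []) :
    D.toTM.verdict (D.toTM.step c).state = some (D.accept r.1) := by
  obtain ⟨hs, ⟨L, hi⟩, ho, hw⟩ := h
  have h0 : (c.tapes ⟨0, Nat.zero_lt_succ _⟩).head = none := by
    rw [hi, Tape.mk'_head]; rfl
  have hv : D.toTM.verdict c.state = none := by rw [hs]; rfl
  have hd : D.toTM.δ c.state (fun i => (c.tapes i).head) =
      (.inr (D.accept r.1), fun i => (c.tapes i).head, fun _ => none) := by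
    rw [hs]
    exact D.delta_blank (a := fun i => (c.tapes i).head) h0
  rw [step_of_verdict_eq_none hv, hd]
  rfl

/-- One step for each bit, and one more in which the blank after the input is seen and the verdict
is given. -/
theorem Represents.iterate {c : D.toTM.Cfg} {r : D.Conf} {w : List Bool}
    (h : D.Represents c r w) :
    D.toTM.verdict (D.toTM.step^[w.length + 1] c).state =
      some (D.accept (w.foldl D.stepBit r).1) := by
  induction w generalizing c r with
  | nil => exact h.halt
  | cons b w ih =>
    rw [List.length_cons, Function.iterate_succ_apply]
    exact ih h.step

theorem represents_init (x y : List Bool) :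
    D.Represents (D.toTM.init x y) (D.initConf y) x :=
  ⟨rfl, ⟨ListBlank.mk [], rfl⟩, rfl, rfl⟩

theorem haltsWithin (x y : List Bool) :
    D.toTM.HaltsWithin x y (D.accept (x.foldl D.stepBit (D.initConf y)).1) (x.length + 1) :=
  (represents_init x y).iterate

/-- Stream machines solve problems in linear time. -/
theorem language_mem_NDTIME (D : StreamMachine) (f : ℕ → ℕ) :
    D.language f ∈ NDTIME f fun n => (n : ℝ) := by
  refine ⟨D.toTM, fun n => n + 1, ?_, fun x y _ => ⟨_, haltsWithin x y⟩, fun x => ?_⟩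
  · refine IsBigO.of_bound 2 ?_
    filter_upwards [eventually_ge_atTop 1] with n hn
    have : (1 : ℝ) ≤ n := by exact_mod_cast hn
    rw [Real.norm_of_nonneg (by positivity), Real.norm_of_nonneg (by positivity)]
    push_cast
    linarith
  · refine exists_congr fun y => and_congr_right fun _ => ?_
    have h := haltsWithin (D := D) x y
    unfold Accepts
    unfold MultiTapeTM.HaltsWithin at *
    rw [h, Option.some.injEq]

end StreamMachine

/-! ### Sublinear time -/

namespace MultiTapeTM

open Turing

theorem bitTape_nth (M : MultiTapeTM) (w : List Bool) (p : ℤ) :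
    (M.bitTape w).nth p = if 0 ≤ p then (w[p.toNat]?).map Sum.inl else none := by
  have hnat : ∀ n : ℕ, (M.bitTape w).nth n = (w[n]?).map Sum.inl := by
    intro n
    unfold bitTape Tape.mk₁ Tape.mk₂
    rw [Tape.mk'_nth_nat, ListBlank.nth_mk, List.getI_eq_getElem?_getD, List.getElem?_map]
    cases w[n]? <;> rfl
  rcases p with n | n
  · exact (hnat n).trans (if_pos (Int.natCast_nonneg n)).symm
  · rw [if_neg (by simp)]
    simp only [bitTape, Tape.mk₁, Tape.mk₂, Tape.mk', Tape.nth]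
    rw [ListBlank.nth_mk]
    rfl

/-- The configurations agree except for cells of the input tape at distance at least `d` to the
right of the head. -/
structure AgreeBelow {M : MultiTapeTM} (d : ℕ) (c c' : M.Cfg) : Prop where
  state : c.state = c'.state
  input : ∀ i, i.val = 0 → ∀ p : ℤ, p < d → (c.tapes i).nth p = (c'.tapes i).nth p
  tapes : ∀ i, i.val ≠ 0 → c.tapes i = c'.tapes i

/-- The scanned cells agree because 0 < d + 1, so both machines do the same thing, and one move
brings the unknown cells nearer by at most one. -/
theorem AgreeBelow.step {M : MultiTapeTM} {d : ℕ} {c c' : M.Cfg} (h : AgreeBelow (d + 1) c c') :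
    AgreeBelow d (M.step c) (M.step c') := by
  have hh : (fun i => (c.tapes i).head) = fun i => (c'.tapes i).head := by
    funext i
    by_cases hi : i.val = 0
    · rw [← Tape.nth_zero, ← Tape.nth_zero, h.input i hi 0 (by positivity)]
    · rw [h.tapes i hi]
  have hst := h.state
  cases hv : M.verdict c.state with
  | some b =>
    rw [step_of_verdict hv, step_of_verdict (hst ▸ hv)]
    exact ⟨hst, fun i hi p hp => h.input i hi p (by push_cast; omega), h.tapes⟩
  | none =>
    rw [step_of_verdict_eq_none hv, step_of_verdict_eq_none (hst ▸ hv), ← hst, ← hh]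
    refine ⟨rfl, fun i hi p hp => ?_, fun i hi => by simp only [h.tapes i hi]⟩
    have hw : ∀ q : ℤ, q < d + 1 →
        ((c.tapes i).write ((M.δ c.state fun i => (c.tapes i).head).2.1 i)).nth q =
        ((c'.tapes i).write ((M.δ c.state fun i => (c.tapes i).head).2.1 i)).nth q := by
      intro q hq
      rw [Tape.write_nth, Tape.write_nth, h.input i hi q (by push_cast; omega)]
    have hm : ∀ e : Option Dir,
        (moveHead e ((c.tapes i).write ((M.δ c.state fun i => (c.tapes i).head).2.1 i))).nth p =
        (moveHead e ((c'.tapes i).write ((M.δ c.state fun i => (c.tapes i).head).2.1 i))).nth p := by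
      rintro (_ | _ | _)
      · exact hw p (by omega)
      · simp only [moveHead, Tape.move_left_nth]
        exact hw _ (by omega)
      · simp only [moveHead, Tape.move_right_nth]
        exact hw _ (by omega)
    exact hm _

theorem AgreeBelow.iterate {M : MultiTapeTM} {d t : ℕ} {c c' : M.Cfg} (h : AgreeBelow d c c')
    (ht : t ≤ d) : AgreeBelow (d - t) (M.step^[t] c) (M.step^[t] c') := by
  induction t with
  | zero => exact h
  | succ t ih =>
    rw [Function.iterate_succ_apply', Function.iterate_succ_apply']
    have := ih (by omega)
    rw [show d - t = d - (t + 1) + 1 by omega] at this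
    exact this.step

theorem agreeBelow_init (M : MultiTapeTM) (w u u' y : List Bool) :
    AgreeBelow w.length (M.init (w ++ u) y) (M.init (w ++ u') y) := by
  refine ⟨rfl, fun i hi p hp => ?_, fun i hi => by simp only [init, hi, if_false]⟩
  simp only [init, hi, if_true, bitTape_nth]
  split
  · rw [List.getElem?_append_left (by omega), List.getElem?_append_left (by omega)]
  · rfl

end MultiTapeTM

/-- The stream machine that looks for a bit `true`. -/
abbrev findTrue : StreamMachine where
  A := Empty
  S := Bool
  start := false
  next s b _ w := (s || b, w, none, none)
  accept s := s

theorem findTrue_accepts (x y : List Bool) : findTrue.Accepts x y ↔ true ∈ x := by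
  have : ∀ (c : findTrue.Conf), (x.foldl findTrue.stepBit c).1 = true ↔
      (c.1 = true ∨ true ∈ x) := by
    induction x with
    | nil => simp
    | cons b x ih =>
      intro c
      rw [List.foldl_cons, ih]
      have : (findTrue.stepBit c b).1 = (c.1 || b) := rfl
      rw [this]
      refine (or_congr_left Bool.or_eq_true_iff).trans ?_
      simp only [List.mem_cons, or_assoc, eq_comm (a := true)]
  have h := this (findTrue.initConf y)
  rw [show (findTrue.initConf y).1 = false from rfl] at h
  refine h.trans ?_
  simp

theorem isLittleO_rpow_rpow_of_lt {a b : ℝ} (h : a < b) :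
    (fun x : ℝ => x ^ a) =o[atTop] fun x => x ^ b := by
  refine (isLittleO_iff_tendsto' ?_).2 ((tendsto_rpow_neg_atTop (sub_pos.2 h)).congr' ?_)
  · filter_upwards [eventually_gt_atTop 0] with x hx h0
    exact absurd h0 (Real.rpow_pos_of_pos hx b).ne'
  · filter_upwards [eventually_gt_atTop 0] with x hx
    rw [← Real.rpow_sub hx, neg_sub]

/-- Linear time with any number of nondeterministic bits is not contained in sublinear
deterministic time. -/
theorem not_NDTIME_subset_DTIME_of_lt_one (f : ℕ → ℕ) {c : ℝ} (hc : c < 1) :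
    ¬ NDTIME f (fun n => (n : ℝ)) ⊆ DTIME fun n => (n : ℝ) ^ c := by
  intro h
  obtain ⟨M, T, hT, hhalt, hmem⟩ := h (findTrue.language_mem_NDTIME f)
  have ho : (fun n => (T n : ℝ)) =o[atTop] fun n : ℕ => (n : ℝ) := by
    refine hT.trans_isLittleO ?_
    have := (isLittleO_rpow_rpow_of_lt hc).comp_tendsto tendsto_natCast_atTop_atTop
    simpa [Function.comp_def] using this
  obtain ⟨n, hn, hn2⟩ := ((ho.bound (half_pos one_pos)).and (eventually_ge_atTop 2)).exists
  -- From T n ≤ n/2 and n ≥ 2: too little time to see the last of n bits.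
  have hTn : T n + 1 ≤ n := by
    rw [Real.norm_of_nonneg (by positivity), Real.norm_of_nonneg (by positivity)] at hn
    have h2 : (2 : ℝ) ≤ n := by exact_mod_cast hn2
    exact_mod_cast (by linarith : (T n : ℝ) + 1 ≤ n)
  -- On n − 1 zeros followed by b, the last bit alone decides membership.
  have key : ∀ b : Bool, M.HaltsWithin (List.replicate (n - 1) false ++ [b]) [] true (T n) ↔
      b = true := by
    intro b
    have hl : (List.replicate (n - 1) false ++ [b]).length = n := by simp; omega
    have h1 := hmem (List.replicate (n - 1) false ++ [b])
    rw [hl] at h1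
    have h2 : (List.replicate (n - 1) false ++ [b]) ∈
findTrue.language f ↔ b = true := by
      constructor
      · rintro ⟨y, -, hy⟩
        rw [findTrue_accepts] at hy
        simpa using hy
      · rintro rfl
        exact ⟨List.replicate (f n) false, by rw [hl, List.length_replicate],
          by rw [findTrue_accepts]; simp⟩
    rw [← h2, h1]
    constructor
    · exact fun h => ⟨[], rfl, h⟩
    · rintro ⟨y, hy, h⟩
      rwa [List.length_eq_zero_iff.1 hy] at h
  -- The two inputs differ only at distance n − 1 from the start, which T n ≤ n − 1 steps cannot
  -- detect, so the verdicts coincide.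
  have hag := (M.agreeBelow_init (List.replicate (n - 1) false) [true] [false] []).iterate
    (t := T n) (by simp; omega)
  have ht := (key true).2 rfl
  unfold MultiTapeTM.HaltsWithin at *
  rw [hag.state] at ht
  exact Bool.noConfusion ((key false).1 ht)

/-! ### A stream machine for the clique problem -/

/-- The operations that control the clique machine, where `m` vertices are guessed. -/
inductive CliqueOp (m : ℕ) where
  /-- compare a bit of the label of the current vertex with a bit of the label of guess `k` -/
  | cmp (β : Bool) (k : Fin m)
  | oracleLeft
  /-- store the set of guesses that are equal to the current vertex -/
  | put
  | workLeft
  /-- process an entry of the adjacency matrix -/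
  | scan (β : Bool)
  /-- evaluate a row of the adjacency matrix -/
  | mark

/-- The finite memory of the clique machine. -/
@[ext] structure CliqueState (m : ℕ) where
  /-- guesses that agree with the current vertex so far -/
  same : Finset (Fin m)
  /-- guesses that are adjacent to all other guesses -/
  good : Finset (Fin m)
  /-- guesses that are adjacent to the vertex of the current row -/
  acc : Finset (Fin m)
  /-- the vertex of the current row has an earlier neighbour that is adjacent to all guesses -/
  pending : Bool
  /-- two adjacent vertices that are adjacent to all guesses have been found -/
  found : Bool

instance (m : ℕ) : Finite (CliqueOp m) := by
  let f : CliqueOp m → (Bool × Fin m) ⊕ Bool ⊕ Fin 4 := fun o => match o with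
    | .cmp β k => .inl (β, k)
    | .scan β => .inr (.inl β)
    | .oracleLeft => .inr (.inr 0)
    | .put => .inr (.inr 1)
    | .workLeft => .inr (.inr 2)
    | .mark => .inr (.inr 3)
  refine Finite.of_injective f ?_
  intro a b h
  cases a <;> cases b <;> simp_all [f]

instance (m : ℕ) : Nonempty (CliqueOp m) := ⟨.put⟩

instance (m : ℕ) : Finite (CliqueState m) := by
  refine Finite.of_injective
    (fun s => (s.same, s.good, s.acc, s.pending, s.found)) ?_
  intro a b h
  simp only [Prod.mk.injEq] at h
  ext1 <;> simp [h]

instance (m : ℕ) : NeZero (Nat.card (CliqueOp m)) := ⟨Nat.card_pos.ne'⟩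

namespace CliqueOp

open Turing MultiTapeTM StreamMachine

variable {m : ℕ}

/-- The contents of a cell of the work tape: the guesses that are equal to the vertex, and whether
the vertex is known to be adjacent to all guesses. -/
abbrev Cell (m : ℕ) : Type := Finset (Fin m) × Bool

/-- The contents of a cell of the work tape; blank cells count as empty. -/
def cell : Option (Bool ⊕ Cell m) → Cell m
  | some (.inr c) => c
  | _ => (∅, false)

/-- The effect of an operation: new state, symbol to write on the work tape, moves on the oracle
tape and the work tape. -/
def next (s : CliqueState m) (o w : Option (Bool ⊕ Cell m)) : CliqueOp m →
    CliqueState m × Option (Bool ⊕ Cell m) × Option Dir × Option Dir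
  | .cmp β k => ({ s with same := if o = some (.inl β) then s.same else s.same.erase k }, w,
      some .right, none)
  | .oracleLeft => (s, w, some .left, none)
  | .put => ({ s with same := Finset.univ }, some (.inr (s.same, false)), none, some .right)
  | .workLeft => (s, w, none, some .left)
  | .scan β => ({ s with
      acc := if β then s.acc ∪ (cell w).1 else s.acc
      pending := s.pending || (β && (cell w).2) }, w, none, some .right)
  | .mark => ({ s with
      good := s.good ∪ (cell w).1.filter fun k => insert k s.acc = Finset.univ
      found := s.found || (decide (s.acc = Finset.univ) && s.pending)
      acc := ∅
      pending := false }, some (.inr ((cell w).1, decide (s.acc = Finset.univ))), none, none)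

/-- The number of an operation. -/
noncomputable def num : CliqueOp m ≃ Fin (Nat.card (CliqueOp m)) := Finite.equivFin _

/-- The unary code of an operation. -/
noncomputable def code (o : CliqueOp m) : List Bool := List.replicate (num o) false ++ [true]

theorem length_code_pos (o : CliqueOp m) : 1 ≤ o.code.length := by simp [code]

theorem length_code_le (o : CliqueOp m) : o.code.length ≤ Nat.card (CliqueOp m) := by
  have := (num o).2
  simp only [code, List.length_append, List.length_replicate, List.length_singleton]
  omega

/-- The machine that executes the operations encoded by its input. -/
noncomputable abbrev machine (m : ℕ) : StreamMachine where
  A := Cell m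
  S := Fin (Nat.card (CliqueOp m)) × CliqueState m
  start := (0, ⟨Finset.univ, ∅, ∅, false, false⟩)
  next s b o w := if b then
      let r := next s.2 o w (num.symm s.1)
      ((0, r.1), r.2)
    else ((s.1 + 1, s.2), w, none, none)
  accept s := decide (s.2.good = Finset.univ) && s.2.found

/-- The state of the clique machine with the positions of the heads and the contents of the work
tape. -/
@[ext] structure Full (m : ℕ) extends CliqueState m where
  oraclePos : ℤ
  workPos : ℤ
  work : ℤ → Cell m

/-- The effect of an operation on the full state, where `y` is the contents of the oracle tape. -/
def apply (y : ℤ → Option Bool) (a : Full m) : CliqueOp m → Full m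
  | .cmp β k => { a with
      same := if y a.oraclePos = some β then a.same else a.same.erase k
      oraclePos := a.oraclePos + 1 }
  | .oracleLeft => { a with oraclePos := a.oraclePos - 1 }
  | .put => { a with
      same := Finset.univ
      work := Function.update a.work a.workPos (a.same, false)
      workPos := a.workPos + 1 }
  | .workLeft => { a with workPos := a.workPos - 1 }
  | .scan β => { a with
      acc := if β then a.acc ∪ (a.work a.workPos).1 else a.acc
      pending := a.pending || (β && (a.work a.workPos).2)
      workPos := a.workPos + 1 }
  | .mark => { a with
      good := a.good ∪ (a.work a.workPos).1.filter fun k => insert k a.acc = Finset.univ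
      found := a.found || (decide (a.acc = Finset.univ) && a.pending)
      work := Function.update a.work a.workPos
        ((a.work a.workPos).1, decide (a.acc = Finset.univ))
      acc := ∅
      pending := false }

/-- The configuration `c` of the machine represents the full state `a`. -/
structure Rep (y : ℤ → Option Bool) (a : Full m) (c : (machine m).Conf) : Prop where
  state : c.1 = ((0, a.toCliqueState) : Fin (Nat.card (CliqueOp m)) × CliqueState m)
  oracle : ∀ i, c.2.1.nth i = (y (a.oraclePos + i)).map Sum.inl
  work : ∀ i, cell (c.2.2.nth i) = a.work (a.workPos + i)

/-- While zeros are read, the machine only counts them, modulo the number of operations; thus finite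
memory suffices and every input can be parsed. On the code of an operation, started from 0, the
count does not wrap around. -/
theorem foldl_replicate_false (n : ℕ) (r : Fin (Nat.card (CliqueOp m))) (s : CliqueState m)
    (T : Tape (Option (Bool ⊕ Cell m)) × Tape (Option (Bool ⊕ Cell m))) :
    (List.replicate n false).foldl (machine m).stepBit ((r, s), T) = ((r + Fin.ofNat _ n, s), T) := by
  induction n generalizing r with
  | zero => simp
  | succ n ih =>
    have h1 : (machine m).stepBit ((r, s), T) false = ((r + 1, s), T) := by
      have h2 : T.2.write T.2.head = T.2 := Tape.write_self T.2
      have h3 : (machine m).stepBit ((r, s), T) false =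
        ((r + 1, s), T.1, T.2.write T.2.head) := rfl
      rw [h3, h2]
    rw [List.replicate_succ, List.foldl_cons, h1, ih]
    congr 2
    apply Fin.ext
    simp only [Fin.val_add, Fin.ofNat, Nat.add_mod_mod, Nat.mod_add_mod, Fin.val_one']
    congr 1
    omega

/-- Tapes are indexed relative to their heads, full states by absolute positions. In the absolute
picture a head move changes one number only, and the oracle tape becomes a fixed function y; all
further analysis takes place there. -/
theorem Rep.foldl_code {y : ℤ → Option Bool} {a : Full m} {c : (machine m).Conf}
    (h : Rep y a c) (o : CliqueOp m) :
    Rep y (apply y a o) (o.code.foldl (machine m).stepBit c) := by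
  obtain ⟨⟨r, s⟩, O, W⟩ := c
  obtain ⟨h1, h2, h3⟩ := h
  simp only [Prod.mk.injEq] at h1
  obtain ⟨rfl, rfl⟩ := h1
  simp only at h2 h3
  have hO : O.head = (y a.oraclePos).map Sum.inl := by
    rw [← Tape.nth_zero, h2, add_zero]
  have hW : cell W.head = a.work a.workPos := by
    rw [← Tape.nth_zero, h3, add_zero]
  have e : o.code.foldl (machine m).stepBit ((0, a.toCliqueState), O, W) =
      ((0, (next a.toCliqueState O.head W.head o).1),
        moveHead (next a.toCliqueState O.head W.head o).2.2.1 O,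
        moveHead (next a.toCliqueState O.head W.head o).2.2.2
          (W.write (next a.toCliqueState O.head W.head o).2.1)) := by
    rw [code, List.foldl_append, foldl_replicate_false]
    have h4 : (0 : Fin (Nat.card (CliqueOp m))) + Fin.ofNat _ (num o).val = num o := by
      rw [zero_add]; simp
    rw [h4]
    have h5 : ∀ r : Fin (Nat.card (CliqueOp m)),
        [true].foldl (machine m).stepBit ((r, a.toCliqueState), O, W) =
        ((0, (next a.toCliqueState O.head W.head (num.symm r)).1),
          moveHead (next a.toCliqueState O.head W.head (num.symm r)).2.2.1 O,
          moveHead (next a.toCliqueState O.head W.head (num.symm r)).2.2.2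
            (W.write (next a.toCliqueState O.head W.head (num.symm r)).2.1)) := fun r => rfl
    rw [h5, Equiv.symm_apply_apply]
  rw [e]
  have hOw : ∀ i, O.nth i = (y (a.oraclePos + i)).map Sum.inl := h2
  have hWw : ∀ i, cell (W.nth i) = a.work (a.workPos + i) := h3
  cases o with
  | cmp β k =>
    refine ⟨?_, fun i => ?_, fun i => ?_⟩
    · have : O.head = some (Sum.inl β) ↔ y a.oraclePos = some β := by
        rw [hO]; cases y a.oraclePos <;> simp
      simp [next, apply, this]
    · simp only [next, apply, moveHead]
      rw [Tape.move_right_nth, hOw]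
      ring_nf
    · simp only [next, apply, moveHead, Tape.write_self]
      exact hWw i
  | oracleLeft =>
    refine ⟨rfl, fun i => ?_, fun i => ?_⟩
    · simp only [next, apply, moveHead]
      rw [Tape.move_left_nth, hOw]
      ring_nf
    · simp only [next, apply, moveHead, Tape.write_self]
      exact hWw i
  | put =>
    refine ⟨rfl, hOw, fun i => ?_⟩
    simp only [next, apply, moveHead]
    rw [Tape.move_right_nth, Tape.write_nth, Function.update_apply,
      show a.workPos + 1 + i = a.workPos + (i + 1) by ring]
    by_cases hi : i + 1 = 0
    · rw [if_pos hi, if_pos (by omega)]; rfl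
    · rw [if_neg hi, if_neg (by omega), hWw]
  | workLeft =>
    refine ⟨rfl, hOw, fun i => ?_⟩
    simp only [next, apply, moveHead]
    rw [Tape.move_left_nth, Tape.write_self, hWw]
    ring_nf
  | scan β =>
    refine ⟨?_, hOw, fun i => ?_⟩
    · simp only [next, apply, hW]
    · simp only [next, apply, moveHead]
      rw [Tape.move_right_nth, Tape.write_self, hWw]
      ring_nf
  | mark =>
    refine ⟨?_, hOw, fun i => ?_⟩
    · simp only [next, apply, hW]
    · simp only [next, apply, moveHead]
      rw [Tape.write_nth, Function.update_apply]
      by_cases hi : i = 0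
      · rw [if_pos hi, if_pos (by omega), hW]; rfl
      · rw [if_neg hi, if_neg (by omega), hWw]

theorem Rep.foldl_codes {y : ℤ → Option Bool} {a : Full m} {c : (machine m).Conf}
    (h : Rep y a c) (l : List (CliqueOp m)) :
    Rep y (l.foldl (apply y) a) ((l.flatMap code).foldl (machine m).stepBit c) := by
  induction l generalizing a c with
  | nil => exact h
  | cons o l ih =>
    rw [List.flatMap_cons, List.foldl_append, List.foldl_cons]
    exact ih (h.foldl_code o)

/-- The contents of a tape that holds the string `y`. -/
def oracleTape (y : List Bool) (p : ℤ) : Option Bool := if 0 ≤ p then y[p.toNat]? else none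

/-- The full state at the start. -/
def Full.init (m : ℕ) : Full m :=
  ⟨⟨Finset.univ, ∅, ∅, false, false⟩, 0, 0, fun _ => (∅, false)⟩

theorem rep_init (y : List Bool) :
    Rep (oracleTape y) (Full.init m) ((machine m).initConf y) := by
  refine ⟨rfl, fun i => ?_, fun i => ?_⟩
  · have h := (machine m).toTM.bitTape_nth y i
    have e : ((machine m).initConf y).2.1.nth i = if 0 ≤ i then (y[i.toNat]?).map Sum.inl
      else none := h
    rw [e]
    simp only [Full.init, zero_add, oracleTape]
    split <;> rfl
  · have h := (machine m).toTM.bitTape_nth [] i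
    have e : ((machine m).initConf y).2.2.nth i = none :=
      h.trans (by simp)
    rw [e]
    rfl

theorem accepts_flatMap_code (l : List (CliqueOp m)) (y : List Bool) :
    (machine m).Accepts (l.flatMap code) y ↔
      (l.foldl (apply (oracleTape y)) (Full.init m)).good = Finset.univ ∧
      (l.foldl (apply (oracleTape y)) (Full.init m)).found = true := by
  have h := ((rep_init (m := m) y).foldl_codes l).state
  unfold Accepts
  rw [h]
  have e : ∀ s : CliqueState m, (machine m).accept ((0, s) : Fin (Nat.card (CliqueOp m)) × _) =
    (decide (s.good = Finset.univ) && s.found) := fun s => rfl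
  rw [e]
  simp

end CliqueOp

/-! ### The operations for a graph and their effect on the full state -/

namespace CliqueOp

variable {m : ℕ}

/-- The lowest `b` binary digits of `u`. -/
def labelBits : ℕ → ℕ → List Bool
  | 0, _ => []
  | b + 1, u => decide (u % 2 = 1) :: labelBits b (u / 2)

theorem length_labelBits (b u : ℕ) : (labelBits b u).length = b := by
  induction b generalizing u with
  | zero => rfl
  | succ b ih => simp [labelBits, ih]

theorem labelBits_injOn {b u v : ℕ} (hu : u < 2 ^ b) (hv : v < 2 ^ b)
    (h : labelBits b u = labelBits b v) : u = v := by
  induction b generalizing u v with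
  | zero => simp at hu hv; omega
  | succ b ih =>
    simp only [labelBits, List.cons.injEq, decide_eq_decide] at h
    have := ih (by rw [pow_succ] at hu; omega) (by rw [pow_succ] at hv; omega) h.2
    omega

/-- The operations that compare a label with the labels of the guesses. -/
def cmpOps (m : ℕ) (bs : List Bool) : List (CliqueOp m) :=
  bs.flatMap fun β => (List.finRange m).map (cmp β)

/-- The operations for the label `u` of a vertex. -/
def putOps (m b u : ℕ) : List (CliqueOp m) :=
  cmpOps m (labelBits b u) ++ List.replicate (b * m) oracleLeft ++ [put]

/-- The operations for row `i` of the adjacency matrix. -/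
def rowOps (m N i : ℕ) (bs : List Bool) : List (CliqueOp m) :=
  bs.map scan ++ List.replicate (N - i) workLeft ++ [mark] ++ List.replicate i workLeft

/-- The operations for the graph on `N` vertices with adjacency matrix `adj`. -/
def graphOps (m N : ℕ) (adj : ℕ → ℕ → Bool) : List (CliqueOp m) :=
  ((List.range N).flatMap fun j => putOps m (Nat.size (N - 1)) (N - 1 - j)) ++
    List.replicate N workLeft ++
    (List.range N).flatMap fun i => rowOps m N i ((List.range N).map (adj i))

variable {y : ℤ → Option Bool}

open Classical in
theorem foldl_cmp (β : Bool) (ks : List (Fin m)) (a : Full m) :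
    (ks.map (cmp β)).foldl (apply y) a = { a with
      same := a.same.filter fun k => ∀ i : ℕ, ks[i]? = some k → y (a.oraclePos + i) = some β
      oraclePos := a.oraclePos + ks.length } := by
  induction ks generalizing a with
  | nil => simp
  | cons k₀ ks ih =>
    rw [List.map_cons, List.foldl_cons, ih]
    ext1 <;> try rfl
    · ext k
      simp only [apply, Finset.mem_filter]
      rw [← Nat.and_forall_add_one (p := fun i => (k₀ :: ks)[i]? = some k →
        y (a.oraclePos + i) = some β)]
      simp only [List.getElem?_cons_zero, List.getElem?_cons_succ, Option.some.injEq,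
        Nat.cast_zero, add_zero, Nat.cast_add, Nat.cast_one]
      have : ∀ i : ℤ, a.oraclePos + 1 + i = a.oraclePos + (i + 1) := fun i => by ring
      simp only [this]
      rw [← and_assoc, Finset.mem_filter]
      refine and_congr_left fun _ => ?_
      split
      · simp_all
      · simp only [Finset.mem_erase]
        constructor
        · rintro ⟨h1, h2⟩
          exact ⟨h2, fun h => absurd h.symm h1⟩
        · rintro ⟨h1, h2⟩
          refine ⟨?_, h1⟩
          rintro rfl
          exact absurd (h2 rfl) ‹_›
    · simp only [apply, List.length_cons]
      push_cast
      ring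

-- Digit t of the label of guess k is expected in oracle cell t * m + k. With this interleaving the
-- m cells next in line are precisely those to be compared with the current digit, so the oracle
-- head only moves right.
open Classical in
theorem foldl_cmpOps (bs : List Bool) (a : Full m) :
    (cmpOps m bs).foldl (apply y) a = { a with
      same := a.same.filter fun k => ∀ (t : ℕ) (β : Bool), bs[t]? = some β →
        y (a.oraclePos + t * m + k.val) = some β
      oraclePos := a.oraclePos + bs.length * m } := by
  induction bs generalizing a with
  | nil => simp [cmpOps]
  | cons β bs ih =>
    rw [cmpOps, List.flatMap_cons, List.foldl_append, foldl_cmp]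
    rw [cmpOps] at ih
    rw [ih]
    ext1 <;> try rfl
    · ext k
      simp only [Finset.mem_filter, List.length_finRange]
      rw [← Nat.and_forall_add_one (p := fun t => ∀ β', (β :: bs)[t]? = some β' →
        y (a.oraclePos + t * m + k.val) = some β')]
      simp only [List.getElem?_cons_zero, List.getElem?_cons_succ, Option.some.injEq,
        Nat.cast_zero, zero_mul, add_zero, Nat.cast_add, Nat.cast_one]
      have h1 : ∀ t : ℤ, a.oraclePos + m + t * m + k.val = a.oraclePos + (t + 1) * m + k.val :=
        fun t => by ring
      simp only [h1]
      rw [← and_assoc]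
      refine and_congr_left fun _ => and_congr_right fun _ => ?_
      constructor
      · rintro h β' rfl
        exact h k (by simp)
      · intro h i hi
        rw [List.getElem?_eq_some_iff] at hi
        obtain ⟨hi1, hi2⟩ := hi
        have : i = k.val := by rw [← hi2]; simp
        rw [this]
        exact h β rfl
    · simp only [List.length_cons, List.length_finRange]
      push_cast
      ring

theorem foldl_oracleLeft (n : ℕ) (a : Full m) :
    (List.replicate n oracleLeft).foldl (apply y) a =
      { a with oraclePos := a.oraclePos - n } := by
  induction n generalizing a with
  | zero => simp
  | succ n ih =>
    rw [List.replicate_succ, List.foldl_cons, ih]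
    simp only [apply]
    congr 1
    push_cast
    ring

theorem foldl_workLeft (n : ℕ) (a : Full m) :
    (List.replicate n workLeft).foldl (apply y) a = { a with workPos := a.workPos - n } := by
  induction n generalizing a with
  | zero => simp
  | succ n ih =>
    rw [List.replicate_succ, List.foldl_cons, ih]
    simp only [apply]
    congr 1
    push_cast
    ring

open Classical in
/-- The guesses with label `u`. -/
noncomputable def guesses (m : ℕ) (y : ℤ → Option Bool) (b u : ℕ) : Finset (Fin m) :=
  Finset.univ.filter fun k => ∀ (t : ℕ) (β : Bool), (labelBits b u)[t]? = some β →
    y (t * m + k.val) = some β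

/-- The b * m comparisons are undone by as many left moves and `put` resets the set of candidates,
so the next vertex meets the same hypotheses. -/
theorem foldl_putOps (b u : ℕ) {a : Full m} (ho : a.oraclePos = 0) (hs : a.same = Finset.univ) :
    (putOps m b u).foldl (apply y) a = { a with
      work := Function.update a.work a.workPos (guesses m y b u, false)
      workPos := a.workPos + 1 } := by
  rw [putOps, List.foldl_append, List.foldl_append, foldl_cmpOps, foldl_oracleLeft]
  simp only [List.foldl_cons, List.foldl_nil, apply, ho, hs, length_labelBits]
  ext1 <;> try rfl
  · simp [hs]
  · simp
  · refine congrArg (fun G => Function.update a.work a.workPos (G, false)) (a₂ := guesses m y b u) ?_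
    ext k
    simp [guesses, ho]

/-- Vertex j has the label N − 1 − j. The order is reversed because the program that writes these
operations counts down the remaining vertices and takes the label from its counter. -/
theorem foldl_putOps_range (b N n : ℕ) {a : Full m} (ho : a.oraclePos = 0)
    (hs : a.same = Finset.univ) (hw : a.workPos = 0) :
    ((List.range n).flatMap fun j => putOps m b (N - 1 - j)).foldl (apply y) a = { a with
      work := fun p => if 0 ≤ p ∧ p < n then (guesses m y b (N - 1 - p.toNat), false)
        else a.work p
      workPos := n } := by
  induction n with
  | zero =>
    ext1 <;> try rfl
    · exact hw
    · funext p
      exact (if_neg (by omega)).symm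
  | succ n ih =>
    rw [List.range_succ, List.flatMap_append, List.foldl_append, ih, List.flatMap_singleton]
    rw [foldl_putOps b _ (by exact ho) (by exact hs)]
    ext1 <;> try rfl
    · funext p
      simp only [Function.update_apply]
      by_cases hp : p = n
      · rw [if_pos hp, if_pos (by push_cast; omega), hp]
        simp
      · rw [if_neg hp]
        by_cases h1 : 0 ≤ p ∧ p < n
        · rw [if_pos h1, if_pos (by push_cast; omega)]
        · rw [if_neg h1, if_neg (by push_cast; omega)]

open Classical in
theorem foldl_scan (bs : List Bool) (a : Full m) :
    (bs.map scan).foldl (apply y) a = { a with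
      acc := a.acc ∪ Finset.univ.filter fun k =>
        ∃ i : ℕ, bs[i]? = some true ∧ k ∈ (a.work (a.workPos + i)).1
      pending := a.pending ||
        decide (∃ i : ℕ, bs[i]? = some true ∧ (a.work (a.workPos + i)).2 = true)
      workPos := a.workPos + bs.length } := by
  induction bs generalizing a with
  | nil =>
    ext1 <;> simp
  | cons β bs ih =>
    rw [List.map_cons, List.foldl_cons, ih]
    have h0 : ∀ p : ℕ → Prop, (∃ i, p i) ↔ (p 0 ∨ ∃ i, p (i + 1)) := fun p =>
      (Nat.or_exists_add_one (p := p)).symm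
    have h1 : ∀ i : ℤ, a.workPos + 1 + i = a.workPos + (i + 1) := fun i => by ring
    ext1 <;> try rfl
    · ext k
      simp only [apply, Finset.mem_union, Finset.mem_filter, Finset.mem_univ, true_and, h1]
      rw [h0 fun i => (β :: bs)[i]? = some true ∧ k ∈ (a.work (a.workPos + i)).1]
      cases β <;> simp [or_assoc]
    · simp only [apply, h1]
      rw [Bool.eq_iff_iff]
      simp only [Bool.or_eq_true, Bool.and_eq_true, decide_eq_true_eq]
      rw [h0 fun i => (β :: bs)[i]? = some true ∧ (a.work (a.workPos + i)).2 = true]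
      cases β <;> simp [or_assoc]
    · simp only [apply, List.length_cons]
      push_cast
      ring

/-- The guesses that are adjacent to vertex `i`. -/
noncomputable def nearby (y : ℤ → Option Bool) (b N : ℕ) (adj : ℕ → ℕ → Bool) (i : ℕ) :
    Finset (Fin m) :=
  open Classical in
  Finset.univ.filter fun k => ∃ j < N, adj i j = true ∧ k ∈ guesses m y b (N - 1 - j)

/-- The full state between the rows of the adjacency matrix, after `n` rows. -/
noncomputable def between (y : ℤ → Option Bool) (b N : ℕ) (adj : ℕ → ℕ → Bool) (n : ℕ) : Full m :=
  open Classical in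
  { same := Finset.univ
    good := Finset.univ.filter fun k =>
      ∃ i < n, k ∈ guesses m y b (N - 1 - i) ∧ insert k (nearby y b N adj i) = Finset.univ
    acc := ∅
    pending := false
    found := decide (∃ i < n, ∃ j < i, adj i j = true ∧
      nearby (m := m) y b N adj i = Finset.univ ∧ nearby (m := m) y b N adj j = Finset.univ)
    oraclePos := 0
    workPos := 0
    work := fun p => if 0 ≤ p ∧ p < N then (guesses m y b (N - 1 - p.toNat),
      decide (p < n ∧ nearby (m := m) y b N adj p.toNat = Finset.univ)) else (∅, false) }

/-- Scanning row i collects the guesses adjacent to vertex i and notices a neighbour that is already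
flagged as adjacent to all guesses. The scan ends at cell N; N − i moves lead to cell i, where the
row is evaluated and vertex i is flagged if it qualifies, and i further moves lead back to cell 0.
-/
theorem foldl_rowOps (b N : ℕ) (adj : ℕ → ℕ → Bool) (i : ℕ) (hi : i < N) :
    (rowOps m N i ((List.range N).map (adj i))).foldl (apply y) (between y b N adj i) =
      between y b N adj (i + 1) := by
  classical
  have hbs : ∀ j : ℕ, ((List.range N).map (adj i))[j]? = some true ↔ j < N ∧ adj i j = true := by
    intro j
    rw [List.getElem?_map]
    by_cases hj : j < N
    · simp [hj]
    · rw [List.getElem?_eq_none (by simp; omega)]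
      simp [hj]
  rw [rowOps, List.foldl_append, List.foldl_append, List.foldl_append, foldl_scan, foldl_workLeft,
    foldl_workLeft]
  have hacc : (Finset.univ.filter fun k => ∃ j : ℕ, ((List.range N).map (adj i))[j]? = some true ∧
      k ∈ ((between (m := m) y b N adj i).work ((between (m := m) y b N adj i).workPos + j)).1) =
      nearby y b N adj i := by
    ext k
    simp only [Finset.mem_filter, Finset.mem_univ, true_and, nearby, hbs]
    refine exists_congr fun j => ?_
    rw [and_assoc]
    refine and_congr_right fun hj => and_congr_right fun _ => ?_
    simp only [between, zero_add]
    rw [if_pos (by omega)]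
    simp
  -- Only vertices of earlier rows can carry a flag, so a suitable edge is looked for in the row of
  -- its larger end.
  have hpen : (∃ j : ℕ, ((List.range N).map (adj i))[j]? = some true ∧
      ((between (m := m) y b N adj i).work ((between (m := m) y b N adj i).workPos + j)).2 = true) ↔
      ∃ j < i, adj i j = true ∧ nearby (m := m) y b N adj j = Finset.univ := by
    simp only [hbs]
    refine exists_congr fun j => ?_
    constructor
    · rintro ⟨⟨h1, h2⟩, h3⟩
      simp only [between, zero_add] at h3
      rw [if_pos (by omega)] at h3
      simp only [decide_eq_true_eq, Int.toNat_natCast] at h3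
      exact ⟨by omega, h2, h3.2⟩
    · rintro ⟨h1, h2, h3⟩
      refine ⟨⟨by omega, h2⟩, ?_⟩
      simp only [between, zero_add]
      rw [if_pos (by omega)]
      simp only [decide_eq_true_eq, Int.toNat_natCast]
      exact ⟨by omega, h3⟩
  rw [hacc]
  simp only [hpen, List.foldl_cons, List.foldl_nil, apply, List.length_map, List.length_range]
  have hpos : (between (m := m) y b N adj i).workPos + (N : ℤ) - ((N - i : ℕ) : ℤ) = i := by
    simp only [between]; omega
  rw [hpos]
  have hwork : (between (m := m) y b N adj i).work i = (guesses m y b (N - 1 - i), false) := by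
    simp only [between]
    rw [if_pos (by omega)]
    simp
  rw [hwork]
  ext1
  · rfl
  · ext k
    simp only [between, Finset.mem_union, Finset.mem_filter, Finset.mem_univ, true_and,
      Finset.empty_union]
    constructor
    · rintro (⟨j, h1, h2⟩ | h)
      · exact ⟨j, by omega, h2⟩
      · exact ⟨i, by omega, h⟩
    · rintro ⟨j, h1, h2⟩
      rcases Nat.lt_succ_iff_lt_or_eq.1 h1 with h | rfl
      · exact .inl ⟨j, h, h2⟩
      · exact .inr h2
  · rfl
  · rfl
  · rw [Bool.eq_iff_iff]
    simp only [between, Bool.or_eq_true, Bool.and_eq_true, decide_eq_true_eq,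
      Finset.empty_union, Bool.false_or]
    constructor
    · rintro (⟨j, h1, h2⟩ | ⟨h1, j, h2, h3, h4⟩)
      · exact ⟨j, by omega, h2⟩
      · exact ⟨i, by omega, j, h2, h3, h1, h4⟩
    · rintro ⟨j, h1, j', h2, h3, h4, h5⟩
      rcases Nat.lt_succ_iff_lt_or_eq.1 h1 with h | rfl
      · exact .inl ⟨j, h, j', h2, h3, h4, h5⟩
      · exact .inr ⟨h4, j', h2, h3, h5⟩
  · rfl
  · simp [between]
  · funext p
    simp only [Function.update_apply, between, Finset.empty_union]
    by_cases hp : p = i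
    · subst hp
      rw [if_pos rfl, if_pos (by omega)]
      simp
    · rw [if_neg hp]
      by_cases h1 : 0 ≤ p ∧ p < N
      · rw [if_pos h1, if_pos h1]
        have : p < i ↔ p < ((i + 1 : ℕ) : ℤ) := by push_cast; omega
        simp only [this]
      · rw [if_neg h1, if_neg h1]

theorem foldl_graphOps (N : ℕ) (adj : ℕ → ℕ → Bool) :
    (graphOps m N adj).foldl (apply y) (Full.init m) = between y (Nat.size (N - 1)) N adj N := by
  rw [graphOps, List.foldl_append, List.foldl_append, foldl_putOps_range _ _ _ rfl rfl rfl,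
    foldl_workLeft]
  have h0 : ({ Full.init m with
      work := fun p => if 0 ≤ p ∧ p < N then (guesses m y (Nat.size (N - 1)) (N - 1 - p.toNat), false)
        else (Full.init m).work p
      workPos := (N : ℤ) - N } : Full m) = between y (Nat.size (N - 1)) N adj 0 := by
    ext1
    all_goals try (simp [Full.init, between]; done)
    · funext p
      simp only [between, Full.init]
      by_cases h1 : 0 ≤ p ∧ p < N
      · rw [if_pos h1, if_pos h1]
        have : ¬ p < 0 := by omega
        simp [this]
      · rw [if_neg h1, if_neg h1]
  refine (congrArg (fun a => List.foldl (apply y) a _) h0).trans ?_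
  have : ∀ n ≤ N, ((List.range n).flatMap fun i =>
      rowOps m N i ((List.range N).map (adj i))).foldl (apply y)
      (between y (Nat.size (N - 1)) N adj 0) = between y (Nat.size (N - 1)) N adj n := by
    intro n hn
    induction n with
    | zero => rfl
    | succ n ih =>
      rw [List.range_succ, List.flatMap_append, List.foldl_append, ih (by omega),
        List.flatMap_singleton, foldl_rowOps _ _ _ _ (by omega)]
  exact this N le_rfl

end CliqueOp

/-! ### Correctness of the clique machine and the length of its input -/

namespace CliqueOp

variable {m : ℕ}

/-- The adjacency relation of a graph on `Fin N` as a Boolean function on natural numbers. -/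
noncomputable def adjFun {N : ℕ} (G : SimpleGraph (Fin N)) (i j : ℕ) : Bool :=
  open Classical in decide (∃ (hi : i < N) (hj : j < N), G.Adj ⟨i, hi⟩ ⟨j, hj⟩)

theorem adjFun_iff {N : ℕ} {G : SimpleGraph (Fin N)} (i j : Fin N) :
    adjFun G i j = true ↔ G.Adj i j := by
  simp [adjFun]

/-- The cells of guess k spell at most one string of b digits, and b digits determine a number below
2 ^ b. -/
theorem eq_of_mem_guesses {y : ℤ → Option Bool} {b u v : ℕ} (hu : u < 2 ^ b) (hv : v < 2 ^ b)
    {k : Fin m} (h : k ∈ guesses m y b u) (h' : k ∈ guesses m y b v) : u = v := by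
  simp only [guesses, Finset.mem_filter, Finset.mem_univ, true_and] at h h'
  refine labelBits_injOn hu hv (List.ext_getElem ?_ fun t h1 h2 => ?_)
  · rw [length_labelBits, length_labelBits]
  · have e1 := h t _ (List.getElem?_eq_getElem h1)
    have e2 := h' t _ (List.getElem?_eq_getElem h2)
    exact Option.some.inj (e1.symm.trans e2)

theorem label_lt {N i : ℕ} : N - 1 - i < 2 ^ Nat.size (N - 1) :=
  (Nat.sub_le _ _).trans_lt (Nat.lt_size_self _)

/-- Being adjacent to a guess means being adjacent to some vertex with its label; labels are unique,
so this vertex is v k. -/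
theorem exists_adj_of_mem_nearby {y : ℤ → Option Bool} {N : ℕ} {G : SimpleGraph (Fin N)}
    {v : Fin m → Fin N} (hv : ∀ k, k ∈ guesses m y (Nat.size (N - 1)) (N - 1 - v k)) {i : Fin N}
    {k : Fin m} (h : k ∈ nearby y (Nat.size (N - 1)) N (adjFun G) i) : G.Adj i (v k) := by
  simp only [nearby, Finset.mem_filter, Finset.mem_univ, true_and] at h
  obtain ⟨j, hj, h1, h2⟩ := h
  have h3 := eq_of_mem_guesses label_lt label_lt h2 (hv k)
  have := (v k).2
  have h4 : v k = ⟨j, hj⟩ := Fin.ext (by simp only; omega)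
  rw [h4, ← adjFun_iff]
  exact h1

/-- The adjacencies give a homomorphism from a complete graph on m + 2 vertices. It is injective
since G has no loops, so the vertices need not be assumed distinct. -/
theorem not_cliqueFree_of_adj {V : Type*} {G : SimpleGraph V} {v : Fin m → V} {a b : V}
    (hv : ∀ k k', k ≠ k' → G.Adj (v k) (v k')) (ha : ∀ k, G.Adj a (v k))
    (hb : ∀ k, G.Adj b (v k)) (hab : G.Adj a b) : ¬ G.CliqueFree (m + 2) := by
  let φ : (⊤ : SimpleGraph (Option (Option (Fin m)))) →g G :=
    ⟨fun x => x.elim a fun x => x.elim b v, by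
      rintro (_ | _ | k) (_ | _ | k') h
      · exact absurd rfl h
      · exact hab
      · exact ha k'
      · exact hab.symm
      · exact absurd rfl h
      · exact hb k'
      · exact (ha k).symm
      · exact (hb k).symm
      · exact hv k k' fun e => h (by rw [e])⟩
  have h : ¬ G.CliqueFree (Fintype.card (Option (Option (Fin m)))) := fun h =>
    SimpleGraph.cliqueFree_iff_top_free.1 h ⟨⟨φ, φ.injective_of_top_hom⟩⟩
  simpa using h

/-- Soundness holds for arbitrary oracle bits. That every guess is good means that it is the label
of a vertex adjacent to all other guesses; equal guesses are thereby excluded, as no vertex is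
adjacent to itself. The flag `found` supplies the two remaining vertices. -/
theorem not_cliqueFree_of_accepts {N : ℕ} (G : SimpleGraph (Fin N)) {y : List Bool}
    (h : (machine m).Accepts ((graphOps m N (adjFun G)).flatMap code) y) :
    ¬ G.CliqueFree (m + 2) := by
  rw [accepts_flatMap_code, foldl_graphOps] at h
  obtain ⟨h1, h2⟩ := h
  have h3 : ∀ k : Fin m, ∃ i : Fin N,
      k ∈ guesses m (oracleTape y) (Nat.size (N - 1)) (N - 1 - i) ∧
      insert k (nearby (oracleTape y) (Nat.size (N - 1)) N (adjFun G) i) = Finset.univ := by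
    intro k
    have : k ∈ (between (m := m) (oracleTape y) (Nat.size (N - 1)) N (adjFun G) N).good := by
      rw [h1]; exact Finset.mem_univ k
    simp only [between, Finset.mem_filter, Finset.mem_univ, true_and] at this
    obtain ⟨i, hi, h⟩ := this
    exact ⟨⟨i, hi⟩, h⟩
  choose v hv hv' using h3
  simp only [between, decide_eq_true_eq] at h2
  obtain ⟨i, hi, j, hj, hij, hi', hj'⟩ := h2
  refine not_cliqueFree_of_adj (v := v) (a := ⟨i, hi⟩) (b := ⟨j, hj.trans hi⟩) ?_ ?_ ?_ ?_
  · intro k k' hk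
    have : k' ∈ insert k (nearby (oracleTape y) (Nat.size (N - 1)) N (adjFun G) (v k)) := by
      rw [hv']; exact Finset.mem_univ k'
    exact exists_adj_of_mem_nearby hv ((Finset.mem_insert.1 this).resolve_left hk.symm)
  · intro k
    exact exists_adj_of_mem_nearby hv (by rw [hi']; exact Finset.mem_univ k)
  · intro k
    exact exists_adj_of_mem_nearby hv (by rw [hj']; exact Finset.mem_univ k)
  · rw [← adjFun_iff]; exact hij

/-- The oracle bits for the labels `u k`. -/
def oracleBits (b : ℕ) (u : Fin m → ℕ) : List Bool :=
  List.ofFn fun p : Fin (m * b) =>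
    (labelBits b (u ⟨p % m, Nat.mod_lt _ (Nat.pos_of_ne_zero fun h => by
      subst h; exact absurd p.2 (by simp))⟩)).getD (p / m) false

/-- A digit does not depend on how many digits are taken. This is needed because the oracle may be
longer than the labels of a particular graph. -/
theorem labelBits_getElem?_of_le {b b' u t : ℕ} (hb : b ≤ b') (ht : t < b) :
    (labelBits b u)[t]? = (labelBits b' u)[t]? := by
  induction b generalizing b' u t with
  | zero => omega
  | succ b ih =>
    obtain ⟨b', rfl⟩ : ∃ c, b' = c + 1 := ⟨b' - 1, by omega⟩
    cases t with
    | zero => rfl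
    | succ t =>
      simp only [labelBits, List.getElem?_cons_succ]
      exact ih (by omega) (by omega)

/-- Division of t * m + k by m recovers the digit t and the guess k. Cells from b * m onwards hold
surplus digits and have no influence. -/
theorem mem_guesses_oracleBits {b b' : ℕ} (hb : b ≤ b') (u : Fin m → ℕ) (k : Fin m) :
    k ∈ guesses m (oracleTape (oracleBits b' u)) b (u k) := by
  simp only [guesses, Finset.mem_filter, Finset.mem_univ, true_and]
  intro t β h
  have ht : t < b := by
    have := (List.getElem?_eq_some_iff.1 h).1
    rwa [length_labelBits] at this
  rw [labelBits_getElem?_of_le hb ht] at h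
  have hk := k.2
  have hlt : t * m + k.val < m * b' := by
    have : (t + 1) * m ≤ b' * m := Nat.mul_le_mul_right m (by omega)
    rw [mul_comm m b']
    linarith [Nat.succ_mul t m]
  rw [oracleTape, if_pos (by positivity),
    show ((t : ℤ) * m + k.val).toNat = t * m + k.val by exact_mod_cast Int.toNat_natCast _]
  rw [oracleBits, List.getElem?_ofFn, dif_pos hlt]
  have h1 : (t * m + k.val) % m = k.val := by
    rw [Nat.mul_add_mod', Nat.mod_eq_of_lt hk]
  have h2 : (t * m + k.val) / m = t := by
    rw [mul_comm, Nat.mul_add_div (by omega), Nat.div_eq_of_lt hk, add_zero]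
  simp only [h1, h2, List.getD_eq_getElem?_getD, Fin.eta, h, Option.getD_some]

theorem accepts_of_not_cliqueFree {N : ℕ} {G : SimpleGraph (Fin N)} (h : ¬ G.CliqueFree (m + 2))
    {b : ℕ} (hb : Nat.size (N - 1) ≤ b) :
    ∃ y : List Bool, y.length = m * b ∧
      (machine m).Accepts ((graphOps m N (adjFun G)).flatMap code) y := by
  classical
  let e := SimpleGraph.topEmbeddingOfNotCliqueFree h
  have he : ∀ x x', x ≠ x' → G.Adj (e x) (e x') := fun x x' hx => e.map_rel_iff.2 hx
  obtain ⟨v, a, a', hv, ha, ha', haa, hlt⟩ : ∃ (v : Fin m → Fin N) (a a' : Fin N),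
      (∀ k k', k ≠ k' → G.Adj (v k) (v k')) ∧ (∀ k, G.Adj a (v k)) ∧ (∀ k, G.Adj a' (v k)) ∧
      G.Adj a a' ∧ a' < a := by
    have hv : ∀ k k' : Fin m, k ≠ k' → G.Adj (e (k.castAdd 2)) (e (k'.castAdd 2)) :=
      fun k k' hk => he _ _ fun h => hk (Fin.castAdd_injective _ _ h)
    have hn : ∀ (i : Fin 2) (k : Fin m), G.Adj (e (i.natAdd m)) (e (k.castAdd 2)) :=
      fun i k => he _ _ fun h => by
        have := congrArg Fin.val h
        simp only [Fin.val_natAdd, Fin.val_castAdd] at this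
        omega
    have h01 : G.Adj (e (Fin.natAdd m 0)) (e (Fin.natAdd m 1)) :=
      he _ _ fun h => by simpa using congrArg Fin.val h
    -- The machine finds the final edge in the row of its larger end, so the two unguessed vertices
    -- are named according to their order.
    rcases lt_or_gt_of_ne h01.ne with h | h
    · exact ⟨fun k => e (k.castAdd 2), _, _, hv, hn 1, hn 0, h01.symm, h⟩
    · exact ⟨fun k => e (k.castAdd 2), _, _, hv, hn 0, hn 1, h01, h⟩
  refine ⟨oracleBits b fun k => N - 1 - v k, by simp [oracleBits], ?_⟩
  have hg : ∀ k, k ∈ guesses m (oracleTape (oracleBits b fun k => N - 1 - v k))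
      (Nat.size (N - 1)) (N - 1 - v k) := fun k =>
    mem_guesses_oracleBits hb (fun k => N - 1 - v k) k
  have hnear : ∀ (i : Fin N) (k : Fin m), G.Adj i (v k) →
      k ∈ nearby (oracleTape (oracleBits b fun k => N - 1 - v k)) (Nat.size (N - 1)) N
        (adjFun G) i := by
    intro i k hik
    simp only [nearby, Finset.mem_filter, Finset.mem_univ, true_and]
    exact ⟨v k, (v k).2, adjFun_iff _ _ |>.2 hik, hg k⟩
  rw [accepts_flatMap_code, foldl_graphOps]
  constructor
  · refine Finset.eq_univ_iff_forall.2 fun k => ?_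
    simp only [between, Finset.mem_filter, Finset.mem_univ, true_and]
    refine ⟨v k, (v k).2, hg k, Finset.eq_univ_iff_forall.2 fun k' => ?_⟩
    rw [Finset.mem_insert]
    by_cases hk : k' = k
    · exact .inl hk
    · exact .inr (hnear _ _ (hv k k' (Ne.symm hk)))
  · simp only [between, decide_eq_true_eq]
    exact ⟨a, a.2, a', hlt, (adjFun_iff _ _).2 haa,
      Finset.eq_univ_iff_forall.2 fun k => hnear _ _ (ha k),
      Finset.eq_univ_iff_forall.2 fun k => hnear _ _ (ha' k)⟩

/-- The input of the machine for a graph. -/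
noncomputable def graphWord (m : ℕ) {N : ℕ} (G : SimpleGraph (Fin N)) : List Bool :=
  (graphOps m N (adjFun G)).flatMap code

theorem length_le_length_flatMap_code (l : List (CliqueOp m)) :
    l.length ≤ (l.flatMap code).length := by
  induction l with
  | nil => simp
  | cons o l ih =>
    have := length_code_pos o
    simp only [List.length_cons, List.flatMap_cons, List.length_append]
    omega

theorem length_flatMap_code_le (l : List (CliqueOp m)) :
    (l.flatMap code).length ≤ Nat.card (CliqueOp m) * l.length := by
  induction l with
  | nil => simp
  | cons o l ih =>
    have := length_code_le o
    simp only [List.length_cons, List.flatMap_cons, List.length_append, Nat.mul_succ]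
    omega

theorem length_flatMap_const {α β : Type*} (l : List α) (f : α → List β) {n : ℕ}
    (h : ∀ x ∈ l, (f x).length = n) : (l.flatMap f).length = l.length * n := by
  induction l with
  | nil => simp
  | cons x l ih =>
    rw [List.flatMap_cons, List.length_append, h x (by simp), ih fun x hx => h x (by simp [hx]),
      List.length_cons]
    ring

theorem length_putOps (m b u : ℕ) : (putOps m b u).length = 2 * (b * m) + 1 := by
  simp only [putOps, cmpOps, List.length_append, List.length_replicate, List.length_singleton]
  rw [length_flatMap_const (n := m) _ _ (by simp), length_labelBits]
  ring

theorem length_rowOps {m N i : ℕ} (hi : i < N) (bs : List Bool) :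
    (rowOps m N i bs).length = bs.length + N + 1 := by
  simp only [rowOps, List.length_append, List.length_replicate, List.length_singleton,
    List.length_map]
  omega

theorem length_graphOps (m N : ℕ) (adj : ℕ → ℕ → Bool) :
    (graphOps m N adj).length = N * (2 * (Nat.size (N - 1) * m) + 1) + N + N * (N + N + 1) := by
  simp only [graphOps, List.length_append, List.length_replicate]
  rw [length_flatMap_const (n := 2 * (Nat.size (N - 1) * m) + 1) _ _
      (fun _ _ => length_putOps _ _ _),
    length_flatMap_const (n := N + N + 1) _ _ (fun i hi => by
      rw [length_rowOps (List.mem_range.1 hi)]; simp)]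
  simp

/-- The word must not be too short either: the length of the oracle is computed from it, and N²
letters are what makes half a logarithm enough for a label. -/
theorem sq_le_length_graphWord {N : ℕ} (G : SimpleGraph (Fin N)) :
    N ^ 2 ≤ (graphWord m G).length := by
  refine le_trans ?_ (length_le_length_flatMap_code _)
  rw [length_graphOps]
  nlinarith [Nat.zero_le (N * (2 * (Nat.size (N - 1) * m) + 1))]

theorem size_pred_le (N : ℕ) : Nat.size (N - 1) ≤ N := by
  rw [Nat.size_le]
  exact (Nat.sub_le _ _).trans_lt Nat.lt_two_pow_self

/-- The labels contribute O(N log N) operations; bounding their number of digits crudely by N still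
gives O(N²), the order of the matrix part. -/
theorem length_graphWord_le {N : ℕ} (G : SimpleGraph (Fin N)) :
    (graphWord m G).length ≤ Nat.card (CliqueOp m) * (2 * m + 3) * (N + 1) ^ 2 := by
  refine (length_flatMap_code_le _).trans ?_
  rw [length_graphOps, mul_assoc]
  refine Nat.mul_le_mul_left _ ?_
  have h1 : N * (Nat.size (N - 1) * m) ≤ N * (N * m) :=
    Nat.mul_le_mul_left _ (Nat.mul_le_mul_right _ (size_pred_le N))
  nlinarith [Nat.zero_le (m * N)]

/-- Taking logarithms, N is at most 2 to the power on the right. The digits are those of the largest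
label N − 1, which stays strictly below this power even when N equals it. -/
theorem size_le_ceil {N n : ℕ} (h : N ^ 2 ≤ n) :
    Nat.size (N - 1) ≤ ⌈(1 / 2 : ℝ) * Real.logb 2 n⌉₊ := by
  rcases Nat.eq_zero_or_pos N with rfl | hN
  · simp
  rw [Nat.size_le]
  have h1 : (N : ℝ) ≤ 2 ^ ⌈(1 / 2 : ℝ) * Real.logb 2 n⌉₊ := by
    have h2 : Real.logb 2 N ≤ (1 / 2 : ℝ) * Real.logb 2 n := by
      have h3 : Real.logb 2 ((N : ℝ) ^ 2) ≤ Real.logb 2 n :=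
        Real.logb_le_logb_of_le one_lt_two (by positivity) (by exact_mod_cast h)
      rw [Real.logb_pow] at h3
      push_cast at h3
      linarith
    have h4 := h2.trans (Nat.le_ceil _)
    rw [Real.logb_le_iff_le_rpow one_lt_two (by positivity), Real.rpow_natCast] at h4
    exact h4
  have : N ≤ 2 ^ ⌈(1 / 2 : ℝ) * Real.logb 2 n⌉₊ := by exact_mod_cast h1
  omega

/-- The clique problem reduces to the language of the clique machine. -/
theorem graphWord_mem_language {N : ℕ} (G : SimpleGraph (Fin N)) :
    graphWord m G ∈ (machine m).language (fun n => m * ⌈(1 / 2 : ℝ) * Real.logb 2 n⌉₊) ↔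
      ¬ G.CliqueFree (m + 2) := by
  constructor
  · rintro ⟨y, -, hy⟩
    exact not_cliqueFree_of_accepts G hy
  · intro h
    exact accepts_of_not_cliqueFree h (size_le_ceil (sq_le_length_graphWord G))

end CliqueOp

/-! ### Writing the input of the clique machine on the simulated input tape -/

namespace RAM

/-- `hs'` has the same output as `hs`, and the same variables except for those in `X`. -/
structure Keeps (X : List ℕ) (hs hs' : HS) : Prop where
  var : ∀ v, v ∉ X → hs'.var v = hs.var v
  out : hs'.out = hs.out

theorem Keeps.refl (X : List ℕ) (hs : HS) : Keeps X hs hs := ⟨fun _ _ => rfl, rfl⟩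

theorem Keeps.trans {X : List ℕ} {a b c : HS} (h : Keeps X a b) (h' : Keeps X b c) :
    Keeps X a c := ⟨fun v hv => (h'.var v hv).trans (h.var v hv), h'.out.trans h.out⟩

theorem Keeps.mono {X Y : List ℕ} {a b : HS} (h : Keeps X a b) (hXY : X ⊆ Y) : Keeps Y a b :=
  ⟨fun v hv => h.var v fun hx => hv (hXY hx), h.out⟩

theorem Keeps.setv {X : List ℕ} {hs : HS} {v : ℕ} (hv : v ∈ X) (z : ℤ) :
    Keeps X hs (hs.setv v z) :=
  ⟨fun u hu => by rw [HS.setv_var, if_neg (by rintro rfl; exact hu hv)], rfl⟩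

/-- The loop rule with an invariant P n indexed by the number n of rounds still to come, for bodies
of bounded cost. -/
theorem Does.loop {b V : ℕ} (hV : b ≤ V) {v : ℕ} (hv : v < b) {F : Frag} {k : ℕ}
    (P : ℕ → HS → Prop) (h0 : ∀ hs, P 0 hs → hs.var v ≤ 0)
    (h1 : ∀ n hs, P (n + 1) hs → 0 < hs.var v ∧ ∃ hs', Does b V F hs hs' k ∧ P n hs') {n : ℕ}
    {hs : HS} (h : P n hs) :
    ∃ hs', Does b V (Frag.loop v F) hs hs' (n * (k + 3) + 3) ∧ P 0 hs' := by
  induction n generalizing hs with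
  | zero => exact ⟨hs, (Does.loop_exit hV hv (h0 hs h)).mono (by omega), h⟩
  | succ n ih =>
    obtain ⟨h2, hs', h3, h4⟩ := h1 n hs h
    obtain ⟨hs'', h5, h6⟩ := ih h4
    exact ⟨hs'', (Does.loop_step hV hv h2 h3 h5).mono (by rw [Nat.succ_mul]; omega), h6⟩

end RAM

namespace MultiTapeTM

open RAM Turing

variable {M : MultiTapeTM}

/-- The string `w` stands on tape `0`, whose first cell has the address `h0`, variable `1` points to
the end of `w`, and all other cells are blank. -/
structure Emitted (C : M.Coding) (h0 : ℤ) (w : List Bool) (hs : HS) : Prop where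
  ptr : hs.var 1 = h0 + M.stride * w.length
  cells : ∀ j : ℤ, M.lowest ≤ h0 + M.stride * j →
    hs.mem (h0 + M.stride * j) = C.sym ((M.bitTape w).nth j)
  blank : ∀ a : ℤ, M.lowest ≤ a → ¬ M.stride ∣ a - h0 → hs.mem a = 0

/-- Append a bit to the string on tape `0`. -/
def emitBit (C : M.Coding) (b : Bool) : Frag :=
  (Frag.stm 1 (.lit (C.sym (some (.inl b))))).seq (Frag.add 1 (.var 1) (.lit M.stride))

/-- There is room for the string `total` on tape `0` below the address `V`. -/
structure Room (C : M.Coding) (V : ℕ) (h0 : ℤ) (total : List Bool) : Prop where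
  fits : C.Fits V
  low : M.lowest ≤ h0
  room : h0 + M.stride * total.length ≤ V

variable {C : M.Coding} {V : ℕ} {h0 : ℤ} {total : List Bool}

theorem Room.stride_le (h : Room C V h0 total) : |M.stride| ≤ V := by
  have h1 := h.fits.vars
  rw [abs_of_pos M.stride_pos]
  unfold stride
  unfold numVars at h1
  exact_mod_cast (by omega : M.numTapes ≤ V)

theorem Room.lt_numVars {v : ℕ} (hv : v < 10) : v < M.numVars := by unfold numVars; omega

/-- The pointer stands on the cell behind w, so one store appends the bit. The rest of the intended
word enters only to guarantee that the advanced pointer is still at most V. -/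
theorem emitBit_does (h : Room C V h0 total) {w rest : List Bool} {b : Bool}
    (hw : w ++ b :: rest = total) {hs : HS} (he : Emitted C h0 w hs) :
    ∃ hs', Does M.numVars V (emitBit C b) hs hs' 5 ∧ Emitted C h0 (w ++ [b]) hs' ∧
      Keeps [1] hs hs' ∧ hs'.inp = hs.inp := by
  have h1 : 1 < M.numVars := Room.lt_numVars (by omega)
  have hK := M.stride_pos
  have hlow := M.numVars_lt_lowest
  have hl := h.low
  have hroom := h.room
  have hlen : (total.length : ℤ) = w.length + 1 + rest.length := by
    rw [← hw, List.length_append, List.length_cons]; push_cast; ring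
  have hwl : (0 : ℤ) ≤ M.stride * w.length := mul_nonneg hK.le (by positivity)
  have hrl : (0 : ℤ) ≤ M.stride * rest.length := mul_nonneg hK.le (by positivity)
  have hle : h0 + M.stride * w.length + M.stride ≤ V := by
    rw [hlen] at hroom
    linarith [mul_add M.stride (w.length + 1) rest.length, mul_add M.stride w.length 1]
  have hsym : |((C.sym (some (.inl b)) : ℕ) : ℤ)| ≤ V := by
    rw [Nat.abs_cast]
    exact_mod_cast (C.sym_lt _).le.trans h.fits.syms
  have hptr := he.ptr
  have d1 := Does.stm (h := hs) (x := .lit (C.sym (some (.inl b)))) (w := 1) h.fits.vars hsym h1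
    (by rw [hptr]; omega)
  simp only [Src.val] at d1
  have d2 := Does.add (h := hs.setm (hs.var 1) (C.sym (some (.inl b)))) (v := 1) (x := .var 1)
    (y := .lit M.stride) h.fits.vars h1 h1 h.stride_le
    (by
      simp only [Src.val, HS.setm, hptr]
      rw [abs_le]
      have := M.numVars
      omega)
  refine ⟨_, d1.seq d2, ⟨?_, ?_, ?_⟩, ⟨fun v hv => ?_, rfl⟩, rfl⟩
  · rw [HS.setv_var, if_pos rfl]
    simp only [Src.val, HS.setm, hptr, List.length_append, List.length_singleton]
    push_cast
    ring
  · intro j hj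
    change Function.update hs.mem (hs.var 1) _ (h0 + M.stride * j) = _
    rw [hptr, Function.update_apply]
    by_cases hjw : j = w.length
    · rw [if_pos (by rw [hjw]), hjw, bitTape_nth, if_pos (by positivity)]
      simp
    · rw [if_neg, he.cells j hj, bitTape_nth, bitTape_nth]
      · by_cases hj0 : 0 ≤ j
        · rw [if_pos hj0, if_pos hj0]
          by_cases hjl : j < w.length
          · rw [List.getElem?_append_left (by omega)]
          · rw [List.getElem?_eq_none (by omega), List.getElem?_eq_none (by simp; omega)]
        · rw [if_neg hj0, if_neg hj0]
      · intro heq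
        exact hjw (mul_left_cancel₀ hK.ne' (by linarith))
  · intro a ha hd
    change Function.update hs.mem (hs.var 1) _ a = _
    rw [Function.update_of_ne, he.blank a ha hd]
    rintro rfl
    exact hd ⟨w.length, by rw [hptr]; ring⟩
  · have : v ≠ 1 := by simpa using hv
    rw [HS.setv_var, if_neg this]
    rfl

/-- Append a string to the string on tape `0`. -/
def emit (C : M.Coding) (bs : List Bool) : Frag := Frag.seqs (bs.map (emitBit C))

theorem emit_does (h : Room C V h0 total) {bs w rest : List Bool}
    (hw : w ++ (bs ++ rest) = total) {hs : HS} (he : Emitted C h0 w hs) :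
    ∃ hs', Does M.numVars V (emit C bs) hs hs' (5 * bs.length) ∧ Emitted C h0 (w ++ bs) hs' ∧
      Keeps [1] hs hs' ∧ hs'.inp = hs.inp := by
  induction bs generalizing w hs with
  | nil => exact ⟨hs, Does.skip, by simpa using he, .refl _ _, rfl⟩
  | cons b bs ih =>
    obtain ⟨hs1, d1, e1, k1, i1⟩ := emitBit_does h (rest := bs ++ rest) (b := b) hw he
    obtain ⟨hs2, d2, e2, k2, i2⟩ := ih (w := w ++ [b]) (by simpa using hw) e1
    exact ⟨hs2, (d1.seq d2).mono (by simp; omega), by simpa using e2, k1.trans k2, i2.trans i1⟩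

variable {m : ℕ}

/-- The codes of the operations `l` remain to be appended to get the string `total`. -/
def Rest (C : M.Coding) (h0 : ℤ) (total : List Bool) (l : List (CliqueOp m)) (hs : HS) : Prop :=
  ∃ w, w ++ l.flatMap CliqueOp.code = total ∧ Emitted C h0 w hs

theorem Rest.congr {l : List (CliqueOp m)} {hs hs' : HS} (h : Rest C h0 total l hs)
    (hv : hs'.var 1 = hs.var 1) (hm : hs'.mem = hs.mem) : Rest C h0 total l hs' := by
  obtain ⟨w, hw, he⟩ := h
  exact ⟨w, hw, by rw [hv]; exact he.ptr, by rw [hm]; exact he.cells, by rw [hm]; exact he.blank⟩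

theorem Rest.setv {l : List (CliqueOp m)} {hs : HS} (h : Rest C h0 total l hs) {v : ℕ}
    (hv : v ≠ 1) (z : ℤ) : Rest C h0 total l (hs.setv v z) :=
  h.congr (by rw [HS.setv_var, if_neg hv.symm]) rfl

/-- Append the codes of operations. -/
noncomputable def emitOps (C : M.Coding) (ops : List (CliqueOp m)) : Frag :=
  emit C (ops.flatMap CliqueOp.code)

/-- A bound for the cost of one operation. -/
noncomputable def opCost (m : ℕ) : ℕ := 5 * Nat.card (CliqueOp m)

theorem emitOps_does (h : Room C V h0 total) {ops l : List (CliqueOp m)} {hs : HS}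
    (hr : Rest C h0 total (ops ++ l) hs) :
    ∃ hs', Does M.numVars V (emitOps C ops) hs hs' (opCost m * ops.length) ∧
      Rest C h0 total l hs' ∧ Keeps [1] hs hs' ∧ hs'.inp = hs.inp := by
  obtain ⟨w, hw, he⟩ := hr
  rw [List.flatMap_append] at hw
  obtain ⟨hs', d, e, k, i⟩ := emit_does h hw he
  refine ⟨hs', d.mono ?_, ⟨_, by rw [List.append_assoc]; exact hw, e⟩, k, i⟩
  have := CliqueOp.length_flatMap_code_le ops
  rw [opCost, mul_assoc]
  omega

/-- Append the codes of `ops` as often as variable `3` says. -/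
noncomputable def repOps (C : M.Coding) (ops : List (CliqueOp m)) : Frag :=
  Frag.loop 3 ((emitOps C ops).seq (Frag.sub 3 (.var 3) (.lit 1)))

theorem one_le_of_fits (h : C.Fits V) : 10 ≤ V := by
  have := h.vars; unfold numVars at this; omega

/-- Subtracting one from a positive counter. -/
theorem decr_does (h : C.Fits V) {v : ℕ} (hv : v < 10) {hs : HS} {n : ℕ}
    (hn : hs.var v = (n + 1 : ℕ)) (hnV : n ≤ V) :
    Does M.numVars V (Frag.sub v (.var v) (.lit 1)) hs (hs.setv v n) 3 := by
  have h10 := one_le_of_fits h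
  have d := Does.sub (h := hs) (v := v) (x := .var v) (y := .lit 1) h.vars (Room.lt_numVars hv)
    (Room.lt_numVars hv) (by simp only [Src.Ok, abs_one]; exact_mod_cast (by omega : 1 ≤ V))
    (by simp only [Src.val, hn]; rw [abs_le]; push_cast; omega)
  simpa [Src.val, hn] using d

theorem repOps_does (h : Room C V h0 total) {ops l : List (CliqueOp m)} {n : ℕ} {hs : HS}
    (hr : Rest C h0 total ((List.replicate n ops).flatten ++ l) hs) (hn : hs.var 3 = n)
    (hnV : n ≤ V) :
    ∃ hs', Does M.numVars V (repOps C ops) hs hs' (n * (opCost m * ops.length + 6) + 3) ∧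
      Rest C h0 total l hs' ∧ Keeps [1, 3] hs hs' ∧ hs'.inp = hs.inp := by
  obtain ⟨hs', d, -, -, hr', k, i⟩ := Does.loop (k := opCost m * ops.length + 3) h.fits.vars
    (Room.lt_numVars (by omega : 3 < 10)) (F := (emitOps C ops).seq (Frag.sub 3 (.var 3) (.lit 1)))
    (fun n' hs' => n' ≤ V ∧ hs'.var 3 = n' ∧
      Rest C h0 total ((List.replicate n' ops).flatten ++ l) hs' ∧ Keeps [1, 3] hs hs' ∧
      hs'.inp = hs.inp)
    (fun hs' hP => by rw [hP.2.1]; simp) (by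
      rintro n' hs1 ⟨hV, h3, hr1, k1, i1⟩
      refine ⟨by rw [h3]; positivity, ?_⟩
      rw [List.replicate_succ, List.flatten_cons, List.append_assoc] at hr1
      obtain ⟨hs2, d2, r2, k2, i2⟩ := emitOps_does h hr1
      have h3' := (k2.var 3 (by decide)).trans h3
      exact ⟨_, d2.seq (decr_does h.fits (by omega) h3' (by omega)), by omega,
        by simp [HS.setv_var], r2.setv (by omega) _,
        (k1.trans (k2.mono (by simp))).trans (.setv (by simp) _), i2.trans i1⟩)
    ⟨hnV, hn, hr, .refl _ _, rfl⟩
  exact ⟨hs', d, by simpa using hr', k, i⟩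

theorem repOp_does (h : Room C V h0 total) {o : CliqueOp m} {l : List (CliqueOp m)} {n : ℕ} {hs : HS}
    (hr : Rest C h0 total (List.replicate n o ++ l) hs) (hn : hs.var 3 = n) (hnV : n ≤ V) :
    ∃ hs', Does M.numVars V (repOps C [o]) hs hs' (n * (opCost m + 6) + 3) ∧
      Rest C h0 total l hs' ∧ Keeps [1, 3] hs hs' ∧ hs'.inp = hs.inp := by
  have e : (List.replicate n [o]).flatten = List.replicate n o := by
    induction n with
    | zero => rfl
    | succ n ih => simp_all [List.replicate_succ]
  simpa using repOps_does h (ops := [o]) (n := n) (by rwa [e]) hn hnV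

/-- Copy a variable. -/
theorem copy_does (h : C.Fits V) {v v' : ℕ} (hv : v < 10) (hv' : v' < 10) (hs : HS) :
    Does M.numVars V (Frag.mov v (.var v')) hs (hs.setv v (hs.var v')) 2 :=
  Does.mov (x := .var v') h.vars (Room.lt_numVars hv) (Room.lt_numVars hv')

/-- Append the operations for the bits of the label in variable `4`, whose number is in
variable `3`. -/
noncomputable def labelFrag (C : M.Coding) (m : ℕ) : Frag :=
  Frag.loop 3 (Frag.seqs [Frag.div 7 (.var 4) (.lit 2), Frag.add 6 (.var 7) (.var 7),
    Frag.sub 6 (.var 4) (.var 6),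
    Frag.ifz 6 (emitOps C (CliqueOp.cmpOps m [false])) (emitOps C (CliqueOp.cmpOps m [true])),
    Frag.mov 4 (.var 7), Frag.sub 3 (.var 3) (.lit 1)])

/-- Halving a nonnegative variable. -/
theorem half_does (h : C.Fits V) {v v' : ℕ} (hv : v < 10) (hv' : v' < 10) {hs : HS} {u : ℕ}
    (hu : hs.var v' = u) (huV : u ≤ V) :
    Does M.numVars V (Frag.div v (.var v') (.lit 2)) hs (hs.setv v (u / 2 : ℕ)) 3 := by
  have h10 := one_le_of_fits h
  have e : (u : ℤ).fdiv 2 = (u / 2 : ℕ) := by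
    rw [Int.fdiv_eq_ediv_of_nonneg _ (by norm_num)]
    norm_cast
  have d := Does.div (h := hs) (v := v) (x := .var v') (y := .lit 2) h.vars (Room.lt_numVars hv)
    (Room.lt_numVars hv') (by simp only [Src.Ok]; exact_mod_cast (by omega : 2 ≤ V))
    (by simp [Src.val])
    (by
      simp only [Src.val, hu, e, Nat.abs_cast]
      exact_mod_cast (by omega : u / 2 ≤ V))
  simpa only [Src.val, hu, e] using d

theorem cmpOps_length (β : Bool) : (CliqueOp.cmpOps m [β]).length = m := by
  simp [CliqueOp.cmpOps]

/-- Appending one of two lists of operations. -/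
theorem ifz_emitOps_does (h : Room C V h0 total) {v : ℕ} (hv : v < 10) {ops : Bool → List (CliqueOp m)}
    {l : List (CliqueOp m)} {hs : HS} {β : Bool} {k : ℕ} (hk : (ops β).length = k)
    (hr : Rest C h0 total (ops β ++ l) hs) (hβ : hs.var v = if β then 1 else 0) :
    ∃ hs', Does M.numVars V (Frag.ifz v (emitOps C (ops false)) (emitOps C (ops true))) hs hs'
        (opCost m * k + 3) ∧
      Rest C h0 total l hs' ∧ Keeps [1] hs hs' ∧ hs'.inp = hs.inp := by
  obtain ⟨hs', d, r⟩ := emitOps_does h hr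
  rw [hk] at d
  refine ⟨hs', ?_, r⟩
  cases β with
  | false => exact (Does.ifz_zero h.fits.vars (Room.lt_numVars hv) (by simpa using hβ) d).mono (by omega)
  | true => exact Does.ifz_ne h.fits.vars (Room.lt_numVars hv) (by rw [hβ]; simp) d

/-- The lowest digit is u − 2⌊u/2⌋, and ⌊u/2⌋ carries the other digits; the invariant therefore
quantifies over the current value u' of the label variable. -/
theorem labelFrag_does (h : Room C V h0 total) {l : List (CliqueOp m)} {b u : ℕ} {hs : HS}
    (hr : Rest C h0 total (CliqueOp.cmpOps m (CliqueOp.labelBits b u) ++ l) hs)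
    (hb : hs.var 3 = b) (hu : hs.var 4 = u) (hbV : b ≤ V) (huV : u ≤ V) :
    ∃ hs', Does M.numVars V (labelFrag C m) hs hs' (b * (opCost m * m + 20) + 3) ∧
      Rest C h0 total l hs' ∧ Keeps [1, 3, 4, 6, 7] hs hs' ∧ hs'.inp = hs.inp := by
  have hv : ∀ {v : ℕ}, v < 10 → v < M.numVars := fun h => Room.lt_numVars h
  obtain ⟨hs', d, -, -, u', -, -, hr', k, i⟩ := Does.loop (k := opCost m * m + 17) h.fits.vars
    (hv (by omega : 3 < 10)) (F := Frag.seqs [Frag.div 7 (.var 4) (.lit 2),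
      Frag.add 6 (.var 7) (.var 7), Frag.sub 6 (.var 4) (.var 6),
      Frag.ifz 6 (emitOps C (CliqueOp.cmpOps m [false])) (emitOps C (CliqueOp.cmpOps m [true])),
      Frag.mov 4 (.var 7), Frag.sub 3 (.var 3) (.lit 1)])
    (fun b' hs' => b' ≤ V ∧ hs'.var 3 = b' ∧ ∃ u' : ℕ, u' ≤ V ∧ hs'.var 4 = u' ∧
      Rest C h0 total (CliqueOp.cmpOps m (CliqueOp.labelBits b' u') ++ l) hs' ∧
      Keeps [1, 3, 4, 6, 7] hs hs' ∧ hs'.inp = hs.inp)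
    (fun hs' hP => by rw [hP.2.1]; simp) (by
      rintro b' hs1 ⟨hV, h3, u', hV', h4, hr1, k1, i1⟩
      refine ⟨by rw [h3]; positivity, ?_⟩
      have d1 := half_does h.fits (v := 7) (by omega) (by omega : 4 < 10) h4 hV'
      have d2 := Does.add (h := hs1.setv 7 (u' / 2 : ℕ)) (v := 6) (x := .var 7) (y := .var 7)
        h.fits.vars (hv (by omega)) (hv (by omega)) (hv (by omega))
        (by simp only [Src.val, HS.setv_var, if_true]; rw [abs_le]; omega)
      simp only [Src.val, HS.setv_var, if_true] at d2
      have d3 := Does.sub (h := (hs1.setv 7 (u' / 2 : ℕ)).setv 6 ((u' / 2 : ℕ) + (u' / 2 : ℕ)))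
        (v := 6) (x := .var 4) (y := .var 6)
        h.fits.vars (hv (by omega)) (hv (by omega)) (hv (by omega))
        (by simp [Src.val, HS.setv_var, h4]; rw [abs_le]; omega)
      obtain ⟨hs4, e4⟩ : ∃ hs4, hs4 = (((hs1.setv 7 (u' / 2 : ℕ)).setv 6
        ((u' / 2 : ℕ) + (u' / 2 : ℕ))).setv 6 ((u' : ℤ) - ((u' / 2 : ℕ) + (u' / 2 : ℕ)))) := ⟨_, rfl⟩
      have d3' : Does M.numVars V (Frag.sub 6 (.var 4) (.var 6))
          ((hs1.setv 7 (u' / 2 : ℕ)).setv 6 ((u' / 2 : ℕ) + (u' / 2 : ℕ))) hs4 3 := by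
        rw [e4]
        simpa [Src.val, HS.setv_var, h4] using d3
      have hr4 : Rest C h0 total (CliqueOp.cmpOps m [decide (u' % 2 = 1)] ++
          (CliqueOp.cmpOps m (CliqueOp.labelBits b' (u' / 2)) ++ l)) hs4 := by
        rw [e4]
        refine ((Rest.setv ?_ (by omega) _).setv (by omega) _).setv (by omega) _
        simpa [CliqueOp.cmpOps, CliqueOp.labelBits] using hr1
      have k4 : Keeps [1, 3, 4, 6, 7] hs1 hs4 := by
        rw [e4]
        exact ((Keeps.setv (by simp) _).trans (.setv (by simp) _)).trans (.setv (by simp) _)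
      obtain ⟨hs5, d5, r5, k5, i5⟩ := ifz_emitOps_does h (v := 6) (by omega)
        (ops := fun β => CliqueOp.cmpOps m [β]) (cmpOps_length _) hr4 (by
          rw [e4, HS.setv_var, if_pos rfl]
          by_cases hp : u' % 2 = 1
          · rw [decide_eq_true hp, if_pos rfl]; omega
          · rw [decide_eq_false hp, if_neg (by simp)]; omega)
      have h57 : hs5.var 7 = (u' / 2 : ℕ) := by
        rw [k5.var 7 (by decide), e4]
        simp [HS.setv_var]
      have h53 : hs5.var 3 = (b' + 1 : ℕ) := by
        rw [k5.var 3 (by decide), e4]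
        simp [HS.setv_var, h3]
      have d6 := copy_does h.fits (v := 4) (v' := 7) (by omega) (by omega) hs5
      rw [h57] at d6
      have d7 := decr_does h.fits (v := 3) (by omega) (hs := hs5.setv 4 (u' / 2 : ℕ)) (n := b')
        (by simp [HS.setv_var, h53]) (by omega)
      refine ⟨_, (d1.seq (d2.seq (d3'.seq (d5.seq (d6.seq (d7.seq .skip)))))).mono (by omega),
        by omega, by simp [HS.setv_var], u' / 2, by omega, by simp [HS.setv_var],
        (r5.setv (by omega) _).setv (by omega) _, ?_, ?_⟩
      · exact k1.trans (k4.trans ((k5.mono (by simp)).trans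
          ((Keeps.setv (by simp) _).trans (.setv (by simp) _))))
      · exact (i5.trans (by rw [e4]; rfl)).trans i1)
    ⟨hbV, hb, u, huV, hu, hr, .refl _ _, rfl⟩
  exact ⟨hs', d, by simpa [CliqueOp.cmpOps, CliqueOp.labelBits] using hr', k, i⟩

end MultiTapeTM

/-! ### Writing the operations for vertices, rows and the whole graph -/

namespace MultiTapeTM

open RAM Turing

variable {M : MultiTapeTM} {C : M.Coding} {V : ℕ} {h0 : ℤ} {total : List Bool} {m : ℕ}

/-- Append the operations for the label of a vertex; variable `2` holds the number of remaining
vertices and variable `5` the number of bits of a label. -/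
noncomputable def putFrag (C : M.Coding) (m : ℕ) : Frag :=
  Frag.seqs [Frag.sub 4 (.var 2) (.lit 1), Frag.mov 3 (.var 5), labelFrag C m,
    Frag.mov 3 (.var 5), repOps C (List.replicate m (CliqueOp.oracleLeft : CliqueOp m)),
    emitOps C [(CliqueOp.put : CliqueOp m)], Frag.sub 2 (.var 2) (.lit 1)]

/-- With u + 1 vertices remaining the label is u, so the loop counter supplies the label after a
subtraction. -/
theorem putFrag_does (h : Room C V h0 total) {l : List (CliqueOp m)} {b u : ℕ} {hs : HS}
    (hr : Rest C h0 total (CliqueOp.putOps m b u ++ l) hs)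
    (h2 : hs.var 2 = (u + 1 : ℕ)) (h5 : hs.var 5 = b) (hbV : b ≤ V) (huV : u ≤ V) :
    ∃ hs', Does M.numVars V (putFrag C m) hs hs' (b * (2 * (opCost m * m) + 26) + 16 + opCost m) ∧
      Rest C h0 total l hs' ∧ hs'.var 2 = u ∧ Keeps [1, 2, 3, 4, 6, 7] hs hs' ∧
      hs'.inp = hs.inp := by
  have h10 := one_le_of_fits h.fits
  have d1 := Does.sub (h := hs) (v := 4) (x := .var 2) (y := .lit 1) h.fits.vars
    (Room.lt_numVars (by omega)) (Room.lt_numVars (by omega))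
    (by simp only [Src.Ok, abs_one]; exact_mod_cast (by omega : 1 ≤ V))
    (by simp only [Src.val, h2]; rw [abs_le]; push_cast; omega)
  have e1 : (Src.var 2).val hs - (Src.lit 1).val hs = u := by simp [Src.val, h2]
  rw [e1] at d1
  have d2 := copy_does h.fits (v := 3) (v' := 5) (by omega) (by omega) (hs.setv 4 u)
  have h5' : (hs.setv 4 u).var 5 = b := by simp [HS.setv_var, h5]
  rw [h5'] at d2
  have r2 : Rest C h0 total (CliqueOp.cmpOps m (CliqueOp.labelBits b u) ++
      ((List.replicate b (List.replicate m CliqueOp.oracleLeft)).flatten ++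
        ([CliqueOp.put] ++ l))) ((hs.setv 4 u).setv 3 b) := by
    refine (Rest.setv ?_ (by omega) _).setv (by omega) _
    simpa [CliqueOp.putOps] using hr
  obtain ⟨hs3, d3, r3, k3, i3⟩ := labelFrag_does h r2 (by simp [HS.setv_var])
    (by simp [HS.setv_var]) hbV huV
  have d4 := copy_does h.fits (v := 3) (v' := 5) (by omega) (by omega) hs3
  have h53 : hs3.var 5 = b := by
    rw [k3.var 5 (by decide)]; simp [HS.setv_var, h5]
  rw [h53] at d4
  obtain ⟨hs5, d5, r5, k5, i5⟩ := repOps_does h (r3.setv (v := 3) (by omega) b) (n := b)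
    (by simp [HS.setv_var]) hbV
  obtain ⟨hs6, d6, r6, k6, i6⟩ := emitOps_does h r5
  have k06 : Keeps [1, 3, 4, 6, 7] hs hs6 :=
    (((Keeps.setv (by simp) _).trans (.setv (by simp) _)).trans k3).trans
      (((Keeps.setv (by simp) _).trans (k5.mono (by simp))).trans (k6.mono (by simp)))
  have d7 := decr_does h.fits (v := 2) (by omega) (hs := hs6) (n := u)
    (by rw [k06.var 2 (by decide), h2]) huV
  refine ⟨_, (d1.seq (d2.seq (d3.seq (d4.seq (d5.seq (d6.seq (d7.seq .skip))))))).mono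
    (le_of_eq ?_), r6.setv (by omega) _, by simp [HS.setv_var],
    (k06.mono (by simp)).trans (.setv (by simp) _), ?_⟩
  · simp only [List.length_replicate, List.length_singleton]
    ring
  · exact i6.trans (i5.trans i3)

/-- Append the operations of one row of the adjacency matrix; variable `2` holds the number of
remaining rows. -/
noncomputable def rowFrag (C : M.Coding) (m : ℕ) : Frag :=
  Frag.seqs [Frag.mov 3 (.var 0),
    Frag.loop 3 (Frag.seqs [Frag.rd 6,
      Frag.ifz 6 (emitOps C [(CliqueOp.scan false : CliqueOp m)])
        (emitOps C [(CliqueOp.scan true : CliqueOp m)]), Frag.sub 3 (.var 3) (.lit 1)]),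
    Frag.mov 3 (.var 2), repOps C [(CliqueOp.workLeft : CliqueOp m)],
    emitOps C [(CliqueOp.mark : CliqueOp m)], Frag.sub 3 (.var 0) (.var 2),
    repOps C [(CliqueOp.workLeft : CliqueOp m)], Frag.sub 2 (.var 2) (.lit 1)]

/-- A bit as an integer. -/
def bitInt (b : Bool) : ℤ := if b then 1 else 0

/-- Each matrix entry is translated as soon as it is read, so the matrix is never stored. The unread
input and the operations still to be written shrink together in the invariant. -/
theorem scanLoop_does (h : Room C V h0 total) {l : List (CliqueOp m)} {bs : List Bool}
    {inp : List ℤ} {hs : HS} (hr : Rest C h0 total (bs.map CliqueOp.scan ++ l) hs)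
    (h3 : hs.var 3 = bs.length) (hV : bs.length ≤ V) (hi : hs.inp = bs.map bitInt ++ inp) :
    ∃ hs', Does M.numVars V (Frag.loop 3 (Frag.seqs [Frag.rd 6,
      Frag.ifz 6 (emitOps C [(CliqueOp.scan false : CliqueOp m)])
        (emitOps C [(CliqueOp.scan true : CliqueOp m)]), Frag.sub 3 (.var 3) (.lit 1)])) hs hs'
        (bs.length * (opCost m + 10) + 3) ∧
      Rest C h0 total l hs' ∧ Keeps [1, 3, 6] hs hs' ∧ hs'.inp = inp := by
  obtain ⟨hs', d, bs', hb0, -, -, hr', k, i⟩ := Does.loop (k := opCost m + 7) h.fits.vars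
    (Room.lt_numVars (by omega : 3 < 10)) (F := Frag.seqs [Frag.rd 6,
      Frag.ifz 6 (emitOps C [(CliqueOp.scan false : CliqueOp m)])
        (emitOps C [(CliqueOp.scan true : CliqueOp m)]), Frag.sub 3 (.var 3) (.lit 1)])
    (fun n hs' => ∃ bs' : List Bool, bs'.length = n ∧ n ≤ V ∧ hs'.var 3 = n ∧
      Rest C h0 total (bs'.map CliqueOp.scan ++ l) hs' ∧ Keeps [1, 3, 6] hs hs' ∧
      hs'.inp = bs'.map bitInt ++ inp)
    (fun hs' hP => by obtain ⟨_, -, -, h3, -⟩ := hP; rw [h3]; simp) (by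
      rintro n hs1 ⟨_ | ⟨β, bs'⟩, hn, hV, h3, hr1, k1, i1⟩
      · simp at hn
      simp only [List.length_cons, Nat.succ.injEq] at hn
      refine ⟨by rw [h3]; positivity, ?_⟩
      rw [List.map_cons, List.cons_append] at i1
      have d2 := Does.rd (v := 6) h.fits.vars (Room.lt_numVars (by omega)) i1
      obtain ⟨hs3, d3, r3, k3, i3⟩ := ifz_emitOps_does h (v := 6) (by omega)
        (ops := fun β => [(CliqueOp.scan β : CliqueOp m)]) (β := β) (k := 1) rfl
        (l := bs'.map CliqueOp.scan ++ l)
        (hs := { hs1.setv 6 (bitInt β) with inp := bs'.map bitInt ++ inp })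
        (Rest.congr (hs := hs1.setv 6 (bitInt β)) (hr1.setv (by omega) _) rfl rfl)
        (by simp [HS.setv, bitInt])
      have k13 : Keeps [1, 3, 6] hs1 hs3 := by
        have k2 : Keeps [1, 3, 6] hs1 { hs1.setv 6 (bitInt β) with inp := bs'.map bitInt ++ inp } :=
          ⟨(Keeps.setv (X := [1, 3, 6]) (hs := hs1) (v := 6) (by simp) (bitInt β)).var, rfl⟩
        exact k2.trans (k3.mono (by simp))
      have h33 : hs3.var 3 = (n + 1 : ℕ) := by
        rw [k3.var 3 (by decide)]; simp [HS.setv, h3]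
      have d4 := decr_does h.fits (v := 3) (by omega) h33 (by omega)
      exact ⟨_, (d2.seq (d3.seq (d4.seq .skip))).mono (by omega), bs', hn, by omega,
        by simp [HS.setv_var], r3.setv (by omega) _, (k1.trans k13).trans (.setv (by simp) _), i3⟩)
    ⟨bs, rfl, hV, h3, hr, .refl _ _, hi⟩
  rw [List.length_eq_zero_iff] at hb0
  subst hb0
  exact ⟨hs', d, by simpa using hr', k, by simpa using i⟩

/-- In row i the number r + 1 of remaining rows equals N − i, the number of moves before `mark`; the
i moves after it are counted by N minus this number. -/
theorem rowFrag_does (h : Room C V h0 total) {l : List (CliqueOp m)} {bs : List Bool}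
    {inp : List ℤ} {i r : ℕ} {hs : HS}
    (hr : Rest C h0 total (CliqueOp.rowOps m bs.length i bs ++ l) hs)
    (hi : i + (r + 1) = bs.length) (h2 : hs.var 2 = (r + 1 : ℕ)) (hN : hs.var 0 = bs.length)
    (hV : bs.length ≤ V) (hinp : hs.inp = bs.map bitInt ++ inp) :
    ∃ hs', Does M.numVars V (rowFrag C m) hs hs'
        (bs.length * (2 * opCost m + 16) + 19 + opCost m) ∧
      Rest C h0 total l hs' ∧ hs'.var 2 = r ∧ Keeps [1, 2, 3, 6] hs hs' ∧ hs'.inp = inp := by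
  have d1 := copy_does h.fits (v := 3) (v' := 0) (by omega) (by omega) hs
  rw [hN] at d1
  have r1 : Rest C h0 total (bs.map CliqueOp.scan ++ (List.replicate (r + 1) CliqueOp.workLeft ++
      ([CliqueOp.mark] ++ (List.replicate i CliqueOp.workLeft ++ l)))) (hs.setv 3 bs.length) := by
    refine Rest.setv ?_ (by omega) _
    have : bs.length - i = r + 1 := by omega
    simpa [CliqueOp.rowOps, this] using hr
  obtain ⟨hs2, d2, r2, k2, i2⟩ := scanLoop_does h r1 (by simp [HS.setv_var]) hV hinp
  have h22 : hs2.var 2 = (r + 1 : ℕ) := by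
    rw [k2.var 2 (by decide)]; simp [HS.setv_var, h2]
  have d3 := copy_does h.fits (v := 3) (v' := 2) (by omega) (by omega) hs2
  rw [h22] at d3
  obtain ⟨hs4, d4, r4, k4, i4⟩ := repOp_does h (r2.setv (v := 3) (by omega) ((r + 1 : ℕ) : ℤ))
    (by simp [HS.setv_var]) (by omega)
  obtain ⟨hs5, d5, r5, k5, i5⟩ := emitOps_does h r4
  have k05 : Keeps [1, 3, 6] hs hs5 :=
    ((Keeps.setv (by simp) _).trans k2).trans
      (((Keeps.setv (by simp) _).trans (k4.mono (by simp))).trans (k5.mono (by simp)))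
  have h25 : hs5.var 2 = (r + 1 : ℕ) := by rw [k05.var 2 (by decide), h2]
  have h05 : hs5.var 0 = bs.length := by rw [k05.var 0 (by decide), hN]
  have d6 := Does.sub (h := hs5) (v := 3) (x := .var 0) (y := .var 2) h.fits.vars
    (Room.lt_numVars (by omega)) (Room.lt_numVars (by omega)) (Room.lt_numVars (by omega))
    (by simp only [Src.val, h25, h05]; rw [abs_le]; push_cast; omega)
  have e6 : (Src.var 0).val hs5 - (Src.var 2).val hs5 = i := by
    simp only [Src.val, h25, h05]; omega
  rw [e6] at d6
  obtain ⟨hs7, d7, r7, k7, i7⟩ := repOp_does h (r5.setv (v := 3) (by omega) (i : ℤ))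
    (by simp [HS.setv_var]) (by omega)
  have k57 : Keeps [1, 3, 6] hs5 hs7 := (Keeps.setv (by simp) _).trans (k7.mono (by simp))
  have d8 := decr_does h.fits (v := 2) (by omega) (hs := hs7) (n := r)
    (by rw [k57.var 2 (by decide), h25]) (by omega)
  refine ⟨_, (d1.seq (d2.seq (d3.seq (d4.seq (d5.seq (d6.seq (d7.seq (d8.seq .skip)))))))).mono
    (le_of_eq ?_), r7.setv (by omega) _, by simp [HS.setv_var],
    ((k05.trans k57).mono (by simp)).trans (.setv (by simp) _), ?_⟩
  · rw [← hi, List.length_singleton]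
    ring
  · exact i7.trans (i5.trans (i4.trans i2))

/-- Append all operations for a graph; variable `0` holds the number of vertices and variable `5`
the number of bits of a label. -/
noncomputable def graphFrag (C : M.Coding) (m : ℕ) : Frag :=
  Frag.seqs [Frag.mov 2 (.var 0), Frag.loop 2 (putFrag C m), Frag.mov 3 (.var 0),
    repOps C [(CliqueOp.workLeft : CliqueOp m)], Frag.mov 2 (.var 0), Frag.loop 2 (rowFrag C m)]

/-- The number of instructions for appending all operations. -/
noncomputable def graphCost (m N : ℕ) : ℕ :=
  N * (N * (2 * (opCost m * m) + 26) + 16 + opCost m + 3) + N * (opCost m + 6) +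
    N * (N * (2 * opCost m + 16) + 19 + opCost m + 3) + 15

/-- The program counts the remaining items down while the items are listed upwards; with n + 1 items
left the next one has index N − (n + 1). -/
theorem range'_flatMap_succ {α : Type*} (f : ℕ → List α) (N n : ℕ) (hn : n + 1 ≤ N) :
    (List.range' (N - (n + 1)) (n + 1)).flatMap f =
      f (N - (n + 1)) ++ (List.range' (N - n) n).flatMap f := by
  rw [List.range'_succ, List.flatMap_cons, show N - (n + 1) + 1 = N - n by omega]

theorem graphFrag_does {adj : ℕ → ℕ → Bool} {N : ℕ}
    (h : Room C V h0 ((CliqueOp.graphOps m N adj).flatMap CliqueOp.code)) {hs : HS}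
    (he : Emitted C h0 [] hs) (hN : hs.var 0 = N) (h5 : hs.var 5 = Nat.size (N - 1)) (hV : N ≤ V)
    (hinp : hs.inp = (List.range N).flatMap fun i => (List.range N).map fun j =>
      bitInt (adj i j)) :
    ∃ hs', Does M.numVars V (graphFrag C m) hs hs' (graphCost m N) ∧
      Emitted C h0 ((CliqueOp.graphOps m N adj).flatMap CliqueOp.code) hs' ∧
      Keeps [1, 2, 3, 4, 6, 7] hs hs' := by
  have hv : ∀ {v : ℕ}, v < 10 → v < M.numVars := fun h => Room.lt_numVars h
  have hsz := CliqueOp.size_pred_le N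
  obtain ⟨total, ht⟩ : ∃ t, t = (CliqueOp.graphOps m N adj).flatMap CliqueOp.code := ⟨_, rfl⟩
  rw [← ht] at h ⊢
  obtain ⟨rows, hrows⟩ : ∃ f : ℕ → List (CliqueOp m),
    f = fun i => CliqueOp.rowOps m N i ((List.range N).map (adj i)) := ⟨_, rfl⟩
  have r0 : Rest C h0 total (CliqueOp.graphOps m N adj) hs := ⟨[], by simp [ht], he⟩
  have d1 := copy_does h.fits (v := 2) (v' := 0) (by omega) (by omega) hs
  rw [hN] at d1
  obtain ⟨hs2, d2, -, r2, k2, i2⟩ := Does.loop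
    (k := N * (2 * (opCost m * m) + 26) + 16 + opCost m) h.fits.vars
    (hv (by omega : 2 < 10)) (F := putFrag C m)
    (fun n hs' => (n ≤ N ∧ hs'.var 2 = n) ∧
      Rest C h0 total (((List.range' (N - n) n).flatMap fun j =>
          CliqueOp.putOps m (Nat.size (N - 1)) (N - 1 - j)) ++
        (List.replicate N CliqueOp.workLeft ++ (List.range N).flatMap rows)) hs' ∧
      Keeps [1, 2, 3, 4, 6, 7] hs hs' ∧ hs'.inp = hs.inp)
    (fun hs' hP => by rw [hP.1.2]; simp) (by
      rintro n hs1 ⟨⟨hn, h2⟩, hr1, k1, i1⟩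
      refine ⟨by rw [h2]; positivity, ?_⟩
      rw [range'_flatMap_succ _ _ _ hn, List.append_assoc,
        show N - 1 - (N - (n + 1)) = n by omega] at hr1
      obtain ⟨hs2, d2, r2, h22, k2, i2⟩ := putFrag_does h hr1 h2
        (by rw [k1.var 5 (by decide), h5]) (by omega) (by omega)
      exact ⟨hs2, d2.mono (by
        -- The number of digits is replaced by N to obtain one bound of order N for every vertex.
        have := Nat.mul_le_mul_right (2 * (opCost m * m) + 26) hsz
        omega), ⟨by omega, h22⟩, r2, k1.trans k2, i2.trans i1⟩)
    (n := N) (hs := hs.setv 2 N) ⟨⟨le_rfl, by simp [HS.setv_var]⟩, by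
      refine Rest.setv ?_ (by omega) _
      rw [Nat.sub_self, ← List.range_eq_range', hrows]
      simpa [CliqueOp.graphOps] using r0, .setv (by simp) _, rfl⟩
  have h02 : hs2.var 0 = N := by rw [k2.var 0 (by decide), hN]
  have d3 := copy_does h.fits (v := 3) (v' := 0) (by omega) (by omega) hs2
  rw [h02] at d3
  obtain ⟨hs4, d4, r4, k4, i4⟩ := repOp_does h (o := CliqueOp.workLeft) (l := (List.range N).flatMap rows)
    (n := N) (hs := hs2.setv 3 N) (Rest.setv (by simpa using r2) (by omega) _)
    (by simp [HS.setv_var]) hV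
  have k24 : Keeps [1, 2, 3, 4, 6, 7] hs2 hs4 := (Keeps.setv (by simp) _).trans (k4.mono (by simp))
  have h04 : hs4.var 0 = N := by rw [k24.var 0 (by decide), h02]
  have d5 := copy_does h.fits (v := 2) (v' := 0) (by omega) (by omega) hs4
  rw [h04] at d5
  obtain ⟨hs6, d6, -, ⟨w, hw, e6⟩, k6, -⟩ := Does.loop
    (k := N * (2 * opCost m + 16) + 19 + opCost m) h.fits.vars
    (hv (by omega : 2 < 10)) (F := rowFrag C m)
    (fun n hs' => (n ≤ N ∧ hs'.var 2 = n) ∧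
      Rest C h0 total ((List.range' (N - n) n).flatMap rows) hs' ∧
      Keeps [1, 2, 3, 4, 6, 7] hs hs' ∧
      hs'.inp = (List.range' (N - n) n).flatMap fun i => (List.range N).map fun j =>
        bitInt (adj i j))
    (fun hs' hP => by rw [hP.1.2]; simp) (by
      rintro n hs1 ⟨⟨hn, h2⟩, hr1, k1, i1⟩
      refine ⟨by rw [h2]; positivity, ?_⟩
      rw [range'_flatMap_succ _ _ _ hn] at hr1 i1
      have hl : ((List.range N).map (adj (N - (n + 1)))).length = N := by simp
      obtain ⟨hs2, d2, r2, h22, k2, i2⟩ := rowFrag_does h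
        (bs := (List.range N).map (adj (N - (n + 1)))) (i := N - (n + 1)) (r := n)
        (by rw [hl]; simpa only [hrows] using hr1) (by rw [hl]; omega) h2
        (by rw [k1.var 0 (by decide), hN, hl]) (by rw [hl]; exact hV)
        (by simpa [Function.comp_def] using i1)
      rw [hl] at d2
      exact ⟨hs2, d2, ⟨by omega, h22⟩, by rw [hrows]; exact r2, k1.trans (k2.mono (by simp)), i2⟩)
    (n := N) (hs := hs4.setv 2 N) ⟨⟨le_rfl, by simp [HS.setv_var]⟩, by
      refine Rest.setv ?_ (by omega) _
      rw [Nat.sub_self, ← List.range_eq_range']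
      exact r4, (k2.trans k24).trans (.setv (by simp) _), by
      rw [Nat.sub_self, ← List.range_eq_range', ← hinp, ← i2]
      exact i4⟩
  refine ⟨hs6, (d1.seq (d2.seq (d3.seq (d4.seq (d5.seq (d6.seq .skip)))))).mono (le_of_eq ?_), ?_,
    k6⟩
  · rw [graphCost]; ring
  · rw [← hw]
    simpa using e6

end MultiTapeTM

/-! ### The program that runs a Turing machine on the input of the clique machine -/

namespace MultiTapeTM

open RAM Turing

variable {M : MultiTapeTM} {C : M.Coding} {V m : ℕ}

/-- Multiply variable `6` by the `D`-th power of variable `7`. -/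
def powFrag (D : ℕ) : Frag := Frag.seqs (List.replicate D (Frag.mul 6 (.var 6) (.var 7)))

theorem powFrag_does (hC : C.Fits V) {D a x : ℕ} {hs : HS} (h7 : hs.var 7 = x) (hx : 1 ≤ x)
    (hV : a * x ^ D ≤ V) :
    Does M.numVars V (powFrag D) (hs.setv 6 a) (hs.setv 6 (a * x ^ D : ℕ)) (3 * D) := by
  induction D generalizing a with
  | zero =>
    rw [pow_zero, mul_one]
    exact Does.skip
  | succ D ih =>
    rw [pow_succ'] at hV ⊢
    rw [← mul_assoc] at hV ⊢
    -- Since x ≥ 1, no intermediate product exceeds the final one.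
    have hle : a * x ≤ V := (Nat.le_mul_of_pos_right _ (pow_pos (by omega) D)).trans hV
    have d := Does.mul (h := hs.setv 6 a) (v := 6) (x := .var 6) (y := .var 7) hC.vars
      (Room.lt_numVars (by omega)) (Room.lt_numVars (by omega)) (Room.lt_numVars (by omega))
      (by
        simp only [Src.val, HS.setv_var, h7, if_true]
        rw [if_neg (by omega), ← Nat.cast_mul, Nat.abs_cast]
        exact_mod_cast hle)
    have e : (hs.setv 6 a).setv 6 ((Src.var 6).val (hs.setv 6 a) * (Src.var 7).val (hs.setv 6 a)) =
        hs.setv 6 (a * x : ℕ) := by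
      simp [HS.setv_setv, Src.val, HS.setv_var, h7]
    rw [e] at d
    exact (d.seq (ih hV)).mono (by omega)

/-- Place the heads of all tapes at the cells that follow the address in variable `6`. -/
def headsFrag (M : MultiTapeTM) (l : List (Fin M.numTapes)) : Frag :=
  Frag.seqs (l.map fun i => Frag.add (10 + i) (.var 6) (.lit (M.lowest + (i : ℕ))))

theorem headsFrag_does (hC : C.Fits V) {h0 : ℤ} (hh : M.lowest ≤ h0) (hV : h0 + M.numTapes ≤ V)
    (l : List (Fin M.numTapes)) {hs : HS} (h6 : hs.var 6 = h0 - M.lowest) :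
    ∃ hs', Does M.numVars V (headsFrag M l) hs hs' (3 * l.length) ∧
      (∀ i ∈ l, hs'.var (10 + i) = h0 + (i : ℕ)) ∧
      (∀ v, (∀ i ∈ l, v ≠ 10 + i.val) → hs'.var v = hs.var v) ∧
      hs'.mem = hs.mem ∧ hs'.inp = hs.inp ∧ hs'.out = hs.out := by
  induction l generalizing hs with
  | nil => exact ⟨hs, Does.skip, by simp, fun _ _ => rfl, rfl, rfl, rfl⟩
  | cons i l ih =>
    have hlow := M.numVars_lt_lowest
    have hi := i.2
    have d := Does.add (h := hs) (v := 10 + i) (x := .var 6) (y := .lit (M.lowest + (i : ℕ)))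
      hC.vars (by unfold numVars; omega) (Room.lt_numVars (by omega))
      (by simp only [Src.Ok]; rw [abs_le]; omega)
      (by simp only [Src.val, h6]; rw [abs_le]; omega)
    have e : (Src.var 6).val hs + (Src.lit (M.lowest + (i : ℕ))).val hs = h0 + (i : ℕ) := by
      simp only [Src.val, h6]; ring
    rw [e] at d
    obtain ⟨hs', d', h1, h2, h3, h4, h5⟩ := ih (hs := hs.setv (10 + i) (h0 + (i : ℕ)))
      (by rw [HS.setv_var, if_neg (by omega), h6])
    refine ⟨hs', (d.seq d').mono (by rw [List.length_cons]; omega), ?_, ?_, h3, h4, h5⟩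
    · intro j hj
      by_cases hjl : j ∈ l
      · exact h1 j hjl
      · obtain rfl : j = i := by simpa [hjl] using hj
        rw [h2 _ (fun i' hi' he => hjl (by
          obtain rfl : j = i' := Fin.ext (by omega)
          exact hi')), HS.setv_var, if_pos rfl]
    · intro v hv
      rw [h2 v fun j hj => hv j (List.mem_cons_of_mem _ hj), HS.setv_var,
        if_neg (hv i List.mem_cons_self)]

/-- Add the number of binary digits of variable `7` to variable `5`. -/
def sizeFrag : Frag := Frag.loop 7 (Frag.seqs [Frag.add 5 (.var 5) (.lit 1),
  Frag.div 7 (.var 7) (.lit 2)])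

theorem size_half {u : ℕ} (hu : u ≠ 0) : Nat.size (u / 2) + 1 = Nat.size u := by
  have h := Nat.size_bit (b := u.bodd) (n := u.div2) (by rwa [Nat.bit_bodd_div2])
  rw [Nat.bit_bodd_div2, Nat.div2_val] at h
  exact h.symm

/-- The hypothesis uses `toNat` because variable 7 holds N − 1, which is −1 for the empty graph; the
loop then ends at once with the correct size 0. -/
theorem sizeFrag_does (hC : C.Fits V) {hs : HS} {u : ℕ} (h7 : (hs.var 7).toNat = u) (hV : u ≤ V)
    (h5 : hs.var 5 = 0) :
    ∃ hs', Does M.numVars V sizeFrag hs hs' (Nat.size u * 9 + 3) ∧ hs'.var 5 = Nat.size u ∧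
      Keeps [5, 7] hs hs' ∧ hs'.mem = hs.mem ∧ hs'.inp = hs.inp := by
  have h10 := one_le_of_fits hC
  have hsz : Nat.size u ≤ u := by
    rw [Nat.size_le]; exact Nat.lt_two_pow_self
  obtain ⟨hs', d, -, -, -, h5', k⟩ := Does.loop (k := 6) hC.vars
    (Room.lt_numVars (by omega : 7 < 10))
    (F := Frag.seqs [Frag.add 5 (.var 5) (.lit 1), Frag.div 7 (.var 7) (.lit 2)])
    (fun n hs' => n = Nat.size (hs'.var 7).toNat ∧ (hs'.var 7).toNat ≤ V ∧ n ≤ Nat.size u ∧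
      hs'.var 5 = Nat.size u - n ∧ Keeps [5, 7] hs hs' ∧ hs'.mem = hs.mem ∧ hs'.inp = hs.inp)
    (fun hs' hP => by
      have := hP.1.symm
      rw [Nat.size_eq_zero] at this
      omega)
    (by
      rintro n hs1 ⟨hn, h7V, hle, h5, k, hm, hi⟩
      obtain ⟨w, hw⟩ : ∃ w, w = (hs1.var 7).toNat := ⟨_, rfl⟩
      rw [← hw] at hn h7V
      have hw0 : w ≠ 0 := by
        rintro rfl
        simp at hn
      have hw7 : hs1.var 7 = w := by omega
      refine ⟨by omega, ?_⟩
      have d1 := Does.add (h := hs1) (v := 5) (x := .var 5) (y := .lit 1) hC.vars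
        (Room.lt_numVars (by omega)) (Room.lt_numVars (by omega))
        (by simp only [Src.Ok, abs_one]; exact_mod_cast (by omega : 1 ≤ V))
        (by simp only [Src.val, h5]; rw [abs_le]; omega)
      have d2 := half_does hC (v := 7) (v' := 7) (by omega) (by omega)
        (hs := hs1.setv 5 ((Src.var 5).val hs1 + (Src.lit 1).val hs1)) (u := w)
        (by rw [HS.setv_var, if_neg (by omega), hw7]) h7V
      have := size_half hw0
      refine ⟨_, (d1.seq (d2.seq .skip)).mono (by omega), ?_, ?_, by omega, ?_,
        k.trans ((Keeps.setv (by simp) _).trans (.setv (by simp) _)), hm, hi⟩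
      · rw [HS.setv_var, if_pos rfl, Int.toNat_natCast]
        omega
      · rw [HS.setv_var, if_pos rfl, Int.toNat_natCast]
        omega
      · rw [HS.setv_var, if_neg (by omega), HS.setv_var, if_pos rfl]
        simp only [Src.val, h5]
        push_cast
        ring)
    (n := Nat.size u) (hs := hs)
    ⟨by rw [h7], by omega, le_rfl, by rw [h5]; ring, .refl _ _, rfl, rfl⟩
  exact ⟨hs', d, by simpa using h5', k⟩

/-- Read the number of vertices and set up the tapes around a position of the form
`c * (N + 1) ^ D`. -/
def setupFrag (M : MultiTapeTM) (c D : ℕ) : Frag :=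
  Frag.seqs [Frag.rd 0, Frag.add 7 (.var 0) (.lit 1), Frag.mov 6 (.lit c), powFrag D,
    Frag.mul 6 (.var 6) (.lit M.stride), headsFrag M (List.finRange _), Frag.mov 1 (.var 10),
    Frag.sub 7 (.var 0) (.lit 1), sizeFrag]

/-- The number of instructions of the set-up. -/
def setupCost (M : MultiTapeTM) (D N : ℕ) : ℕ := 3 * D + 3 * M.numTapes + 9 * N + 20

/-- The address of the first cell of tape `0`. -/
def origin (M : MultiTapeTM) (B : ℕ) : ℤ := M.stride * B + M.lowest

/-- A bound for all numbers that occur in the simulation when the heads do not move more than `B`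
cells away from the start. -/
def Coding.bound (C : M.Coding) (B : ℕ) : ℕ :=
  2 * (M.numTapes * B) + (M.numTapes * (M.numVars + 1) + M.numTapes + M.numVars + C.numSym + C.numSt)

theorem Coding.fits_bound (C : M.Coding) (B : ℕ) : C.Fits (C.bound B) :=
  ⟨by unfold bound; omega, by unfold bound; omega, by unfold bound; omega⟩

/-- B moves in either direction stay between the lowest tape address and the bound: the origin lies
B cells above the former, and this inequality leaves B cells below the latter for every tape. -/
theorem origin_le_bound (C : M.Coding) (B : ℕ) :
    origin M B + M.numTapes + M.stride * B ≤ C.bound B := by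
  unfold origin Coding.bound lowest stride
  push_cast
  linarith

theorem le_bound (C : M.Coding) (B : ℕ) : 2 * B ≤ C.bound B := by
  have := Nat.le_mul_of_pos_left B (show 0 < M.numTapes by unfold numTapes; omega)
  unfold Coding.bound
  omega

/-- The tapes extend to the left as well, while addresses do not, so the heads start B cells above
the lowest tape address. The memory is still zero, hence blank, and so represents the empty word.
Variable 1 becomes a separate pointer for writing the input, which leaves head 0 on its first cell.
-/
theorem setupFrag_does {c D N B : ℕ} (hB : c * (N + 1) ^ D = B) (hN : N + 1 ≤ B)
    {inp : List ℤ} {hs : HS} (hvar : hs.var 5 = 0) (hmem : ∀ a, hs.mem a = 0)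
    (hinp : hs.inp = (N : ℤ) :: inp) :
    ∃ hs', Does M.numVars (C.bound B) (setupFrag M c D) hs hs' (setupCost M D N) ∧
      Emitted C (origin M B) [] hs' ∧ hs'.var 0 = N ∧ hs'.var 5 = Nat.size (N - 1) ∧
      hs'.inp = inp ∧ hs'.out = hs.out ∧
      ∀ i : Fin M.numTapes, hs'.var (10 + i) = origin M B + (i : ℕ) := by
  obtain ⟨V, hV⟩ : ∃ V, V = C.bound B := ⟨_, rfl⟩
  have hC := C.fits_bound B
  have hor := origin_le_bound C B
  have hBV := le_bound C B
  rw [← hV] at hC hor hBV ⊢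
  have hK := M.stride_pos
  have hKB : 0 ≤ M.stride * B := mul_nonneg hK.le (by positivity)
  have hlow := M.numVars_lt_lowest
  have h10 := one_le_of_fits hC
  have hv : ∀ {v : ℕ}, v < 10 → v < M.numVars := fun h => Room.lt_numVars h
  have hcB : c ≤ B := by
    rw [← hB]
    exact Nat.le_mul_of_pos_right _ (pow_pos (by omega) _)
  have d1 := Does.rd (v := 0) hC.vars (hv (by omega)) hinp
  obtain ⟨hs1, e1⟩ : ∃ hs1, hs1 = { hs.setv 0 (N : ℤ) with inp := inp } := ⟨_, rfl⟩
  rw [← e1] at d1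
  have v10 : hs1.var 0 = N := by rw [e1]; simp [HS.setv]
  have v15 : hs1.var 5 = 0 := by rw [e1]; simp [HS.setv, hvar]
  have m1 : hs1.mem = hs.mem := by rw [e1]; rfl
  have i1 : hs1.inp = inp := by rw [e1]
  have o1 : hs1.out = hs.out := by rw [e1]; rfl
  have d2 := Does.add (h := hs1) (v := 7) (x := .var 0) (y := .lit 1) hC.vars
    (hv (by omega)) (hv (by omega)) (by simp only [Src.Ok, abs_one]; exact_mod_cast (by omega : 1 ≤ V))
    (by simp only [Src.val, v10]; rw [abs_le]; omega)
  have e2 : (Src.var 0).val hs1 + (Src.lit 1).val hs1 = (N + 1 : ℕ) := by simp [Src.val, v10]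
  rw [e2] at d2
  have d3 := Does.mov (h := hs1.setv 7 (N + 1 : ℕ)) (v := 6) (x := .lit c) hC.vars (hv (by omega))
    (by simp only [Src.Ok, Nat.abs_cast]; exact_mod_cast (by omega : c ≤ V))
  simp only [Src.val] at d3
  have d4 := powFrag_does hC (hs := hs1.setv 7 (N + 1 : ℕ)) (D := D) (a := c) (x := N + 1)
    (by simp [HS.setv_var]) (by omega) (by omega)
  rw [hB] at d4
  have d5 := Does.mul (h := (hs1.setv 7 (N + 1 : ℕ)).setv 6 B) (v := 6) (x := .var 6)
    (y := .lit M.stride) hC.vars (hv (by omega)) (hv (by omega))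
    (by
      simp only [Src.Ok, abs_of_pos hK]
      have := hC.vars
      unfold stride
      unfold numVars at this
      exact_mod_cast (by omega : M.numTapes ≤ V))
    (by
      simp only [Src.val, HS.setv_var, if_true]
      rw [mul_comm, abs_of_nonneg hKB]
      unfold origin at hor
      omega)
  obtain ⟨hs5, e5⟩ : ∃ hs5, hs5 = ((hs1.setv 7 (N + 1 : ℕ)).setv 6 B).setv 6
    ((Src.var 6).val ((hs1.setv 7 (N + 1 : ℕ)).setv 6 B) *
      (Src.lit M.stride).val ((hs1.setv 7 (N + 1 : ℕ)).setv 6 B)) := ⟨_, rfl⟩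
  rw [← e5] at d5
  have v56 : hs5.var 6 = origin M B - M.lowest := by
    rw [e5]
    simp only [Src.val, HS.setv_var, if_true, origin]
    ring
  have v50 : hs5.var 0 = N := by rw [e5]; simp [HS.setv_var, v10]
  have v55 : hs5.var 5 = 0 := by rw [e5]; simp [HS.setv_var, v15]
  have m5 : hs5.mem = hs1.mem := by rw [e5]; rfl
  have i5 : hs5.inp = hs1.inp := by rw [e5]; rfl
  have o5 : hs5.out = hs1.out := by rw [e5]; rfl
  obtain ⟨hs6, d6, g6, f6, m6, i6, o6⟩ := headsFrag_does hC (h0 := origin M B)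
    (by unfold origin; omega) (by linarith) (List.finRange _) v56
  rw [List.length_finRange] at d6
  have v60 : hs6.var 0 = N := by rw [f6 0 (fun i _ => by omega), v50]
  have v65 : hs6.var 5 = 0 := by rw [f6 5 (fun i _ => by omega), v55]
  have v6h : ∀ i : Fin M.numTapes, hs6.var (10 + i) = origin M B + (i : ℕ) :=
    fun i => g6 i (List.mem_finRange i)
  have v610 : hs6.var 10 = origin M B := by
    have := v6h ⟨0, by unfold numTapes; omega⟩
    simpa using this
  have d7 := Does.mov (h := hs6) (v := 1) (x := .var 10) hC.vars (hv (by omega))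
    (show 10 < M.numVars by unfold numVars numTapes; omega)
  simp only [Src.val, v610] at d7
  have d8 := Does.sub (h := hs6.setv 1 (origin M B)) (v := 7) (x := .var 0) (y := .lit 1) hC.vars
    (hv (by omega)) (hv (by omega)) (by simp only [Src.Ok, abs_one]; exact_mod_cast (by omega : 1 ≤ V))
    (by simp only [Src.val, HS.setv_var, v60]; rw [if_neg (by omega), abs_le]; omega)
  have e8 : (Src.var 0).val (hs6.setv 1 (origin M B)) - (Src.lit 1).val (hs6.setv 1 (origin M B)) =
      (N : ℤ) - 1 := by simp [Src.val, HS.setv_var, v60]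
  rw [e8] at d8
  obtain ⟨hs9, d9, s9, k9, m9, i9⟩ := sizeFrag_does hC
    (hs := (hs6.setv 1 (origin M B)).setv 7 ((N : ℤ) - 1)) (u := N - 1)
    (by rw [HS.setv_var, if_pos rfl]; omega) (by omega) (by simp [HS.setv_var, v65])
  have hsz := CliqueOp.size_pred_le N
  have hm9 : ∀ a, hs9.mem a = 0 := by
    intro a
    have : hs9.mem = hs.mem := m9.trans (m6.trans (m5.trans m1))
    rw [this, hmem]
  refine ⟨hs9, (d1.seq (d2.seq (d3.seq (d4.seq (d5.seq (d6.seq (d7.seq (d8.seq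
    (d9.seq .skip))))))))).mono ?_, ⟨?_, ?_, ?_⟩, ?_, s9, ?_, ?_, ?_⟩
  · unfold setupCost
    omega
  · rw [k9.var 1 (by decide)]
    simp [HS.setv_var]
  · intro j _
    rw [hm9, bitTape_nth]
    simp [C.sym_none]
  · intro a _ _
    exact hm9 a
  · rw [k9.var 0 (by decide)]
    simp [HS.setv_var, v60]
  · exact i9.trans (i6.trans (i5.trans i1))
  · exact k9.out.trans (o6.trans (o5.trans o1))
  · intro i
    rw [k9.var _ (by simp; omega), HS.setv_var, if_neg (by omega), HS.setv_var, if_neg (by omega)]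
    exact v6h i

end MultiTapeTM

/-! ### The run from the graph to the answer -/

namespace MultiTapeTM

open RAM Turing

variable {M : MultiTapeTM} {C : M.Coding} {V m : ℕ}

/-- The word occupies the residue class of tape 0. In all other classes the memory is blank, which
is right for the work tapes and also for the oracle tape, since a deterministic machine receives no
oracle bits. -/
theorem simRel_init {B : ℕ} {w : List Bool} {hs : HS} (he : Emitted C (origin M B) w hs)
    (hh : ∀ i : Fin M.numTapes, hs.var (10 + i) = origin M B + (i : ℕ)) {R : ℕ} (hR : R ≤ B) :
    SimRel C (C.bound B) ((hs.setv 8 (C.st M.start)).setv 9 (verdictCode (M.verdict M.start)))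
      (M.init w []) R where
  st := by simp [HS.setv_var, init]
  verdict := by simp [HS.setv_var, init]
  tapes i := by
    have hK := M.stride_pos
    have hor := origin_le_bound C B
    have hi := i.2
    have hiK : ((i : ℕ) : ℤ) < M.stride := by unfold stride; exact_mod_cast hi
    have hRB : M.stride * R ≤ M.stride * B :=
      mul_le_mul_of_nonneg_left (by exact_mod_cast hR) hK.le
    refine TapeRep.congr (hs := hs) ?_ (by
      rw [HS.setv_var, if_neg (by omega), HS.setv_var, if_neg (by omega)]) rfl
    refine ⟨?_, ?_, ?_, ?_⟩
    · rw [hh, origin, lowest, ← mul_add, Int.mul_add_emod_self_left]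
      exact Int.emod_eq_of_lt (by positivity) hiK
    · rw [hh, origin]
      omega
    · rw [hh]
      have : ((i : ℕ) : ℤ) < M.numTapes := by exact_mod_cast hi
      linarith
    · intro p hp
      rw [hh] at hp ⊢
      by_cases hi0 : i.val = 0
      · rw [hi0] at hp ⊢
        simp only [Nat.cast_zero, add_zero] at hp ⊢
        rw [he.cells p hp]
        simp only [init, hi0, if_true]
      · rw [he.blank _ hp]
        · have : (M.init w []).tapes i = M.bitTape [] := by
            simp only [init, hi0, if_false, ite_self]
          rw [this, bitTape_nth]
          simp [C.sym_none]
        · rw [show origin M B + (i : ℕ) + M.stride * p - origin M B = (i : ℕ) + M.stride * p by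
            ring, dvd_add_left (dvd_mul_right _ _)]
          intro hd
          have := Int.le_of_dvd (by omega) hd
          omega

/-- Run the machine on the input of the clique machine. -/
noncomputable def runFrag (C : M.Coding) (m c D : ℕ) : Frag :=
  Frag.seqs [setupFrag M c D, graphFrag C m, Frag.mov 8 (.lit (C.st M.start)),
    Frag.mov 9 (.lit (verdictCode (M.verdict M.start))), Frag.loop 9 (stepFrag C),
    Frag.add 7 (.var 9) (.lit 1), Frag.wr (.var 7)]

/-- The number of instructions of the whole run for `N` vertices and `R` steps of the machine. -/
noncomputable def runCost (C : M.Coding) (m D N R : ℕ) : ℕ :=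
  setupCost M D N + graphCost m N + R * (stepCost C + 3) + 11

theorem runFrag_does {c D N B R : ℕ} {adj : ℕ → ℕ → Bool} (hB : c * (N + 1) ^ D = B)
    (hN : N + 1 ≤ B) (hR : R ≤ B)
    (hL : ((CliqueOp.graphOps m N adj).flatMap CliqueOp.code).length ≤ B) {b : Bool}
    (hM : M.HaltsWithin ((CliqueOp.graphOps m N adj).flatMap CliqueOp.code) [] b R)
    {hs : HS} (hvar : hs.var 5 = 0) (hmem : ∀ a, hs.mem a = 0) (hout : hs.out = [])
    (hinp : hs.inp = (N : ℤ) :: (List.range N).flatMap fun i => (List.range N).map fun j =>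
      bitInt (adj i j)) :
    ∃ hs', Does M.numVars (C.bound B) (runFrag C m c D) hs hs' (runCost C m D N R) ∧
      hs'.out = [if b then 1 else 0] := by
  obtain ⟨hs1, d1, e1, v10, v15, i1, o1, hh1⟩ := setupFrag_does (C := C) hB hN hvar hmem hinp
  have hC := C.fits_bound B
  have hor := origin_le_bound C B
  have hBV := le_bound C B
  have hK := M.stride_pos
  have hLB : M.stride * (((CliqueOp.graphOps m N adj).flatMap CliqueOp.code).length : ℤ) ≤
      M.stride * B := mul_le_mul_of_nonneg_left (by exact_mod_cast hL) hK.le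
  have hKB : 0 ≤ M.stride * B := mul_nonneg hK.le (by positivity)
  have room : Room C (C.bound B) (origin M B)
      ((CliqueOp.graphOps m N adj).flatMap CliqueOp.code) := by
    refine ⟨hC, by unfold origin; omega, ?_⟩
    have : (0 : ℤ) ≤ M.numTapes := by positivity
    linarith
  obtain ⟨hs2, d2, e2, k2⟩ := graphFrag_does room e1 v10 v15 (by omega) i1
  have hh2 : ∀ i : Fin M.numTapes, hs2.var (10 + i) = origin M B + (i : ℕ) := fun i => by
    rw [k2.var _ (by simp; omega), hh1]
  have hv : ∀ {v : ℕ}, v < 10 → v < M.numVars := fun h => Room.lt_numVars h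
  have d3 := Does.mov (h := hs2) (v := 8) (x := .lit (C.st M.start)) hC.vars (hv (by omega))
    (by
      simp only [Src.Ok, Nat.abs_cast]
      exact_mod_cast (C.st_lt _).le.trans hC.states)
  have d4 := Does.mov (h := hs2.setv 8 (C.st M.start)) (v := 9)
    (x := .lit (verdictCode (M.verdict M.start))) hC.vars (hv (by omega))
    ((abs_verdictCode_le _).trans (by exact_mod_cast (by have := one_le_of_fits hC; omega :
      1 ≤ C.bound B)))
  obtain ⟨hs5, d5, v5, o5⟩ := simulate_does hC le_rfl hM (simRel_init e2 hh2 hR)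
  have h10 := one_le_of_fits hC
  -- The verdict codes 0 and −1 were chosen so that adding one gives the required output.
  have e6 : (Src.var 9).val hs5 + (Src.lit 1).val hs5 = if b then 1 else 0 := by
    simp only [Src.val, v5]
    cases b <;> rfl
  have d6 := Does.add (h := hs5) (v := 7) (x := .var 9) (y := .lit 1) hC.vars (hv (by omega))
    (hv (by omega)) (by simp only [Src.Ok, abs_one]; exact_mod_cast (by omega : 1 ≤ C.bound B))
    (by
      rw [e6]
      cases b
      · simp
      · simp only [if_true, abs_one]; exact_mod_cast (by omega : 1 ≤ C.bound B))
  rw [e6] at d6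
  have d7 := Does.wr (h := hs5.setv 7 (if b then 1 else 0)) (x := .var 7) hC.vars
    (show 7 < M.numVars from hv (by omega))
  refine ⟨_, (d1.seq (d2.seq (d3.seq (d4.seq (d5.seq (d6.seq (d7.seq .skip))))))).mono ?_, ?_⟩
  · unfold runCost
    omega
  · have : hs5.out = [] := o5.trans (k2.out.trans (o1.trans hout))
    simp [Src.val, HS.setv, this]

/-- The whole program. -/
noncomputable def runProgram (C : M.Coding) (m c D : ℕ) : RAM.Program :=
  (runFrag C m c D).code 0 ++ [.halt]

open Classical in
theorem encodeGraph_eq {N : ℕ} (G : SimpleGraph (Fin N)) :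
    encodeGraph G = (N : ℤ) :: (List.range N).flatMap fun i => (List.range N).map fun j =>
      bitInt (CliqueOp.adjFun G i j) := by
  have e : ∀ i j : Fin N, bitInt (CliqueOp.adjFun G i j) = if G.Adj i j then 1 else 0 := by
    intro i j
    simp only [bitInt, CliqueOp.adjFun_iff]
  rw [encodeGraph, ← List.map_coe_finRange_eq_range]
  simp only [List.flatMap_map, List.map_map, Function.comp_def, e]

/-- The initial configuration represents the abstract state that is zero everywhere. The cost is the
number of instructions times the bound 4 · size for each of them, plus one for `halt`. -/
theorem runProgram_computes {c D N B R : ℕ} (G : SimpleGraph (Fin N)) (hB : c * (N + 1) ^ D = B)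
    (hN : N + 1 ≤ B) (hR : R ≤ B) (hL : (CliqueOp.graphWord m G).length ≤ B) {b : Bool}
    (hM : M.HaltsWithin (CliqueOp.graphWord m G) [] b R) :
    ∃ t ≤ 4 * size (C.bound B) * runCost C m D N R + 1,
      Computes (runProgram C m c D) (RAM.init (encodeGraph G)) [if b then 1 else 0] t := by
  have hBV := le_bound C B
  obtain ⟨hs', d, o⟩ := runFrag_does (C := C) hB hN hR hL hM
    (hs := ⟨fun _ => 0, fun _ => 0, encodeGraph G, []⟩) rfl (fun _ => rfl) rfl (encodeGraph_eq G)
  obtain ⟨c', hpc, hr, n, hn, hsteps⟩ := d (runProgram C m c D) 0 (fun i x hx => by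
    rw [zero_add, runProgram, List.getElem?_append_left]
    · exact hx
    · by_contra hi
      rw [List.getElem?_eq_none (by omega)] at hx
      simp at hx) (RAM.init (encodeGraph G)) rfl
    ⟨fun _ _ => rfl, fun _ _ => rfl, rfl, rfl, fun j => by simp [RAM.init], by
      intro z hz
      rw [RAM.init, encodeGraph_eq] at hz
      have h1 : ((1 : ℕ) : ℤ) ≤ C.bound B := by exact_mod_cast (by omega : 1 ≤ C.bound B)
      simp only [List.mem_cons, List.mem_flatMap, List.mem_map] at hz
      rcases hz with rfl | ⟨i, -, j, -, rfl⟩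
      · rw [Nat.abs_cast]
        exact_mod_cast (by omega : N ≤ C.bound B)
      · unfold bitInt
        split
        · rw [abs_one]; exact h1
        · rw [abs_zero]; positivity⟩
  have hh : (runProgram C m c D)[c'.pc]? = some .halt := by
    rw [hpc, zero_add, runProgram, ← (runFrag C m c D).length_code 0]
    simp
  obtain ⟨t, ht, hcomp⟩ := hsteps.computes (Computes.halt hh)
  rw [hr.out, o] at hcomp
  exact ⟨t, ht.trans (by gcongr), hcomp⟩

end MultiTapeTM

/-! ### Asymptotic bounds -/

/-- The program must be correct for every N, so the asymptotic bound is made uniform: the finitely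
many exceptional values are summed into the constant, and n + 1 keeps the power at least 1. -/
theorem exists_forall_le_mul_rpow {T : ℕ → ℕ} {c : ℝ} (hc : 0 ≤ c)
    (hT : (fun n => (T n : ℝ)) =O[atTop] fun n => (n : ℝ) ^ c) :
    ∃ K : ℕ, ∀ n, (T n : ℝ) ≤ K * ((n : ℝ) + 1) ^ c := by
  obtain ⟨a, ha⟩ := hT.bound
  obtain ⟨n0, hn0⟩ := eventually_atTop.1 ha
  refine ⟨⌈|a|⌉₊ + ∑ j ∈ Finset.range n0, T j, fun n => ?_⟩
  have h1 : (1 : ℝ) ≤ ((n : ℝ) + 1) ^ c := Real.one_le_rpow (by linarith [n.cast_nonneg (α := ℝ)]) hc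
  push_cast
  rw [add_mul]
  by_cases hn : n0 ≤ n
  · have h2 := hn0 n hn
    rw [Real.norm_of_nonneg (by positivity), Real.norm_of_nonneg (by positivity)] at h2
    have h3 : (n : ℝ) ^ c ≤ ((n : ℝ) + 1) ^ c :=
      Real.rpow_le_rpow (by positivity) (by linarith) hc
    have h4 : a * (n : ℝ) ^ c ≤ ⌈|a|⌉₊ * ((n : ℝ) + 1) ^ c :=
      mul_le_mul ((le_abs_self a).trans (Nat.le_ceil _)) h3 (by positivity) (by positivity)
    have h5 : (0 : ℝ) ≤ (∑ j ∈ Finset.range n0, (T j : ℝ)) * ((n : ℝ) + 1) ^ c := by positivity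
    linarith
  · have h2 : (T n : ℝ) ≤ ∑ j ∈ Finset.range n0, (T j : ℝ) :=
      Finset.single_le_sum (f := fun j => (T j : ℝ)) (fun _ _ => by positivity)
        (Finset.mem_range.2 (by omega))
    have h3 : (0 : ℝ) ≤ ∑ j ∈ Finset.range n0, (T j : ℝ) := by positivity
    have h4 := le_mul_of_one_le_right h3 h1
    have h5 : (0 : ℝ) ≤ ⌈|a|⌉₊ * ((n : ℝ) + 1) ^ c := by positivity
    linarith

theorem tendsto_log_log_div_log :
    Tendsto (fun N : ℕ => Real.log (Real.log N) / Real.log N) atTop (𝓝 0) :=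
  Real.isLittleO_log_id_atTop.tendsto_div_nhds_zero.comp
    (Real.tendsto_log_atTop.comp tendsto_natCast_atTop_atTop)

/-- As N to the power log log N / log N is log N, the factor from the logarithmic cost is absorbed
by an exponent that tends to 0. -/
theorem rpow_add_log_log_div_log (d : ℝ) {N : ℕ} (hN : 2 ≤ N) :
    (N : ℝ) ^ (d + Real.log (Real.log N) / Real.log N) = (N : ℝ) ^ d * Real.log N := by
  have h1 : (1 : ℝ) < N := by exact_mod_cast hN
  have h2 : 0 < Real.log N := Real.log_pos h1
  rw [Real.rpow_add (by linarith), Real.rpow_def_of_pos (by linarith : (0 : ℝ) < N)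
    (Real.log (Real.log N) / Real.log N), mul_div_cancel₀ _ h2.ne', Real.exp_log h2]

theorem log_succ_isBigO :
    (fun N : ℕ => ((Nat.log 2 (N + 1) + 1 : ℕ) : ℝ)) =O[atTop] fun N : ℕ => Real.log N := by
  refine IsBigO.of_bound (3 / Real.log 2) ?_
  filter_upwards [eventually_ge_atTop 2] with N hN
  have h2 : (2 : ℝ) ≤ N := by exact_mod_cast hN
  have hl2 : 0 < Real.log 2 := Real.log_pos (by norm_num)
  have hlN : Real.log 2 ≤ Real.log N := Real.log_le_log (by norm_num) h2
  rw [Real.norm_of_nonneg (by positivity), Real.norm_of_nonneg (by linarith)]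
  have h3 : (Nat.log 2 (N + 1) : ℝ) ≤ Real.logb 2 ((N + 1 : ℕ) : ℝ) := by
    exact_mod_cast Real.natLog_le_logb (N + 1) 2
  have h4 : Real.log ((N + 1 : ℕ) : ℝ) ≤ 2 * Real.log N := by
    have : Real.log ((N : ℝ) ^ 2) = 2 * Real.log N := by rw [Real.log_pow]; norm_num
    rw [← this]
    refine Real.log_le_log (by positivity) ?_
    push_cast
    nlinarith
  have h5 : Real.logb 2 ((N + 1 : ℕ) : ℝ) ≤ 2 * Real.log N / Real.log 2 := by
    rw [Real.logb]
    gcongr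
  have h6 : 1 ≤ Real.log N / Real.log 2 := (one_le_div hl2).2 hlN
  push_cast
  calc (Nat.log 2 (N + 1) : ℝ) + 1 ≤ 2 * Real.log N / Real.log 2 + Real.log N / Real.log 2 := by
        linarith
    _ = 3 / Real.log 2 * Real.log N := by ring

theorem succ_rpow_isBigO {d : ℝ} (hd : 0 ≤ d) :
    (fun N : ℕ => ((N : ℝ) + 1) ^ d) =O[atTop] fun N : ℕ => (N : ℝ) ^ d := by
  refine IsBigO.of_bound (2 ^ d) ?_
  filter_upwards [eventually_ge_atTop 1] with N hN
  have h1 : (1 : ℝ) ≤ N := by exact_mod_cast hN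
  rw [Real.norm_of_nonneg (by positivity), Real.norm_of_nonneg (by positivity),
    ← Real.mul_rpow (by norm_num) (by positivity)]
  exact Real.rpow_le_rpow (by positivity) (by linarith) hd

/-! ### From deterministic time to clique detection -/

namespace MultiTapeTM

open RAM

variable {M : MultiTapeTM}

/-- All numbers in the run are polynomially bounded in N, with constants depending on the machine,
so their length is O(log N). -/
theorem exists_size_bound_le (C : M.Coding) (c D : ℕ) :
    ∃ k : ℕ, ∀ N : ℕ, size (C.bound (c * (N + 1) ^ D)) ≤ k * (Nat.log 2 (N + 1) + 1) := by
  obtain ⟨E, hE⟩ : ∃ E : ℕ, ∀ N : ℕ, C.bound (c * (N + 1) ^ D) ≤ E * (N + 1) ^ D := by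
    refine ⟨2 * (M.numTapes * c) + (M.numTapes * (M.numVars + 1) + M.numTapes + M.numVars +
      C.numSym + C.numSt), fun N => ?_⟩
    rw [add_mul]
    refine add_le_add (le_of_eq (by ring)) (Nat.le_mul_of_pos_right _ (by positivity))
  refine ⟨E + D + 1, fun N => ?_⟩
  have h1 : C.bound (c * (N + 1) ^ D) ≤ 2 ^ (E + D * (Nat.log 2 (N + 1) + 1)) := by
    refine (hE N).trans ?_
    rw [pow_add, mul_comm D, pow_mul]
    exact Nat.mul_le_mul Nat.lt_two_pow_self.le
      (Nat.pow_le_pow_left (Nat.lt_pow_succ_log_self (by norm_num) _).le _)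
  have h2 := Nat.log_mono_right (b := 2) h1
  rw [Nat.log_pow (by norm_num)] at h2
  unfold size
  rw [Int.natAbs_natCast]
  nlinarith

/-- Writing the word takes O(N²) instructions, and each simulated step takes a number of
instructions that depends on the machine only. -/
theorem exists_runCost_le (C : M.Coding) (m D : ℕ) :
    ∃ k : ℕ, ∀ N R : ℕ, runCost C m D N R ≤ k * ((N + 1) ^ 2 + R) := by
  refine ⟨(3 * D + 3 * M.numTapes + 20 + 9) + ((2 * (opCost m * m) + 26) + (16 + opCost m + 3) +
    (opCost m + 6) + (2 * opCost m + 16) + (19 + opCost m + 3) + 15) + (stepCost C + 3) + 11,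
    fun N R => ?_⟩
  unfold runCost setupCost graphCost
  generalize stepCost C + 3 = s
  generalize 2 * (opCost m * m) + 26 = a1
  generalize 2 * opCost m + 16 = a2
  generalize opCost m + 6 = a3
  have h1 : N ≤ (N + 1) ^ 2 := by nlinarith
  have h2 : N * N ≤ (N + 1) ^ 2 := by nlinarith
  have h3 : 1 ≤ (N + 1) ^ 2 := Nat.one_le_pow _ _ (by omega)
  generalize (N + 1) ^ 2 = Q at *
  generalize opCost m = q
  generalize M.numTapes = τ
  calc _ = (3 * D + 3 * τ + 20 + 15 + 11) * 1 + (9 + (16 + q + 3) + a3 + (19 + q + 3)) * N +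
        (a1 + a2) * (N * N) + R * s := by ring
    _ ≤ (3 * D + 3 * τ + 20 + 15 + 11) * Q + (9 + (16 + q + 3) + a3 + (19 + q + 3)) * Q +
        (a1 + a2) * Q + R * s := by gcongr
    _ ≤ _ := by
      rw [mul_add]
      have e : ∀ u : ℕ, R * s ≤ (u + s + 11) * R := fun u => by
        rw [mul_comm]; exact Nat.mul_le_mul_right _ (by omega)
      refine add_le_add ?_ (e _)
      rw [← add_mul, ← add_mul]
      exact Nat.mul_le_mul_right _ (by omega)

end MultiTapeTM

open MultiTapeTM in
/-- A Turing machine for the language of the clique machine yields a RAM program for cliques. -/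
theorem cliqueInTime_of_mem_DTIME {m : ℕ} {c : ℝ} (hc : 1 ≤ c)
    (h : (CliqueOp.machine m).language (fun n => m * ⌈(1 / 2 : ℝ) * Real.logb 2 n⌉₊) ∈
      DTIME fun n => (n : ℝ) ^ c) : CliqueInTime (m + 2) (2 * c) := by
  obtain ⟨M, T, hT, hhalt, hmem⟩ := h
  obtain ⟨C⟩ := nonempty_coding M
  obtain ⟨K, hK⟩ := exists_forall_le_mul_rpow (by linarith) hT
  obtain ⟨L, hL⟩ : ∃ L, L = Nat.card (CliqueOp m) * (2 * m + 3) := ⟨_, rfl⟩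
  -- The word has length at most L (N + 1)², so K (n + 1)^c is at most K (L + 1)^c (N + 1)^(2c).
  obtain ⟨A, hA⟩ : ∃ A, A = ⌈(K : ℝ) * ((L : ℝ) + 1) ^ c⌉₊ := ⟨_, rfl⟩
  obtain ⟨R, hR⟩ : ∃ R : ℕ → ℕ, R = fun N : ℕ => ⌊(A : ℝ) * ((N : ℝ) + 1) ^ (2 * c)⌋₊ := ⟨_, rfl⟩
  -- The program has to compute the position of the tapes, so the exponent is rounded up to an
  -- integer there. This affects only the size of addresses; the running time is governed by R with
  -- the exact exponent 2c.
  obtain ⟨D, hD⟩ : ∃ D, D = ⌈2 * c⌉₊ := ⟨_, rfl⟩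
  have hD2 : 2 ≤ D := by
    have : (2 : ℝ) ≤ D := by
      rw [hD]; exact (by linarith : (2 : ℝ) ≤ 2 * c).trans (Nat.le_ceil _)
    exact_mod_cast this
  have hRle : ∀ N, (R N : ℝ) ≤ A * ((N : ℝ) + 1) ^ (2 * c) := fun N => by
    rw [hR]; exact Nat.floor_le (by positivity)
  have hpow : ∀ N : ℕ, (N + 1) ^ 2 ≤ (N + 1) ^ D := fun N => Nat.pow_le_pow_right (by omega) hD2
  have hRB : ∀ N, R N ≤ (A + L + 1) * (N + 1) ^ D := fun N => by
    have h1 : ((N : ℝ) + 1) ^ (2 * c) ≤ ((N : ℝ) + 1) ^ D := by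
      rw [← Real.rpow_natCast]
      refine Real.rpow_le_rpow_of_exponent_le (by linarith [N.cast_nonneg (α := ℝ)]) ?_
      rw [hD]; exact Nat.le_ceil _
    have h2 : (R N : ℝ) ≤ (A * (N + 1) ^ D : ℕ) := by
      push_cast
      exact (hRle N).trans (by gcongr)
    exact (by exact_mod_cast h2 : R N ≤ A * (N + 1) ^ D).trans
      (Nat.mul_le_mul_right _ (by omega))
  have hTR : ∀ (N : ℕ) (G : SimpleGraph (Fin N)), T (CliqueOp.graphWord m G).length ≤ R N := by
    intro N G
    have h1 := CliqueOp.length_graphWord_le (m := m) G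
    rw [← hL] at h1
    rw [hR]
    refine Nat.le_floor ((hK _).trans ?_)
    have h2 : ((CliqueOp.graphWord m G).length : ℝ) + 1 ≤ ((L : ℝ) + 1) * ((N : ℝ) + 1) ^ 2 := by
      have h3 : (CliqueOp.graphWord m G).length + 1 ≤ (L + 1) * (N + 1) ^ 2 := by
        rw [add_mul, one_mul]
        exact add_le_add h1 (Nat.one_le_pow _ _ (by omega))
      exact_mod_cast h3
    calc (K : ℝ) * (((CliqueOp.graphWord m G).length : ℝ) + 1) ^ c
        ≤ K * (((L : ℝ) + 1) * ((N : ℝ) + 1) ^ 2) ^ c := by gcongr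
      _ = K * ((L : ℝ) + 1) ^ c * ((N : ℝ) + 1) ^ (2 * c) := by
        rw [Real.mul_rpow (by positivity) (by positivity), Real.rpow_mul (by positivity),
          Real.rpow_two, mul_assoc]
      _ ≤ A * ((N : ℝ) + 1) ^ (2 * c) := by
        gcongr
        rw [hA]
        exact Nat.le_ceil _
  -- The factor A + L + 1 makes the distance B at least the simulated time, the length of the word,
  -- and N + 1.
  refine ⟨runProgram C m (A + L + 1) D,
    fun N => 4 * RAM.size (C.bound ((A + L + 1) * (N + 1) ^ D)) * runCost C m D N (R N) + 1,
    fun N => Real.log (Real.log N) / Real.log N, fun N G => ?_, tendsto_log_log_div_log, ?_⟩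
  · obtain ⟨b, hb⟩ := hhalt (CliqueOp.graphWord m G) [] rfl
    have hN : N + 1 ≤ (A + L + 1) * (N + 1) ^ D :=
      ((Nat.le_self_pow (by omega) (N + 1)).trans (hpow N)).trans
        (Nat.le_mul_of_pos_left _ (by omega))
    have hW : (CliqueOp.graphWord m G).length ≤ (A + L + 1) * (N + 1) ^ D := by
      have h1 := CliqueOp.length_graphWord_le (m := m) G
      rw [← hL] at h1
      exact h1.trans (Nat.mul_le_mul (by omega) (hpow N))
    obtain ⟨t, ht, hcomp⟩ := runProgram_computes (C := C) (D := D) G rfl hN (hRB N) hW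
      (hb.mono (hTR N G))
    refine ⟨t, ht, ?_⟩
    convert hcomp using 2
    have key : b = true ↔ ¬ G.CliqueFree (m + 2) := by
      rw [← CliqueOp.graphWord_mem_language, hmem]
      constructor
      · rintro rfl
        exact ⟨[], rfl, hb⟩
      · rintro ⟨y, hy, hacc⟩
        rw [List.length_eq_zero_iff.1 hy] at hacc
        unfold HaltsWithin at hb hacc
        rw [hb] at hacc
        exact Option.some.inj hacc
    by_cases hG : G.CliqueFree (m + 2)
    · rw [if_pos hG, if_neg (by rw [key]; simpa using hG)]
    · rw [if_neg hG, if_pos (key.2 hG)]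
  · obtain ⟨k1, hk1⟩ := exists_size_bound_le C (A + L + 1) D
    obtain ⟨k2, hk2⟩ := exists_runCost_le C m D
    have hcost : (fun N : ℕ => (runCost C m D N (R N) : ℝ)) =O[atTop]
        fun N : ℕ => (N : ℝ) ^ (2 * c) := by
      refine IsBigO.trans (IsBigO.of_bound ((k2 : ℝ) * (1 + A)) (Eventually.of_forall fun N => ?_))
        (succ_rpow_isBigO (by linarith : 0 ≤ 2 * c))
      rw [Real.norm_of_nonneg (by positivity), Real.norm_of_nonneg (by positivity)]
      have h1 : (runCost C m D N (R N) : ℝ) ≤ k2 * (((N : ℝ) + 1) ^ 2 + R N) := by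
        exact_mod_cast hk2 N (R N)
      -- Here c ≥ 1 is essential: it makes the quadratic cost of writing the word negligible.
      have h2 : ((N : ℝ) + 1) ^ 2 ≤ ((N : ℝ) + 1) ^ (2 * c) := by
        rw [← Real.rpow_two]
        exact Real.rpow_le_rpow_of_exponent_le (by linarith [N.cast_nonneg (α := ℝ)])
          (by linarith)
      refine h1.trans ?_
      rw [mul_assoc]
      refine mul_le_mul_of_nonneg_left ?_ (by positivity)
      linarith [hRle N]
    have hsize : (fun N : ℕ => (RAM.size (C.bound ((A + L + 1) * (N + 1) ^ D)) : ℝ)) =O[atTop]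
        fun N : ℕ => Real.log N := by
      refine IsBigO.trans (IsBigO.of_bound (k1 : ℝ) (Eventually.of_forall fun N => ?_))
        log_succ_isBigO
      rw [Real.norm_of_nonneg (by positivity), Real.norm_of_nonneg (by positivity)]
      exact_mod_cast hk1 N
    have hprod := hcost.mul hsize
    have hone : (fun N : ℕ => (4 * RAM.size (C.bound ((A + L + 1) * (N + 1) ^ D)) *
        runCost C m D N (R N) + 1 : ℝ)) =O[atTop] fun N : ℕ =>
        (runCost C m D N (R N) : ℝ) * RAM.size (C.bound ((A + L + 1) * (N + 1) ^ D)) := by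
      refine IsBigO.of_bound 5 (Eventually.of_forall fun N => ?_)
      rw [Real.norm_of_nonneg (by positivity), Real.norm_of_nonneg (by positivity)]
      have h1 : 1 ≤ RAM.size (C.bound ((A + L + 1) * (N + 1) ^ D)) := RAM.one_le_size _
      have h2 : 1 ≤ runCost C m D N (R N) := by unfold runCost; omega
      have h3 : (1 : ℝ) ≤ (runCost C m D N (R N) : ℝ) *
          RAM.size (C.bound ((A + L + 1) * (N + 1) ^ D)) := by
        exact_mod_cast Nat.mul_pos h2 h1
      linarith
    refine IsBigO.congr' (hone.trans hprod) (Eventually.of_forall fun N => by push_cast; rfl) ?_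
    filter_upwards [eventually_ge_atTop 2] with N hN
    exact (rpow_add_log_log_div_log _ hN).symm

/-! ### The theorem -/

theorem mainTheorem7 (K : Type*) [Field K] (l : ℕ) (hl : 3 ≤ l) (hdvd : 3 ∣ l)
    (hard : ∀ ε : ℝ, 0 < ε → ¬ CliqueInTime l (matMulExponent K * l / 3 - ε))
    (ε' : ℝ) (hε' : 0 < ε') :
    ¬ NDTIME (fun n => (l - 2) * ⌈(1 / 2 : ℝ) * Real.logb 2 n⌉₊) (fun n => (n : ℝ)) ⊆
      DTIME (fun n => (n : ℝ) ^ (matMulExponent K * l / 6 - ε')) := by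
  intro hsub
  -- Sublinear exponents are refuted without the hardness assumption; for the others the reduction
  -- from cliques applies.
  by_cases hc : matMulExponent K * l / 6 - ε' < 1
  · exact not_NDTIME_subset_DTIME_of_lt_one _ hc hsub
  · have h := cliqueInTime_of_mem_DTIME (not_lt.1 hc)
      (hsub ((CliqueOp.machine (l - 2)).language_mem_NDTIME _))
    rw [Nat.sub_add_cancel (by omega : 2 ≤ l)] at h
    -- The loss doubles because the word has quadratic length: 2 (ωℓ/6 − ε') = ωℓ/3 − 2ε'.
    refine hard (2 * ε') (by positivity) ?_
    convert h using 1
    ring
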